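/- **Setting.** An overlap structure is a pair $(\xi,Q)$, where $\xi=(\xi_1\ge\xi_2\ge\dots\ge 0)$ with $\sum_i\xi_i\le 1$ and $Q=(q_{ij})_{i,j\ge1}$ is a real symmetric positive semi-definite matrix with $q_{ii}=1$ for all $i$. A random overlap structure (ROSt) is a random variable with values in the space of overlap structures (with the $\sigma$-algebra generated by the coordinates). For an integer $r\ge 1$ and a function $g:\mathbb{R}\to\mathbb{R}$, the evolution $\Phi_r$ with function $g$ is the random map $$(\xi,Q)\mapsto\left(\Big(\frac{\xi_{\pi(i)}e^{g(\kappa_{\pi(i)})}}{\sum_j\xi_je^{g(\kappa_j)}}\Big)_{i\ge1},\ (q_{\pi(i)\pi(j)})_{i,j\ge1}\right),$$ where, given $(\xi,Q)$, $\kappa=(\kappa_i)_{i\ge1}$ is a centered Gaussian field with covariance $(q_{ij}^r)_{i,j}$, and $\pi$ is the permutation that puts the new weights in decreasing order (equal weights keep their order; a quotient with zero denominator is read as $0$). A ROSt is quasi-stationary under $\Phi_r$ if $\Phi_r(\xi,Q)$ has the same law as $(\xi,Q)$. It is ergodic under $\Phi_r$ if every bounded measurable real function $f$ of overlap structures with $\mathbb{E}[f(\Phi_r(\xi,Q))\mid\xi,Q]=f(\xi,Q)$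 almost surely is almost surely constant. For a bounded measurable function $H$ of the overlaps of $s$ points put $$\mathbb{E}^{(s)}[H(q)]:=\mathbb{E}\Big[\sum_{i_1,\dots,i_s\ge1}\xi_{i_1}\cdots\xi_{i_s}\,H\big((q_{i_li_{l'}})_{1\le l,l'\le s}\big)\Big].$$ **Proposition (moment Ghirlanda–Guerra identities).** Let $\psi\in C^2(\mathbb{R})$ have bounded first and second derivatives, and suppose that, for $Y$ a standard Gaussian variable, the law of $\psi(Y)$ is absolutely continuous with respect to Lebesgue measure. Let $h\in\mathbb{R}$ with $\psi'(h)\ne0$, let $r\ge1$ be an integer, and let $J\subseteq\mathbb{R}$ be an interval that contains $0$ and does not consist of $0$ alone. Let $(\xi,Q)$ be a ROSt that is quasi-stationary under $\Phi_r$ with function $\kappa\mapsto\psi(\beta\kappa+h)$ for every $\beta\in J$, and ergodic under these evolutions for every $\beta\in J\setminus\{0\}$. Then, for every integer $s\ge1$ and every bounded measurable function $F_s$ of the overlaps of $s$ points, $$\mathbb{E}^{(s+1)}\big[q^r_{s,s+1}F_s(q)\big]=\frac1s\,\mathbb{E}^{(2)}\big[q^r_{12}\big]\,\mathbb{E}^{(s)}\big[F_s(q)\big]+\frac1s\sum_{l=1}^{s-1}\mathbb{E}^{(s)}\big[q^r_{ls}F_s(q)\big],$$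 where, on the left, $F_s$ is evaluated at the overlaps of the first $s$ of the $s+1$ points. -/

import Mathlib

open MeasureTheory ProbabilityTheory

/-- The space of overlap structures: pairs `(ξ, Q)` where `ξ` is a non-increasing sequence of
non-negative reals of total mass at most one and `Q` is an infinite (symmetric) positive
semi-definite real matrix with ones on the diagonal. Particles are indexed by `ℕ`, from `0`.
The `σ`-algebra is the one generated by the coordinates. -/
abbrev OverlapStructure : Type :=
  {x : (ℕ → ℝ) × (ℕ → ℕ → ℝ) // Antitone x.1 ∧ (∀ i, 0 ≤ x.1 i) ∧ Summable x.1 ∧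
    ∑' i, x.1 i ≤ 1 ∧ Matrix.PosSemidef (Matrix.of x.2) ∧ ∀ i, x.2 i i = 1}

namespace OverlapStructure

/-- The weight `ξ_i` of the `i`-th particle. -/
def weight (x : OverlapStructure) (i : ℕ) : ℝ := x.1.1 i

/-- The overlap `q_{ij}` of the `i`-th and the `j`-th particle. -/
def overlap (x : OverlapStructure) (i j : ℕ) : ℝ := x.1.2 i j

lemma measurable_weight (i : ℕ) : Measurable fun x : OverlapStructure => x.weight i := by
  unfold weight; fun_prop

lemma measurable_overlap (i j : ℕ) : Measurable fun x : OverlapStructure => x.overlap i j := by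
  unfold overlap; fun_prop

end OverlapStructure

section Gaussian

/-- `ν` is the law of a centered Gaussian field `(κ_i)` with covariance `C`. -/
structure IsCenteredGaussianField (C : ℕ → ℕ → ℝ) (ν : Measure (ℕ → ℝ)) : Prop where
  gaussian : IsGaussianProcess (fun (i : ℕ) (κ : ℕ → ℝ) => κ i) ν
  mean_zero : ∀ i, ∫ κ, κ i ∂ν = 0
  covariance_eq : ∀ i j, cov[fun κ : ℕ → ℝ => κ i, fun κ : ℕ → ℝ => κ j; ν] = C i j

/-- Successive residuals of the Cholesky decomposition of an infinite matrix. -/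
noncomputable def choleskyResidual (C : ℕ → ℕ → ℝ) : ℕ → ℕ → ℕ → ℝ
  | 0 => C
  | n + 1 => fun i j => choleskyResidual C n i j -
      choleskyResidual C n i n * choleskyResidual C n n j / choleskyResidual C n n n

/-- The Cholesky factor of an infinite matrix. -/
noncomputable def choleskyFactor (C : ℕ → ℕ → ℝ) (i n : ℕ) : ℝ :=
  choleskyResidual C n i n / Real.sqrt (choleskyResidual C n n n)

lemma posSemidef_sum_nonneg {M : Matrix ℕ ℕ ℝ} (hM : M.PosSemidef) (s : Finset ℕ) (c : ℕ → ℝ) :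
    0 ≤ ∑ i ∈ s, ∑ j ∈ s, c i * M i j * c j := by
  classical
  have h := hM.2 (Finsupp.onFinset s (fun i => if i ∈ s then c i else 0) (by simp +contextual))
  rw [Finsupp.sum_of_support_subset _ Finsupp.support_onFinset_subset _ (by simp)] at h
  refine h.trans_eq (Finset.sum_congr rfl fun i hi => ?_)
  rw [Finsupp.sum_of_support_subset _ Finsupp.support_onFinset_subset _ (by simp)]
  refine Finset.sum_congr rfl fun j hj => ?_
  simp [hi, hj]

lemma posSemidef_sq_le {M : Matrix ℕ ℕ ℝ} (hM : M.PosSemidef) (i j : ℕ) :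
    M i j ^ 2 ≤ M i i * M j j := by
  have h := (hM.submatrix ![i, j]).det_nonneg
  have hs : M j i = M i j := by simpa using hM.1.apply i j
  rw [Matrix.det_fin_two] at h
  simp [hs] at h
  nlinarith

lemma posSemidef_residual_step {M : Matrix ℕ ℕ ℝ} (hM : M.PosSemidef) (n : ℕ) :
    (Matrix.of fun i j => M i j - M i n * M n j / M n n).PosSemidef := by
  have hs : ∀ i j, M j i = M i j := fun i j => by simpa using hM.1.apply i j
  refine ⟨?_, fun x => ?_⟩
  · ext i j
    simp [Matrix.conjTranspose_apply, hs i j, hs n i, hs n j, mul_comm]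
  · rcases eq_or_ne (M n n) 0 with h0 | h0
    · simpa [h0] using hM.2 x
    · classical
      set s := insert n x.support with hsdef
      have hn : n ∈ s := Finset.mem_insert_self _ _
      set L : ℝ := ∑ i ∈ s, x i * M i n with hL
      have hL' : ∑ i ∈ s, M n i * x i = L :=
        Finset.sum_congr rfl fun i _ => by rw [hs i n, mul_comm]
      have key := posSemidef_sum_nonneg hM s
        (fun i => x i + if i = n then -(L / M n n) else 0)
      have e1 : ∑ i ∈ s, ∑ j ∈ s, (x i + if i = n then -(L / M n n) else 0) * M i j *
          (x j + if j = n then -(L / M n n) else 0) =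
          (∑ i ∈ s, ∑ j ∈ s, x i * M i j * x j) - L * L / M n n := by
        have : ∀ i ∈ s, ∑ j ∈ s, (x i + if i = n then -(L / M n n) else 0) * M i j *
          (x j + if j = n then -(L / M n n) else 0) =
          (∑ j ∈ s, x i * M i j * x j) + x i * M i n * (-(L / M n n)) +
          (if i = n then -(L / M n n) * (∑ j ∈ s, M n j * x j) +
            (-(L / M n n)) * M n n * (-(L / M n n)) else 0) := by
          intro i _
          split_ifs with h
          · subst h
            simp only [mul_add, add_mul, Finset.sum_add_distrib, mul_ite, mul_zero,
              Finset.sum_ite_eq', hn, if_true, Finset.mul_sum, mul_assoc]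
            ring
          · simp only [mul_add, add_zero, Finset.sum_add_distrib, mul_ite, mul_zero,
              Finset.sum_ite_eq', hn, if_true]
        rw [Finset.sum_congr rfl this]
        simp only [Finset.sum_add_distrib, ← Finset.sum_mul, Finset.sum_ite_eq', hn, if_true, hL',
          ← hL]
        field_simp
        ring
      rw [e1] at key
      rw [Finsupp.sum_of_support_subset x (Finset.subset_insert n _) _ (by simp)]
      have e2 : ∀ i ∈ s, (x.sum fun j xj => star (x i) *
          (Matrix.of fun i j => M i j - M i n * M n j / M n n) i j * xj) =
          ∑ j ∈ s, (x i * M i j * x j - (x i * M i n) * (M n j * x j) / M n n) := by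
        intro i _
        rw [Finsupp.sum_of_support_subset x (Finset.subset_insert n _) _ (by simp)]
        refine Finset.sum_congr rfl fun j _ => ?_
        simp
        ring
      rw [Finset.sum_congr rfl e2]
      simp only [Finset.sum_sub_distrib, ← Finset.sum_div, ← Finset.mul_sum, ← Finset.sum_mul, hL',
        ← hL]
      exact key

lemma choleskyResidual_posSemidef {C : ℕ → ℕ → ℝ} (hC : (Matrix.of C).PosSemidef) (n : ℕ) :
    (Matrix.of (choleskyResidual C n)).PosSemidef := by
  induction n with
  | zero => exact hC
  | succ n ih => exact posSemidef_residual_step ih n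

lemma choleskyResidual_eq_zero {C : ℕ → ℕ → ℝ} (hC : (Matrix.of C).PosSemidef) (n i j : ℕ)
    (hi : i < n) : choleskyResidual C n i j = 0 := by
  induction n generalizing i j with
  | zero => omega
  | succ n ih =>
    have hP := choleskyResidual_posSemidef hC n
    rcases Nat.lt_succ_iff_lt_or_eq.1 hi with h | rfl
    · simp [choleskyResidual, ih i _ h]
    · rcases eq_or_ne (choleskyResidual C i i i) 0 with h0 | h0
      · have := posSemidef_sq_le hP i j
        simp only [Matrix.of_apply, h0, zero_mul] at this
        have : choleskyResidual C i i j = 0 := by nlinarith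
        simp [choleskyResidual, this]
      · simp only [choleskyResidual]
        field_simp
        ring

lemma choleskyFactor_sum {C : ℕ → ℕ → ℝ} (hC : (Matrix.of C).PosSemidef) (N i j : ℕ) :
    C i j = ∑ n ∈ Finset.range N, choleskyFactor C i n * choleskyFactor C j n +
      choleskyResidual C N i j := by
  induction N with
  | zero => simp [choleskyResidual]
  | succ N ih =>
    have hP := choleskyResidual_posSemidef hC N
    have hs : choleskyResidual C N N j = choleskyResidual C N j N := by
      simpa using hP.1.apply j N
    have hd : 0 ≤ choleskyResidual C N N N := hP.diag_nonneg (i := N)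
    rw [Finset.sum_range_succ, ih]
    simp only [choleskyResidual, choleskyFactor]
    rw [div_mul_div_comm, Real.mul_self_sqrt hd, hs]
    ring

lemma choleskyFactor_eq_zero {C : ℕ → ℕ → ℝ} (hC : (Matrix.of C).PosSemidef) {i n : ℕ}
    (h : i < n) : choleskyFactor C i n = 0 := by
  simp [choleskyFactor, choleskyResidual_eq_zero hC n i n h]

/-- The field `κ_i = ∑_n L_{in} g_n`, with `L` the Cholesky factor of `C`. -/
noncomputable def choleskyField (C : ℕ → ℕ → ℝ) (g : ℕ → ℝ) (i : ℕ) : ℝ :=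
  ∑ n ∈ Finset.range (i + 1), choleskyFactor C i n * g n

lemma measurable_choleskyResidual (n i j : ℕ) :
    Measurable fun C : ℕ → ℕ → ℝ => choleskyResidual C n i j := by
  induction n generalizing i j with
  | zero => simp only [choleskyResidual]; fun_prop
  | succ n ih =>
    simp only [choleskyResidual]
    exact (ih i j).sub (((ih i n).mul (ih n j)).div (ih n n))

lemma measurable_choleskyField :
    Measurable fun p : (ℕ → ℕ → ℝ) × (ℕ → ℝ) => choleskyField p.1 p.2 := by
  refine measurable_pi_lambda _ fun i => ?_
  unfold choleskyField choleskyFactor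
  refine Finset.measurable_sum _ fun n _ => ?_
  have h1 := (measurable_choleskyResidual n i n).comp
    (measurable_fst : Measurable (Prod.fst : (ℕ → ℕ → ℝ) × (ℕ → ℝ) → _))
  have h2 := (measurable_choleskyResidual n n n).comp
    (measurable_fst : Measurable (Prod.fst : (ℕ → ℕ → ℝ) × (ℕ → ℝ) → _))
  have h3 : Measurable fun p : (ℕ → ℕ → ℝ) × (ℕ → ℝ) => p.2 n := by fun_prop
  exact (h1.div h2.sqrt).mul h3

/-- The law of a sequence of independent standard Gaussian variables. -/
noncomputable def iidGaussian : Measure (ℕ → ℝ) :=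
  Measure.infinitePi fun _ : ℕ => gaussianReal 0 1

instance : IsProbabilityMeasure iidGaussian := by unfold iidGaussian; infer_instance

lemma isGaussianProcess_iidGaussian :
    IsGaussianProcess (fun (i : ℕ) (g : ℕ → ℝ) => g i) iidGaussian where
  hasGaussianLaw I := by
    have h : iIndepFun (fun (i : ℕ) (g : ℕ → ℝ) => g i) iidGaussian :=
      iIndepFun_infinitePi (X := fun _ x => x) (fun _ => measurable_id)
    refine iIndepFun.hasGaussianLaw (X := fun (i : I) (g : ℕ → ℝ) => g i) (fun i => ⟨?_⟩)
      (h.precomp Subtype.val_injective)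
    unfold iidGaussian
    rw [Measure.infinitePi_map_eval]
    infer_instance

lemma memLp_iidGaussian (i : ℕ) : MemLp (fun g : ℕ → ℝ => g i) 2 iidGaussian :=
  (isGaussianProcess_iidGaussian.hasGaussianLaw_eval i).memLp_two

lemma integral_iidGaussian (i : ℕ) : ∫ g, g i ∂iidGaussian = 0 := by
  have h : iidGaussian.map (fun g : ℕ → ℝ => g i) = gaussianReal 0 1 := by
    unfold iidGaussian; exact Measure.infinitePi_map_eval _ i
  have h2 := integral_map (μ := iidGaussian) (φ := fun g : ℕ → ℝ => g i) (measurable_pi_apply i).aemeasurable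
    (f := fun y : ℝ => y) (by fun_prop)
  rw [← h2, h, integral_id_gaussianReal]

lemma covariance_iidGaussian (i j : ℕ) :
    cov[fun g : ℕ → ℝ => g i, fun g : ℕ → ℝ => g j; iidGaussian] = if i = j then 1 else 0 := by
  split_ifs with hij
  · subst hij
    have h : iidGaussian.map (fun g : ℕ → ℝ => g i) = gaussianReal 0 1 := by
      unfold iidGaussian; exact Measure.infinitePi_map_eval _ i
    rw [covariance_self (measurable_pi_apply i).aemeasurable]
    have := variance_map (μ := iidGaussian) (Y := fun g : ℕ → ℝ => g i) (X := fun y : ℝ => y)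
      (by fun_prop) (measurable_pi_apply i).aemeasurable
    rw [h] at this
    have h3 : Var[fun y : ℝ => y; gaussianReal 0 1] = 1 := by simp
    rw [h3] at this
    exact this.symm
  · have h : iIndepFun (fun (i : ℕ) (g : ℕ → ℝ) => g i) iidGaussian :=
      iIndepFun_infinitePi (X := fun _ x => x) (fun _ => measurable_id)
    exact (h.indepFun hij).covariance_eq_zero (memLp_iidGaussian i) (memLp_iidGaussian j)

lemma isCenteredGaussianField_choleskyField {C : ℕ → ℕ → ℝ} (hC : (Matrix.of C).PosSemidef) :
    IsCenteredGaussianField C (iidGaussian.map (choleskyField C)) := by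
  have hm : Measurable (choleskyField C) := by
    exact measurable_choleskyField.comp (measurable_const.prodMk measurable_id)
  have hG : IsGaussianProcess (fun (i : ℕ) (g : ℕ → ℝ) => choleskyField C g i) iidGaussian := by
    refine isGaussianProcess_iidGaussian.of_isGaussianProcess fun i => ⟨Finset.range (i + 1),
      ∑ n : Finset.range (i + 1),
        choleskyFactor C i n • ContinuousLinearMap.proj (R := ℝ) (φ := fun _ => ℝ) n, fun g => ?_⟩
    simp only [choleskyField, sum_apply, smul_apply,
      ContinuousLinearMap.proj_apply, Finset.restrict, smul_eq_mul]
    exact (Finset.sum_coe_sort (Finset.range (i + 1)) fun n => choleskyFactor C i n * g n).symm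
  refine ⟨⟨fun I => ⟨?_⟩⟩, fun i => ?_, fun i j => ?_⟩
  · rw [Measure.map_map (by fun_prop) hm]
    exact (hG.hasGaussianLaw I).isGaussian_map
  · rw [integral_map hm.aemeasurable (measurable_pi_apply i).aestronglyMeasurable]
    unfold choleskyField
    rw [integral_finsetSum]
    · simp [integral_const_mul, integral_iidGaussian]
    · intro n _
      exact ((memLp_iidGaussian n).integrable (by norm_num)).const_mul _
  · rw [covariance_map (measurable_pi_apply i).aestronglyMeasurable
      (measurable_pi_apply j).aestronglyMeasurable hm.aemeasurable]
    have hex : ∀ k, k ≤ i + j → ∀ g : ℕ → ℝ, choleskyField C g k =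
        ∑ n ∈ Finset.range (i + j + 1), choleskyFactor C k n * g n := by
      intro k hk g
      refine Finset.sum_subset (Finset.range_mono (by omega)) fun n _ hn => ?_
      rw [choleskyFactor_eq_zero hC (by simpa using hn), zero_mul]
    have e1 : (fun κ : ℕ → ℝ => κ i) ∘ choleskyField C =
        fun g => ∑ n ∈ Finset.range (i + j + 1), choleskyFactor C i n * g n :=
      funext fun g => hex i (by omega) g
    have e2 : (fun κ : ℕ → ℝ => κ j) ∘ choleskyField C =
        fun g => ∑ n ∈ Finset.range (i + j + 1), choleskyFactor C j n * g n :=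
      funext fun g => hex j (by omega) g
    rw [e1, e2, covariance_fun_sum_fun_sum'
      (fun n _ => (memLp_iidGaussian n).const_mul _) (fun n _ => (memLp_iidGaussian n).const_mul _)]
    rw [choleskyFactor_sum hC (i + j + 1) i j, choleskyResidual_eq_zero hC _ i j (by omega),
      add_zero]
    refine Finset.sum_congr rfl fun n hn => ?_
    simp only [covariance_const_mul_left, covariance_const_mul_right, covariance_iidGaussian,
      mul_ite, mul_one, mul_zero, Finset.sum_ite_eq, hn, if_true]
    exact mul_comm _ _

lemma posSemidef_entrywise_pow {C : ℕ → ℕ → ℝ} (hC : (Matrix.of C).PosSemidef) (r : ℕ) :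
    (Matrix.of fun i j => C i j ^ r).PosSemidef := by
  induction r with
  | zero =>
    refine ⟨by ext i j; simp, fun x => ?_⟩
    have : (x.sum fun i xi => x.sum fun j xj =>
        star xi * (Matrix.of fun i j => C i j ^ 0) i j * xj) =
        (x.sum fun _ xi => xi) * (x.sum fun _ xi => xi) := by
      simp [Finsupp.sum, Finset.sum_mul_sum]
    rw [this]
    exact mul_self_nonneg _
  | succ r ih =>
    have h : (Matrix.of fun i j => C i j ^ (r + 1)) =
        (Matrix.of fun i j => C i j ^ r).hadamard (Matrix.of C) := by
      ext i j
      simp [pow_succ]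
    rw [h]
    exact ih.hadamard hC

theorem exists_gaussianFieldKernel (r : ℕ) :
    ∃ G : Kernel OverlapStructure (ℕ → ℝ),
      ∀ x, IsCenteredGaussianField (fun i j => x.overlap i j ^ r) (G x) := by
  have hm : Measurable fun p : OverlapStructure × (ℕ → ℝ) =>
      choleskyField (fun i j => p.1.overlap i j ^ r) p.2 := by
    refine measurable_choleskyField.comp (Measurable.prodMk ?_ measurable_snd)
    refine measurable_pi_lambda _ fun i => measurable_pi_lambda _ fun j => ?_
    exact ((OverlapStructure.measurable_overlap i j).comp measurable_fst).pow_const r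
  refine ⟨(Kernel.id ×ₖ Kernel.const OverlapStructure iidGaussian).map
    (fun p => choleskyField (fun i j => p.1.overlap i j ^ r) p.2), fun x => ?_⟩
  have hx : (Matrix.of fun i j => x.overlap i j ^ r).PosSemidef :=
    posSemidef_entrywise_pow x.2.2.2.2.2.1 r
  have := isCenteredGaussianField_choleskyField hx
  rw [Kernel.map_apply _ hm, Kernel.prod_apply, Kernel.id_apply, Kernel.const_apply,
    Measure.dirac_prod, Measure.map_map hm (by fun_prop)]
  exact this

/-- The kernel that sends `(ξ, Q)` to the law of the centered Gaussian field whose covariance is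
the `r`-th entrywise power of `Q`. -/
noncomputable def gaussianFieldKernel (r : ℕ) : Kernel OverlapStructure (ℕ → ℝ) :=
  (exists_gaussianFieldKernel r).choose

lemma gaussianFieldKernel_spec (r : ℕ) (x : OverlapStructure) :
    IsCenteredGaussianField (fun i j => x.overlap i j ^ r) (gaussianFieldKernel r x) :=
  (exists_gaussianFieldKernel r).choose_spec x

instance (r : ℕ) : IsMarkovKernel (gaussianFieldKernel r) :=
  ⟨fun x => (gaussianFieldKernel_spec r x).gaussian.isProbabilityMeasure⟩

end Gaussian

section Evolution

/-- With weights `w`, the particle `j` is ranked before the particle `i`: it is heavier, or equally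
heavy and of smaller index. -/
def RankedBefore (w : ℕ → ℝ) (j i : ℕ) : Prop := w i < w j ∨ (w i = w j ∧ j < i)

/-- `σ` lists the particles in decreasing order of their weights `w` (ties keep their order).
There is at most one such permutation, and there is one if `w` is positive and summable. -/
def IsRanking (w : ℕ → ℝ) (σ : Equiv.Perm ℕ) : Prop :=
  ∀ m n, m < n → RankedBefore w (σ m) (σ n)

lemma IsRanking.antitone {w : ℕ → ℝ} {σ : Equiv.Perm ℕ} (h : IsRanking w σ) :
    Antitone fun i => w (σ i) := by
  intro m n hmn
  rcases hmn.eq_or_lt with rfl | hlt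
  · exact le_rfl
  · rcases h m n hlt with h | h
    · exact h.le
    · exact h.1.le

/-- `i` has exactly `n` particles ranked before it. -/
def HasRank (w : ℕ → ℝ) (n i : ℕ) : Prop :=
  ∃ s : Finset ℕ, s.card = n ∧ ∀ j, j ∈ s ↔ RankedBefore w j i

lemma IsRanking.hasRank_iff {w : ℕ → ℝ} {σ : Equiv.Perm ℕ} (h : IsRanking w σ) (n i : ℕ) :
    HasRank w n i ↔ σ n = i := by
  have asymm : ∀ j k, RankedBefore w j k → ¬ RankedBefore w k j := by
    rintro j k (h1 | h1) (h2 | h2)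
    · exact lt_asymm h1 h2
    · exact h1.ne h2.1.symm
    · exact h2.ne h1.1.symm
    · omega
  have key : ∀ m, ∀ j, j ∈ (Finset.range m).map σ.toEmbedding ↔ RankedBefore w j (σ m) := by
    intro m j
    obtain ⟨k, rfl⟩ := σ.surjective j
    simp only [Finset.mem_map_equiv, Equiv.symm_apply_apply, Finset.mem_range]
    refine ⟨h k m, fun hk => ?_⟩
    by_contra hle
    rcases (not_lt.1 hle).eq_or_lt with rfl | hlt
    · exact asymm _ _ hk hk
    · exact asymm _ _ hk (h m k hlt)
  constructor
  · rintro ⟨s, hs, hj⟩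
    obtain ⟨m, rfl⟩ := σ.surjective i
    have : s = (Finset.range m).map σ.toEmbedding := by
      ext j; rw [hj, key]
    rw [this, Finset.card_map, Finset.card_range] at hs
    rw [hs]
  · rintro rfl
    exact ⟨_, by simp, key n⟩

lemma exists_isRanking_iff (w : ℕ → ℝ) : (∃ σ, IsRanking w σ) ↔
    (∀ n, ∃ i, HasRank w n i) ∧ ∀ i, ∃ n, HasRank w n i := by
  constructor
  · rintro ⟨σ, h⟩
    exact ⟨fun n => ⟨σ n, (h.hasRank_iff _ _).2 rfl⟩,
      fun i => ⟨σ.symm i, (h.hasRank_iff _ _).2 (by simp)⟩⟩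
  · rintro ⟨h1, h2⟩
    have trans : ∀ j k l, RankedBefore w j k → RankedBefore w k l → RankedBefore w j l := by
      rintro j k l (h1 | h1) (h2 | h2)
      · exact Or.inl (h2.trans h1)
      · exact Or.inl (h2.1 ▸ h1)
      · exact Or.inl (h1.1 ▸ h2)
      · exact Or.inr ⟨h2.1.trans h1.1, h1.2.trans h2.2⟩
    have irrefl : ∀ j, ¬ RankedBefore w j j := by
      rintro j (h | h)
      · exact lt_irrefl _ h
      · exact lt_irrefl _ h.2
    have mono : ∀ m n i j, HasRank w m i → HasRank w n j → RankedBefore w i j → m < n := by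
      rintro m n i j ⟨s, rfl, hs⟩ ⟨t, rfl, ht⟩ hij
      refine Finset.card_lt_card ⟨fun k hk => (ht k).2 (trans _ _ _ ((hs k).1 hk) hij), fun hts => ?_⟩
      exact irrefl i ((hs i).1 (hts ((ht i).2 hij)))
    have total : ∀ i j, i ≠ j → RankedBefore w i j ∨ RankedBefore w j i := by
      intro i j hij
      rcases lt_trichotomy (w i) (w j) with h | h | h
      · exact Or.inr (Or.inl h)
      · rcases lt_or_gt_of_ne hij with h' | h'
        · exact Or.inl (Or.inr ⟨h.symm, h'⟩)
        · exact Or.inr (Or.inr ⟨h, h'⟩)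
      · exact Or.inl (Or.inl h)
    choose p hp using h1
    choose q hq using h2
    have uniq : ∀ m n i, HasRank w m i → HasRank w n i → m = n := by
      rintro m n i ⟨s, rfl, hs⟩ ⟨t, rfl, ht⟩
      congr 1; ext j; rw [hs, ht]
    refine ⟨⟨p, q, fun n => uniq _ _ _ (hq _) (hp n), fun i => ?_⟩, fun m n hmn => ?_⟩
    · by_contra hne
      rcases total _ _ hne with h | h
      · exact lt_irrefl _ (mono _ _ _ _ (hp _) (hq i) h)
      · exact lt_irrefl _ (mono _ _ _ _ (hq i) (hp _) h)
    · change RankedBefore w (p m) (p n)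
      have hne : p m ≠ p n := fun h => hmn.ne (uniq _ _ _ (hp m) (h ▸ hp n))
      rcases total _ _ hne with h | h
      · exact h
      · exact absurd (mono _ _ _ _ (hp n) (hp m) h) (by omega)

lemma measurableSet_hasRank (n i : ℕ) : MeasurableSet {w : ℕ → ℝ | HasRank w n i} := by
  have hb : ∀ j, MeasurableSet {w : ℕ → ℝ | RankedBefore w j i} := fun j =>
    (measurableSet_lt (measurable_pi_apply i) (measurable_pi_apply j)).union
      ((measurableSet_eq_fun (measurable_pi_apply i) (measurable_pi_apply j)).inter
        (MeasurableSet.const _))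
  have : {w : ℕ → ℝ | HasRank w n i} = ⋃ s : Finset ℕ, {_w | s.card = n} ∩
      ⋂ j, {w | j ∈ s ↔ RankedBefore w j i} := by
    ext w; simp [HasRank]
  rw [this]
  refine MeasurableSet.iUnion fun s => (MeasurableSet.const _).inter
    (MeasurableSet.iInter fun j => ?_)
  by_cases hj : j ∈ s
  · simpa [hj] using hb j
  · simpa [hj, Set.compl_def] using (hb j).compl

lemma measurableSet_exists_isRanking : MeasurableSet {w : ℕ → ℝ | ∃ σ, IsRanking w σ} := by
  simp only [exists_isRanking_iff, Set.ofPred_and, Set.ofPred_forall, Set.ofPred_exists]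
  exact (MeasurableSet.iInter fun n => MeasurableSet.iUnion fun i => measurableSet_hasRank n i).inter
    (MeasurableSet.iInter fun i => MeasurableSet.iUnion fun n => measurableSet_hasRank n i)

namespace OverlapStructure

/-- The weights after the increments `a`, normalized to total mass one, before reordering:
`ξ_i e^{a_i} / ∑_j ξ_j e^{a_j}`. -/
noncomputable def reweight (x : OverlapStructure) (a : ℕ → ℝ) (i : ℕ) : ℝ :=
  x.weight i * Real.exp (a i) / ∑' j, x.weight j * Real.exp (a j)

lemma reweight_nonneg (x : OverlapStructure) (a : ℕ → ℝ) (i : ℕ) : 0 ≤ x.reweight a i := by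
  have h : ∀ j, 0 ≤ x.weight j * Real.exp (a j) := fun j =>
    mul_nonneg (x.2.2.1 j) (Real.exp_nonneg _)
  exact div_nonneg (h i) (tsum_nonneg h)

lemma summable_reweight (x : OverlapStructure) (a : ℕ → ℝ) : Summable (x.reweight a) := by
  by_cases h : Summable fun j => x.weight j * Real.exp (a j)
  · exact h.div_const _
  · have : x.reweight a = fun _ => 0 := by
      ext i; simp [reweight, tsum_eq_zero_of_not_summable h]
    rw [this]
    exact summable_zero

lemma tsum_reweight_le_one (x : OverlapStructure) (a : ℕ → ℝ) : ∑' i, x.reweight a i ≤ 1 := by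
  simp only [reweight, tsum_div_const]
  exact div_self_le_one _

open Classical in
/-- One step of the competitive evolution, with increments `a`: the weights are multiplied by
`e^{a_i}`, normalized and put in decreasing order, and the overlaps are permuted accordingly. If
the new weights cannot be put in decreasing order (a null event), nothing is changed. -/
noncomputable def evolve (x : OverlapStructure) (a : ℕ → ℝ) : OverlapStructure :=
  if h : ∃ σ : Equiv.Perm ℕ, IsRanking (x.reweight a) σ then
    ⟨(fun i => x.reweight a (h.choose i), fun i j => x.overlap (h.choose i) (h.choose j)),
      h.choose_spec.antitone, fun _ => x.reweight_nonneg a _,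
      (Equiv.summable_iff h.choose).2 (x.summable_reweight a),
      (Equiv.tsum_eq h.choose (x.reweight a)).trans_le (x.tsum_reweight_le_one a),
      x.2.2.2.2.2.1.submatrix h.choose, fun _ => x.2.2.2.2.2.2 _⟩
  else x

lemma measurable_reweight : Measurable fun p : OverlapStructure × (ℕ → ℝ) => p.1.reweight p.2 := by
  refine measurable_pi_lambda _ fun i => ?_
  have h : ∀ j, Measurable fun p : OverlapStructure × (ℕ → ℝ) =>
      p.1.weight j * Real.exp (p.2 j) := fun j =>
    ((measurable_weight j).comp measurable_fst).mul
      (Real.measurable_exp.comp ((measurable_pi_apply j).comp measurable_snd))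
  unfold reweight
  exact (h i).div (Measurable.tsum h)

open Classical in
lemma measurable_evolve :
    Measurable fun p : OverlapStructure × (ℕ → ℝ) => p.1.evolve p.2 := by
  set idx : ℕ → (ℕ → ℝ) → ℕ := fun n w =>
    if h : ∃ σ : Equiv.Perm ℕ, IsRanking w σ then h.choose n else 0 with hidx
  have hidxm : ∀ n, Measurable (idx n) := fun n => by
    refine measurable_to_countable' fun i => ?_
    have : idx n ⁻¹' {i} = ({w | ∃ σ, IsRanking w σ} ∩ {w | HasRank w n i}) ∪
        ({w | ∃ σ, IsRanking w σ}ᶜ ∩ {_w | 0 = i}) := by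
      ext w
      by_cases h : ∃ σ, IsRanking w σ
      · simp only [hidx, Set.mem_preimage, Set.mem_singleton_iff, Set.mem_union,
          Set.mem_inter_iff, Set.mem_ofPred_eq, Set.mem_compl_iff, h, true_and, not_true,
          false_and, or_false]
        exact (h.choose_spec.hasRank_iff n i).symm
      · simp [hidx, h]
    rw [this]
    exact (measurableSet_exists_isRanking.inter (measurableSet_hasRank n i)).union
      (measurableSet_exists_isRanking.compl.inter (MeasurableSet.const _))
  have hI : ∀ n, Measurable fun p : OverlapStructure × (ℕ → ℝ) => idx n (p.1.reweight p.2) :=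
    fun n => (hidxm n).comp measurable_reweight
  have hE : MeasurableSet {p : OverlapStructure × (ℕ → ℝ) |
      ∃ σ, IsRanking (p.1.reweight p.2) σ} :=
    measurable_reweight measurableSet_exists_isRanking
  refine measurable_comap_iff.2 ?_
  have e : (Subtype.val ∘ fun p : OverlapStructure × (ℕ → ℝ) => p.1.evolve p.2) = fun p =>
      if ∃ σ, IsRanking (p.1.reweight p.2) σ then
        (fun i => p.1.reweight p.2 (idx i (p.1.reweight p.2)),
          fun i j => p.1.overlap (idx i (p.1.reweight p.2)) (idx j (p.1.reweight p.2)))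
      else p.1.1 := by
    ext p : 1
    by_cases h : ∃ σ, IsRanking (p.1.reweight p.2) σ
    · simp only [Function.comp_apply, evolve, dif_pos h, if_pos h, hidx]
    · simp only [Function.comp_apply, evolve, dif_neg h, if_neg h]
  rw [e]
  refine Measurable.ite hE (Measurable.prodMk ?_ ?_) (measurable_subtype_coe.comp measurable_fst)
  · refine measurable_pi_lambda _ fun i => ?_
    have h1 : Measurable fun z : ℕ × (ℕ → ℝ) => z.2 z.1 :=
      measurable_from_prod_countable_right fun n => measurable_pi_apply n
    exact h1.comp ((hI i).prodMk measurable_reweight)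
  · refine measurable_pi_lambda _ fun i => measurable_pi_lambda _ fun j => ?_
    have h1 : Measurable fun z : (ℕ × ℕ) × OverlapStructure => z.2.overlap z.1.1 z.1.2 :=
      measurable_from_prod_countable_right fun n => measurable_overlap n.1 n.2
    exact h1.comp (((hI i).prodMk (hI j)).prodMk measurable_fst)

end OverlapStructure

/-- The transition kernel of the evolution `Φ_r` with function `ψ`: the increments are `ψ (κ_i)`,
where, given `(ξ, Q)`, the field `κ` is centered Gaussian with covariance the `r`-th entrywise
power of `Q`. -/
noncomputable def evolutionKernel (ψ : ℝ → ℝ) (r : ℕ) : Kernel OverlapStructure OverlapStructure :=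
  (Kernel.id ×ₖ gaussianFieldKernel r).map fun p => p.1.evolve fun i => ψ (p.2 i)

lemma evolutionKernel_apply {ψ : ℝ → ℝ} (hψ : Measurable ψ) (r : ℕ) (x : OverlapStructure) :
    evolutionKernel ψ r x =
      (gaussianFieldKernel r x).map fun κ => x.evolve fun i => ψ (κ i) := by
  have hm : Measurable fun p : OverlapStructure × (ℕ → ℝ) => p.1.evolve fun i => ψ (p.2 i) :=
    OverlapStructure.measurable_evolve.comp (measurable_fst.prodMk
      (measurable_pi_lambda _ fun i => hψ.comp ((measurable_pi_apply i).comp measurable_snd)))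
  rw [evolutionKernel, Kernel.map_apply _ hm, Kernel.prod_apply, Kernel.id_apply,
    Measure.dirac_prod, Measure.map_map hm (by fun_prop)]
  rfl

/-- A random overlap structure with law `P` is quasi-stationary under `Φ_r` with function `ψ`. -/
def IsQuasiStationary (P : Measure OverlapStructure) (ψ : ℝ → ℝ) (r : ℕ) : Prop :=
  (evolutionKernel ψ r).Invariant P

/-- A random overlap structure `(ξ, Q)` with law `P` is ergodic under `Φ_r` with function `ψ`:
the only (bounded measurable) functions `f` with `𝔼[f (Φ_r (ξ, Q)) | ξ, Q] = f (ξ, Q)` almost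
surely are the constants. -/
def IsErgodicEvolution (P : Measure OverlapStructure) (ψ : ℝ → ℝ) (r : ℕ) : Prop :=
  ∀ f : OverlapStructure → ℝ, Measurable f → (∃ B, ∀ x, |f x| ≤ B) →
    (∀ᵐ x ∂P, ∫ y, f y ∂(evolutionKernel ψ r x) = f x) → ∃ c, ∀ᵐ x ∂P, f x = c

/-- The class of functions driving the evolution: twice continuously differentiable with bounded
first and second derivatives, and such that the law of `ψ (Y)`, for `Y` a standard Gaussian
variable, is absolutely continuous with respect to the Lebesgue measure. -/
structure IsEvolutionFunction (ψ : ℝ → ℝ) : Prop where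
  contDiff : ContDiff ℝ 2 ψ
  bounded_deriv : ∃ B, ∀ x, |deriv ψ x| ≤ B
  bounded_deriv2 : ∃ B, ∀ x, |deriv (deriv ψ) x| ≤ B
  absolutelyContinuous : (gaussianReal 0 1).map ψ ≪ volume

end Evolution

/-- The `ξ`-sampled expectation `𝔼^{(s)}[H]` of a function `H` of the overlaps of `s` points:
`𝔼[∑_{i_1, …, i_s} ξ_{i_1} ⋯ ξ_{i_s} H ((q_{i_l i_{l'}})_{l, l'})]`, where `(ξ, Q)` has law `P`. -/
noncomputable def sampledExpectation (P : Measure OverlapStructure) (s : ℕ)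
    (H : (Fin s → Fin s → ℝ) → ℝ) : ℝ :=
  ∫ x, ∑' i : Fin s → ℕ, (∏ l, x.weight (i l)) * H (fun l l' => x.overlap (i l) (i l')) ∂P

/-! Write `E` for the law of the structure and the field, and `Λ(β)` for the expected logarithm of
the normalization `Z` in one step with increments `ψ (β κ + h)`. By ergodicity the weights either
vanish almost surely, and then both sides are zero, or sum to one almost surely. In the second case
the identity comes from comparing two values `t`, `u` of `β` driven by the same Gaussian field.

Law of large numbers. With the labels held fixed, `n` steps amount to one step whose increment is a
sum of `n` independent copies, because the normalizations cancel, and `log Z` is additive along the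
steps. Conditional means of `log Z` are therefore Birkhoff sums of the transition operator on L².
Ergodicity leaves only constants as fixed vectors, so the mean ergodic theorem gives `o(n)` for the
centered conditional means, and a recursion for second moments gives `E (log Z_n - n Λ)² = o(n²)`
(`tendsto_integral_meanSqLog`).

Comparison. Weight by `F ≥ 0` the difference of the two walks at the last sampled point, sampling
with the `t`-tilted weights. Stationarity makes its mean linear in `n` (`integral_meanPairGibbs`).
The bound `c ≤ log M - 1 + e^c / M`, with `M` the tilted average of `e^c`, bounds it by the
`F`-average times `log Z_n(u) - log Z_n(t)` plus a constant (`pairGibbs_le`). Dividing by `n` gives,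
for one step, at most `E[F] (Λ(u) - Λ(t))` (`integral_meanPairGibbs_one_le`). The same bound with `F
= 1` and `t`, `u` exchanged controls `Λ(u) - Λ(t)` by the `u`-tilted average of the increment
difference (`tiltedAverage_sub_le`).

Expansion. Put `t = b ε`, `u = b ε (1 + v)`. The linear part of the increment difference is `ψ'(h)
(u - t) κ`. The remainder is of order `ε²`; its untilted average contributes the same to both sides,
since each `κ_i` is standard Gaussian whatever the overlaps, so only an error of order `ε³` is left.
The tilted average of `κ` vanishes at `0`, and its derivative there is a Gaussian second moment,
that is, an expectation of `r`-th powers of overlaps (`hasDerivAt_tiltedAverage_id`). Dividing by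
`ε²` and letting `v` tend to `0` from both sides turns the inequality into an equality
(`deriv_eq_of_eventually_le`), which is the identity for `F ≥ 0`. Linearity in `F` gives the general
case. -/

set_option linter.unusedSectionVars false

/-! ### Uniqueness of centered Gaussian fields. -/

section GaussianUniqueness

lemma IsCenteredGaussianField.memLp_two {C : ℕ → ℕ → ℝ} {ν : Measure (ℕ → ℝ)}
    (h : IsCenteredGaussianField C ν) (i : ℕ) : MemLp (fun κ : ℕ → ℝ => κ i) 2 ν :=
  (h.gaussian.hasGaussianLaw_eval i).memLp_two

lemma IsCenteredGaussianField.variance_sum {C : ℕ → ℕ → ℝ} {ν : Measure (ℕ → ℝ)}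
    (h : IsCenteredGaussianField C ν) (I : Finset ℕ) (c : I → ℝ) :
    Var[fun κ : ℕ → ℝ => ∑ i : I, κ i * c i; ν] = ∑ i : I, ∑ j : I, c i * (c j * C i j) := by
  have := h.gaussian.isProbabilityMeasure
  rw [variance_fun_sum (X := fun (i : I) (κ : ℕ → ℝ) => κ i * c i)
    fun i => (h.memLp_two i).mul_const _]
  simp only [covariance_mul_const_left, covariance_mul_const_right, h.covariance_eq]
  exact Finset.sum_congr rfl fun i _ => Finset.sum_congr rfl fun j _ => by ring

lemma IsCenteredGaussianField.integral_sum {C : ℕ → ℕ → ℝ} {ν : Measure (ℕ → ℝ)}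
    (h : IsCenteredGaussianField C ν) (I : Finset ℕ) (c : I → ℝ) :
    ∫ κ : ℕ → ℝ, ∑ i : I, κ i * c i ∂ν = 0 := by
  have := h.gaussian.isProbabilityMeasure
  rw [integral_finsetSum (f := fun (i : I) (κ : ℕ → ℝ) => κ i * c i) _
    fun i _ => ((h.memLp_two i).integrable (by norm_num)).mul_const _]
  simp [integral_mul_const, h.mean_zero]

/-- The law of a centered Gaussian field is determined by its covariance. -/
theorem IsCenteredGaussianField.unique {C : ℕ → ℕ → ℝ} {ν ν' : Measure (ℕ → ℝ)}
    (h : IsCenteredGaussianField C ν) (h' : IsCenteredGaussianField C ν') : ν = ν' := by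
  have := h.gaussian.isProbabilityMeasure
  have := h'.gaussian.isProbabilityMeasure
  have key : ∀ I : Finset ℕ, ν.map I.restrict = ν'.map I.restrict := by
    intro I
    have i1 : IsGaussian (ν.map I.restrict) := (h.gaussian.hasGaussianLaw I).isGaussian_map
    have i2 : IsGaussian (ν'.map I.restrict) := (h'.gaussian.hasGaussianLaw I).isGaussian_map
    have hm : Measurable (I.restrict : (ℕ → ℝ) → I → ℝ) := Finset.measurable_restrict I
    -- The characteristic function of a Gaussian marginal involves only the mean and variance of
    -- linear forms, and these are determined by the covariance.
    refine Measure.ext_of_charFunDual ?_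
    ext L
    have hL : ∀ κ : ℕ → ℝ, L (I.restrict κ) = ∑ i : I, κ i * L (Pi.single i 1) := by
      intro κ
      conv_lhs => rw [← LinearMap.sum_single_apply (φ := fun _ : I => ℝ) (I.restrict κ), map_sum]
      refine Finset.sum_congr rfl fun i _ => ?_
      have : (Pi.single i (I.restrict κ i) : I → ℝ) = κ i • Pi.single i 1 := by
        rw [← Pi.single_smul]; simp
      rw [this, map_smul, smul_eq_mul]
    rw [IsGaussian.charFunDual_eq, IsGaussian.charFunDual_eq]
    have v : ∀ ρ : Measure (ℕ → ℝ), Var[L; ρ.map I.restrict] =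
        Var[fun κ : ℕ → ℝ => ∑ i : I, κ i * L (Pi.single i 1); ρ] := fun ρ => by
      rw [variance_map L.continuous.measurable.aemeasurable hm.aemeasurable]
      exact congrArg (fun X => Var[X; ρ]) (funext hL)
    have e : ∀ ρ : Measure (ℕ → ℝ), (ρ.map I.restrict)[fun z => (L z : ℂ)] =
        ((∫ κ : ℕ → ℝ, ∑ i : I, κ i * L (Pi.single i 1) ∂ρ : ℝ) : ℂ) := fun ρ => by
      rw [integral_complex_ofReal, integral_map hm.aemeasurable L.continuous.aestronglyMeasurable]
      simp only [hL]
    rw [e, e, v, v, h.variance_sum I fun i => L (Pi.single i 1),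
      h'.variance_sum I fun i => L (Pi.single i 1), h.integral_sum, h'.integral_sum]
  have h1 : IsProjectiveLimit ν fun I => ν'.map I.restrict := key
  have h2 : IsProjectiveLimit ν' fun I => ν'.map I.restrict := fun _ => rfl
  have : ∀ I : Finset ℕ, IsFiniteMeasure (ν'.map I.restrict) := fun I => inferInstance
  exact h1.unique h2

lemma IsCenteredGaussianField.map_perm {C : ℕ → ℕ → ℝ} {ν : Measure (ℕ → ℝ)}
    (h : IsCenteredGaussianField C ν) (σ : Equiv.Perm ℕ) :
    IsCenteredGaussianField (fun i j => C (σ i) (σ j))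
      (ν.map fun (κ : ℕ → ℝ) i => κ (σ i)) := by
  have hm : Measurable fun (κ : ℕ → ℝ) i => κ (σ i) := by fun_prop
  have hG : IsGaussianProcess (fun (i : ℕ) (κ : ℕ → ℝ) => κ (σ i)) ν := h.gaussian.comp_right σ
  refine ⟨⟨fun I => ⟨?_⟩⟩, fun i => ?_, fun i j => ?_⟩
  · rw [Measure.map_map (by fun_prop) hm]
    exact (hG.hasGaussianLaw I).isGaussian_map
  · rw [integral_map hm.aemeasurable (measurable_pi_apply i).aestronglyMeasurable]
    exact h.mean_zero _
  · rw [covariance_map (measurable_pi_apply i).aestronglyMeasurable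
      (measurable_pi_apply j).aestronglyMeasurable hm.aemeasurable]
    exact h.covariance_eq _ _

end GaussianUniqueness

/-! ### Relabeling of the particles. -/

namespace OverlapStructure

/-- `y` is obtained from `x` by relabeling the particles by `σ`. -/
def IsRelabeling (x y : OverlapStructure) (σ : Equiv.Perm ℕ) : Prop :=
  (∀ i, y.weight i = x.weight (σ i)) ∧ ∀ i j, y.overlap i j = x.overlap (σ i) (σ j)

/-- The kernel is obtained by choice, so equivariance is not built into it; it follows from
uniqueness, since both laws are centered Gaussian fields with the same covariance. -/
lemma gaussianFieldKernel_relabel (r : ℕ) {x y : OverlapStructure} {σ : Equiv.Perm ℕ}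
    (h : ∀ i j, y.overlap i j = x.overlap (σ i) (σ j)) :
    gaussianFieldKernel r y = (gaussianFieldKernel r x).map fun (κ : ℕ → ℝ) i => κ (σ i) := by
  have h1 := gaussianFieldKernel_spec r y
  simp only [h] at h1
  exact h1.unique ((gaussianFieldKernel_spec r x).map_perm σ)

end OverlapStructure

/-! ### Existence of the decreasing rearrangement. -/

section Ranking

/-- The rank of a particle is its number of predecessors. Ranks are strictly increasing along the
order, hence distinct; the predecessors of `i` have distinct ranks below that of `i`, so they fill
every smaller value. An injective map into `ℕ` is unbounded, so every rank is attained. -/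
lemma exists_isRanking_of_finite {w : ℕ → ℝ} (hw : ∀ i, {j | RankedBefore w j i}.Finite) :
    ∃ σ, IsRanking w σ := by
  have trans : ∀ j k l, RankedBefore w j k → RankedBefore w k l → RankedBefore w j l := by
    rintro j k l (h1 | h1) (h2 | h2)
    · exact Or.inl (h2.trans h1)
    · exact Or.inl (h2.1 ▸ h1)
    · exact Or.inl (h1.1 ▸ h2)
    · exact Or.inr ⟨h2.1.trans h1.1, h1.2.trans h2.2⟩
  have irrefl : ∀ j, ¬ RankedBefore w j j := by
    rintro j (h | h)
    · exact lt_irrefl _ h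
    · exact lt_irrefl _ h.2
  have total : ∀ i j, i ≠ j → RankedBefore w i j ∨ RankedBefore w j i := by
    intro i j hij
    rcases lt_trichotomy (w i) (w j) with h | h | h
    · exact Or.inr (Or.inl h)
    · rcases lt_or_gt_of_ne hij with h' | h'
      · exact Or.inl (Or.inr ⟨h.symm, h'⟩)
      · exact Or.inr (Or.inr ⟨h, h'⟩)
    · exact Or.inl (Or.inl h)
  set S : ℕ → Finset ℕ := fun i => (hw i).toFinset with hS
  have memS : ∀ i j, j ∈ S i ↔ RankedBefore w j i := fun i j => by simp [hS]
  have mono : ∀ i j, RankedBefore w i j → (S i).card < (S j).card := fun i j hij =>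
    Finset.card_lt_card ⟨fun k hk => (memS _ _).2 (trans _ _ _ ((memS _ _).1 hk) hij),
      fun hts => irrefl i ((memS _ _).1 (hts ((memS _ _).2 hij)))⟩
  have inj : Function.Injective fun i => (S i).card := by
    intro i j hij
    by_contra hne
    rcases total i j hne with h | h
    · exact (mono _ _ h).ne hij
    · exact (mono _ _ h).ne' hij
  have down : ∀ i n, n < (S i).card → ∃ j, (S j).card = n := by
    intro i n hn
    have himg : (S i).image (fun j => (S j).card) = Finset.range (S i).card := by
      refine Finset.eq_of_subset_of_card_le (fun k hk => ?_) ?_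
      · obtain ⟨j, hj, rfl⟩ := Finset.mem_image.1 hk
        exact Finset.mem_range.2 (mono _ _ ((memS _ _).1 hj))
      · rw [Finset.card_range, Finset.card_image_of_injective _ inj]
    have : n ∈ (S i).image (fun j => (S j).card) := by rw [himg]; exact Finset.mem_range.2 hn
    obtain ⟨j, -, hj⟩ := Finset.mem_image.1 this
    exact ⟨j, hj⟩
  rw [exists_isRanking_iff]
  refine ⟨fun n => ?_, fun i => ⟨_, S i, rfl, memS i⟩⟩
  obtain ⟨m, ⟨i, rfl⟩, hm⟩ := (Set.infinite_range_of_injective inj).exists_gt n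
  obtain ⟨j, hj⟩ := down i n hm
  exact ⟨j, S j, hj, memS j⟩

/-- This shows that the default branch of `evolve` is never taken. A positive weight has finitely
many predecessors by summability. A vanishing new weight next to a positive one comes from a
vanishing old weight, since exponentials are positive; as the old weights are non-increasing, every
positive weight then has a smaller index. -/
lemma OverlapStructure.exists_isRanking_reweight (x : OverlapStructure) (a : ℕ → ℝ) :
    ∃ σ, IsRanking (x.reweight a) σ := by
  refine exists_isRanking_of_finite fun i => ?_
  rcases (x.reweight_nonneg a i).eq_or_lt with h0 | hpos
  · refine (Set.finite_lt_nat i).subset ?_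
    rintro j (hj | hj)
    · rw [← h0] at hj
      by_contra hij
      have hij : i ≤ j := not_lt.1 hij
      have hxj : x.weight j ≠ 0 := by
        intro h; simp [reweight, h] at hj
      have hz : (∑' j, x.weight j * Real.exp (a j)) ≠ 0 := by
        intro h; simp [reweight, h] at hj
      have hxi : x.weight i = 0 := by
        have := h0.symm
        simpa [reweight, hz, Real.exp_ne_zero] using this
      have h1 : x.weight j ≤ x.weight i := x.2.1 hij
      have h2 : 0 ≤ x.weight j := x.2.2.1 j
      exact hxj (le_antisymm (hxi ▸ h1) h2)
    · exact hj.2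
  · have hs := (x.summable_reweight a).tendsto_cofinite_zero
    have := hs.eventually (gt_mem_nhds hpos)
    rw [Filter.eventually_cofinite] at this
    refine this.subset ?_
    rintro j (hj | hj)
    · exact not_lt.2 hj.le
    · exact not_lt.2 hj.1.le

lemma OverlapStructure.exists_perm_evolve (x : OverlapStructure) (a : ℕ → ℝ) :
    ∃ σ : Equiv.Perm ℕ, (∀ i, (x.evolve a).weight i = x.reweight a (σ i)) ∧
      ∀ i j, (x.evolve a).overlap i j = x.overlap (σ i) (σ j) := by
  have h := x.exists_isRanking_reweight a
  refine ⟨h.choose, fun i => ?_, fun i j => ?_⟩ <;> simp [evolve, dif_pos h, weight, overlap]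

end Ranking

namespace OverlapStructure

lemma weight_nonneg (x : OverlapStructure) (i : ℕ) : 0 ≤ x.weight i := x.2.2.1 i

lemma summable_weight (x : OverlapStructure) : Summable x.weight := x.2.2.2.1

lemma tsum_weight_le_one (x : OverlapStructure) : ∑' i, x.weight i ≤ 1 := x.2.2.2.2.1

lemma weight_mul_exp_nonneg (x : OverlapStructure) (i : ℕ) (u : ℝ) :
    0 ≤ x.weight i * Real.exp u := mul_nonneg (x.weight_nonneg i) (Real.exp_nonneg _)

end OverlapStructure

/-! ### Several steps with the labels held fixed. -/

section Walk

variable {E : Type*} [NormedAddCommGroup E] [MeasurableSpace E] [BorelSpace E]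
  [SecondCountableTopology E]

/-- The law of the increments `φ (κ_i)` of one step of the evolution. -/
noncomputable def incrementKernel (φ : ℝ → E) (r : ℕ) : Kernel OverlapStructure (ℕ → E) :=
  (gaussianFieldKernel r).map fun κ i => φ (κ i)

/-- The law of the sum of the increments of `n` independent steps, for fixed labels. -/
noncomputable def walkKernel (φ : ℝ → E) (r : ℕ) : ℕ → Kernel OverlapStructure (ℕ → E)
  | 0 => Kernel.const _ (Measure.dirac 0)
  | n + 1 => (incrementKernel φ r ×ₖ walkKernel φ r n).map fun p => p.1 + p.2

lemma measurable_pi_comp {α β : Type*} [MeasurableSpace α] [MeasurableSpace β] {φ : α → β}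
    (hφ : Measurable φ) : Measurable fun (κ : ℕ → α) i => φ (κ i) := by fun_prop

instance (φ : ℝ → E) (r : ℕ) : IsFiniteKernel (incrementKernel φ r) := by
  unfold incrementKernel; infer_instance

instance (φ : ℝ → E) (r n : ℕ) : IsFiniteKernel (walkKernel φ r n) := by
  induction n with
  | zero => unfold walkKernel; infer_instance
  | succ n ih => unfold walkKernel; infer_instance

lemma isMarkovKernel_incrementKernel {φ : ℝ → E} (hφ : Measurable φ) (r : ℕ) :
    IsMarkovKernel (incrementKernel φ r) :=
  Kernel.IsMarkovKernel.map _ (measurable_pi_comp hφ)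

lemma isMarkovKernel_walkKernel {φ : ℝ → E} (hφ : Measurable φ) (r n : ℕ) :
    IsMarkovKernel (walkKernel φ r n) := by
  induction n with
  | zero => unfold walkKernel; infer_instance
  | succ n ih =>
    have := isMarkovKernel_incrementKernel hφ r
    exact Kernel.IsMarkovKernel.map _ (by fun_prop)

lemma incrementKernel_apply {φ : ℝ → E} (hφ : Measurable φ) (r : ℕ) (x : OverlapStructure) :
    incrementKernel φ r x = (gaussianFieldKernel r x).map fun κ i => φ (κ i) :=
  Kernel.map_apply _ (measurable_pi_comp hφ) _

lemma walkKernel_succ_apply (φ : ℝ → E) (r n : ℕ) (x : OverlapStructure) :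
    walkKernel φ r (n + 1) x =
      ((incrementKernel φ r x).prod (walkKernel φ r n x)).map fun p => p.1 + p.2 := by
  rw [walkKernel, Kernel.map_apply _ (by fun_prop), Kernel.prod_apply]

lemma walkKernel_one (φ : ℝ → E) (r : ℕ) :
    walkKernel φ r 1 = incrementKernel φ r := by
  ext1 x
  rw [walkKernel_succ_apply, walkKernel, Kernel.const_apply, Measure.prod_dirac,
    Measure.map_map (by fun_prop) (by fun_prop)]
  convert Measure.map_id
  ext1 p
  simp

lemma lintegral_walkKernel_succ (φ : ℝ → E) (r n : ℕ) (x : OverlapStructure)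
    {f : (ℕ → E) → ENNReal} (hf : Measurable f) :
    ∫⁻ p, f p ∂walkKernel φ r (n + 1) x =
      ∫⁻ p, ∫⁻ q, f (p + q) ∂walkKernel φ r n x ∂incrementKernel φ r x := by
  rw [walkKernel_succ_apply, lintegral_map hf (by fun_prop),
    lintegral_prod (fun z : (ℕ → E) × (ℕ → E) => f (z.1 + z.2))
      (hf.comp (measurable_fst.add measurable_snd)).aemeasurable]

lemma incrementKernel_relabel {φ : ℝ → E} (hφ : Measurable φ) (r : ℕ) {x y : OverlapStructure}
    {σ : Equiv.Perm ℕ} (h : ∀ i j, y.overlap i j = x.overlap (σ i) (σ j)) :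
    incrementKernel φ r y = (incrementKernel φ r x).map fun p i => p (σ i) := by
  rw [incrementKernel_apply hφ, incrementKernel_apply hφ,
    OverlapStructure.gaussianFieldKernel_relabel r h,
    Measure.map_map (measurable_pi_comp hφ) (by fun_prop),
    Measure.map_map (by fun_prop) (measurable_pi_comp hφ)]
  rfl

/-- This allows the increments after a reordering to be read in the labels of the initial structure.
-/
lemma walkKernel_relabel {φ : ℝ → E} (hφ : Measurable φ) (r n : ℕ) {x y : OverlapStructure}
    {σ : Equiv.Perm ℕ} (h : ∀ i j, y.overlap i j = x.overlap (σ i) (σ j)) :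
    walkKernel φ r n y = (walkKernel φ r n x).map fun p i => p (σ i) := by
  have hm : Measurable fun (p : ℕ → E) i => p (σ i) := by fun_prop
  induction n with
  | zero =>
    rw [walkKernel, Kernel.const_apply, Kernel.const_apply, Measure.map_dirac' hm]
    rfl
  | succ n ih =>
    rw [walkKernel_succ_apply, walkKernel_succ_apply, ih, incrementKernel_relabel hφ r h,
      Measure.map_prod_map _ _ hm hm, Measure.map_map (by fun_prop) (by fun_prop),
      Measure.map_map hm (by fun_prop)]
    rfl

/-- Used for the coordinate projections of increments in `ℝ × ℝ`: the joint walk of two values of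
`β` has the two single walks as marginals. -/
lemma walkKernel_map {E' : Type*} [NormedAddCommGroup E'] [MeasurableSpace E'] [BorelSpace E']
    [SecondCountableTopology E'] {φ : ℝ → E} (hφ : Measurable φ) {T : E → E'}
    (hT : Measurable T) (hT0 : T 0 = 0) (hTa : ∀ u v, T (u + v) = T u + T v)
    (r n : ℕ) (x : OverlapStructure) :
    walkKernel (fun y => T (φ y)) r n x = (walkKernel φ r n x).map fun p i => T (p i) := by
  have hm := measurable_pi_comp hT
  induction n with
  | zero =>
    rw [walkKernel, walkKernel, Kernel.const_apply, Kernel.const_apply, Measure.map_dirac' hm]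
    congr 1
    ext i
    exact hT0.symm
  | succ n ih =>
    rw [walkKernel_succ_apply, walkKernel_succ_apply, ih, incrementKernel_apply hφ,
      incrementKernel_apply (φ := fun y => T (φ y)) (hT.comp hφ)]
    have : (fun (κ : ℕ → ℝ) i => T (φ (κ i))) =
      (fun (p : ℕ → E) i => T (p i)) ∘ fun (κ : ℕ → ℝ) i => φ (κ i) := rfl
    rw [this, ← Measure.map_map hm (measurable_pi_comp hφ), Measure.map_prod_map _ _ hm hm,
      Measure.map_map (by fun_prop) (by fun_prop)]
    rw [Measure.map_map hm (by fun_prop)]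
    refine congrArg (fun g : (ℕ → E) × (ℕ → E) → ℕ → E' => Measure.map g _) ?_
    ext p i
    simp [hTa]

end Walk

/-! ### Exponential moments of the walk. -/

section Moments

/-- The diagonal overlaps are one, and so are their powers; hence one coordinate of the field has a
law that does not depend on the structure. All bounds uniform in `x` rest on this. -/
lemma gaussianFieldKernel_map_eval (r : ℕ) (x : OverlapStructure) (i : ℕ) :
    (gaussianFieldKernel r x).map (fun κ => κ i) = gaussianReal 0 1 := by
  have h := gaussianFieldKernel_spec r x
  rw [(h.gaussian.hasGaussianLaw_eval i).map_eq_gaussianReal, h.mean_zero,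
    ← covariance_self (measurable_pi_apply i).aemeasurable, h.covariance_eq]
  have : x.overlap i i = 1 := x.2.2.2.2.2.2 i
  simp [this]

lemma lintegral_gaussianFieldKernel_eval (r : ℕ) (x : OverlapStructure) (i : ℕ)
    {f : ℝ → ENNReal} (hf : Measurable f) :
    ∫⁻ κ, f (κ i) ∂gaussianFieldKernel r x = ∫⁻ y, f y ∂gaussianReal 0 1 := by
  rw [← gaussianFieldKernel_map_eval r x i, lintegral_map hf (measurable_pi_apply i)]

lemma integrable_exp_abs_gaussianReal (t : ℝ) :
    Integrable (fun y => Real.exp (t * |y|)) (gaussianReal 0 1) :=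
  integrable_exp_mul_abs (X := fun y => y) (integrable_exp_mul_gaussianReal t)
    (integrable_exp_mul_gaussianReal (-t))

lemma OverlapStructure.tsum_ofReal_weight_le_one (x : OverlapStructure) :
    ∑' j, ENNReal.ofReal (x.weight j) ≤ 1 := by
  rw [← ENNReal.ofReal_tsum_of_nonneg x.weight_nonneg x.summable_weight]
  exact ENNReal.ofReal_le_one.2 x.tsum_weight_le_one

variable {E : Type*} [NormedAddCommGroup E] [MeasurableSpace E] [BorelSpace E]
  [SecondCountableTopology E]

/-- The exponential moment of the norm of one increment. -/
noncomputable def expMoment (φ : ℝ → E) (t : ℝ) : ENNReal :=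
  ∫⁻ y, ENNReal.ofReal (Real.exp (t * ‖φ y‖)) ∂gaussianReal 0 1

lemma expMoment_lt_top {φ : ℝ → E} (hφ : Measurable φ) {C c : ℝ}
    (h : ∀ y, ‖φ y‖ ≤ C + c * |y|) {t : ℝ} (ht : 0 ≤ t) :
    expMoment φ t < ⊤ := by
  have : Integrable (fun y => Real.exp (t * ‖φ y‖)) (gaussianReal 0 1) := by
    refine ((integrable_exp_abs_gaussianReal (t * c)).const_mul (Real.exp (t * C))).mono'
      (by fun_prop) (Filter.Eventually.of_forall fun y => ?_)
    rw [Real.norm_of_nonneg (Real.exp_nonneg _), ← Real.exp_add]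
    refine Real.exp_le_exp.2 ((mul_le_mul_of_nonneg_left (h y) ht).trans_eq (by ring))
  exact this.lintegral_lt_top

/-- The triangle inequality splits the exponential of the norm into a product over independent
steps. -/
lemma lintegral_exp_walkKernel_le {φ : ℝ → E} (hφ : Measurable φ) (r n : ℕ)
    (x : OverlapStructure) (i : ℕ) {t : ℝ} (ht : 0 ≤ t) :
    ∫⁻ p, ENNReal.ofReal (Real.exp (t * ‖p i‖)) ∂walkKernel φ r n x ≤ expMoment φ t ^ n := by
  induction n with
  | zero =>
    rw [walkKernel, Kernel.const_apply, lintegral_dirac' _ (by fun_prop)]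
    simp
  | succ n ih =>
    rw [lintegral_walkKernel_succ _ _ _ _ (by fun_prop)]
    calc _ ≤ ∫⁻ p, ∫⁻ q, ENNReal.ofReal (Real.exp (t * ‖p i‖)) *
          ENNReal.ofReal (Real.exp (t * ‖q i‖)) ∂walkKernel φ r n x ∂incrementKernel φ r x := by
          refine lintegral_mono fun p => lintegral_mono fun q => ?_
          rw [← ENNReal.ofReal_mul (Real.exp_nonneg _), ← Real.exp_add, ← mul_add]
          exact ENNReal.ofReal_le_ofReal (Real.exp_le_exp.2
            (mul_le_mul_of_nonneg_left (norm_add_le _ _) ht))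
      _ = (∫⁻ p, ENNReal.ofReal (Real.exp (t * ‖p i‖)) ∂incrementKernel φ r x) *
          ∫⁻ q, ENNReal.ofReal (Real.exp (t * ‖q i‖)) ∂walkKernel φ r n x := by
          simp_rw [lintegral_const_mul' _ _ ENNReal.ofReal_ne_top]
          rw [lintegral_mul_const]
          fun_prop
      _ ≤ expMoment φ t * expMoment φ t ^ n := by
          gcongr
          rw [incrementKernel_apply hφ, lintegral_map (by fun_prop) (measurable_pi_comp hφ),
            lintegral_gaussianFieldKernel_eval r x i
              (f := fun y => ENNReal.ofReal (Real.exp (t * ‖φ y‖))) (by fun_prop)]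
          exact le_rfl
      _ = expMoment φ t ^ (n + 1) := by rw [pow_succ']

/-- The average of `exp (t ‖p_j‖)` over the particles. -/
noncomputable def OverlapStructure.expAverage (x : OverlapStructure) (t : ℝ) (p : ℕ → E) : ℝ :=
  ∑' j, x.weight j * Real.exp (t * ‖p j‖)

lemma OverlapStructure.measurable_expAverage (t : ℝ) :
    Measurable fun z : OverlapStructure × (ℕ → E) => z.1.expAverage t z.2 := by
  unfold OverlapStructure.expAverage
  refine Measurable.tsum fun j => ?_
  have := (OverlapStructure.measurable_weight j).comp
    (measurable_fst : Measurable (Prod.fst : OverlapStructure × (ℕ → E) → _))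
  exact this.mul (by fun_prop)

/-- Sums are taken in `[0, ∞]`, so that summability can be deduced from the bound instead of being
presupposed. The total weight is at most one, so the bound does not see `x`. -/
lemma lintegral_tsum_exp_walkKernel_le {φ : ℝ → E} (hφ : Measurable φ) (r n : ℕ)
    (x : OverlapStructure) {t : ℝ} (ht : 0 ≤ t) :
    ∫⁻ p, ∑' j, ENNReal.ofReal (x.weight j * Real.exp (t * ‖p j‖)) ∂walkKernel φ r n x ≤
      expMoment φ t ^ n := by
  rw [lintegral_tsum fun j => Measurable.aemeasurable (by fun_prop)]
  calc _ ≤ ∑' j, ENNReal.ofReal (x.weight j) * expMoment φ t ^ n := by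
        refine ENNReal.tsum_le_tsum fun j => ?_
        simp_rw [ENNReal.ofReal_mul (x.weight_nonneg j)]
        rw [lintegral_const_mul _ (by fun_prop)]
        gcongr
        exact lintegral_exp_walkKernel_le hφ r n x j ht
    _ ≤ _ := by
        rw [ENNReal.tsum_mul_right]
        exact mul_le_of_le_one_left (zero_le) x.tsum_ofReal_weight_le_one

/-- All exponential moments of the field `p` over the particles are finite. -/
def OverlapStructure.HasExpMoments (x : OverlapStructure) (p : ℕ → E) : Prop :=
  ∀ t : ℝ, Summable fun j => x.weight j * Real.exp (t * ‖p j‖)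

/-- Countably many `t` suffice, so a single null set serves all exponents. -/
lemma OverlapStructure.hasExpMoments_iff (x : OverlapStructure) (p : ℕ → E) :
    x.HasExpMoments p ↔ ∀ t : ℕ, Summable fun j => x.weight j * Real.exp (t * ‖p j‖) := by
  refine ⟨fun h t => h t, fun h t => ?_⟩
  obtain ⟨k, hk⟩ := exists_nat_ge t
  refine (h k).of_nonneg_of_le (fun j => x.weight_mul_exp_nonneg j _) fun j => ?_
  exact mul_le_mul_of_nonneg_left (Real.exp_le_exp.2
    (mul_le_mul_of_nonneg_right hk (norm_nonneg _))) (x.2.2.1 j)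

/-- An increment function of at most linear growth. -/
structure HasLinearGrowth (φ : ℝ → E) : Prop where
  measurable : Measurable φ
  bound : ∃ C c : ℝ, ∀ y, ‖φ y‖ ≤ C + c * |y|

lemma HasLinearGrowth.expMoment_pow_lt_top {φ : ℝ → E} (hφ : HasLinearGrowth φ) {t : ℝ}
    (ht : 0 ≤ t) (n : ℕ) : expMoment φ t ^ n < ⊤ := by
  obtain ⟨C, c, h⟩ := hφ.bound
  exact ENNReal.pow_lt_top (expMoment_lt_top hφ.measurable h ht)

lemma ae_hasExpMoments_walkKernel {φ : ℝ → E} (hφ : HasLinearGrowth φ) (r n : ℕ)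
    (x : OverlapStructure) : ∀ᵐ p ∂walkKernel φ r n x, x.HasExpMoments p := by
  simp only [OverlapStructure.hasExpMoments_iff]
  refine ae_all_iff.2 fun t => ?_
  have h := (lintegral_tsum_exp_walkKernel_le hφ.measurable r n x (t := t) (by positivity)).trans_lt
    (hφ.expMoment_pow_lt_top (by positivity) n)
  filter_upwards [ae_lt_top (Measurable.tsum fun j => by fun_prop) h.ne] with p hp
  have := ENNReal.summable_toReal hp.ne
  refine this.congr fun j => ?_
  rw [ENNReal.toReal_ofReal (x.weight_mul_exp_nonneg j _)]

lemma lintegral_expAverage_walkKernel_le {φ : ℝ → E} (hφ : HasLinearGrowth φ) (r n : ℕ)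
    (x : OverlapStructure) {t : ℝ} (ht : 0 ≤ t) :
    ∫⁻ p, ENNReal.ofReal (x.expAverage t p) ∂walkKernel φ r n x ≤ expMoment φ t ^ n := by
  refine le_trans (lintegral_mono_ae ?_)
    (lintegral_tsum_exp_walkKernel_le hφ.measurable r n x ht)
  filter_upwards [ae_hasExpMoments_walkKernel hφ r n x] with p hp
  rw [OverlapStructure.expAverage, ENNReal.ofReal_tsum_of_nonneg
    (fun j => x.weight_mul_exp_nonneg j _) (hp t)]

end Moments

/-! ### Multiple sums dominated by products. -/

section ProductSums

lemma hasSum_mul_of_nonneg {ι κ : Type*} {u : ι → ℝ} {v : κ → ℝ} {a b : ℝ} (hu : HasSum u a)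
    (hv : HasSum v b) (hu0 : ∀ i, 0 ≤ u i) (hv0 : ∀ k, 0 ≤ v k) :
    HasSum (fun z : ι × κ => u z.1 * v z.2) (a * b) :=
  hu.mul hv (hu.summable.mul_of_nonneg hv.summable hu0 hv0)

lemma hasSum_pi_prod {s : ℕ} {f : Fin s → ℕ → ℝ} (hf0 : ∀ l j, 0 ≤ f l j)
    (hf : ∀ l, Summable (f l)) :
    HasSum (fun i : Fin s → ℕ => ∏ l, f l (i l)) (∏ l, ∑' j, f l j) := by
  induction s with
  | zero => simp [hasSum_unique]
  | succ s ih =>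
    have h2 := hasSum_mul_of_nonneg (hf (Fin.last s)).hasSum
      (ih (f := fun l => f l.castSucc) (fun l => hf0 _) (fun l => hf _)) (hf0 (Fin.last s))
      (fun i => Finset.prod_nonneg fun l _ => hf0 _ _)
    rw [Fin.prod_univ_castSucc, mul_comm, ← (Fin.snocEquiv fun _ => ℕ).hasSum_iff]
    convert h2 using 1
    ext z
    simp [Fin.snocEquiv, Fin.prod_univ_castSucc, mul_comm]

lemma summable_replica {s : ℕ} {w : ℕ → ℝ} {y : Fin s → ℕ → ℝ} {G : (Fin s → ℕ) → ℝ}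
    (hw : ∀ j, 0 ≤ w j) (hy : ∀ l j, 0 ≤ y l j) (hs : ∀ l, Summable fun j => w j * y l j)
    (hG : ∀ i, |G i| ≤ ∏ l, y l (i l)) :
    Summable fun i : Fin s → ℕ => (∏ l, w (i l)) * G i := by
  refine (hasSum_pi_prod (fun l j => mul_nonneg (hw j) (hy l j)) hs).summable.of_norm_bounded
    fun i => ?_
  rw [Finset.prod_mul_distrib, norm_mul, Real.norm_eq_abs,
    abs_of_nonneg (Finset.prod_nonneg fun l _ => hw _)]
  exact mul_le_mul_of_nonneg_left (hG i) (Finset.prod_nonneg fun l _ => hw _)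

lemma abs_tsum_replica_le {s : ℕ} {w : ℕ → ℝ} {y : Fin s → ℕ → ℝ} {G : (Fin s → ℕ) → ℝ}
    (hw : ∀ j, 0 ≤ w j) (hy : ∀ l j, 0 ≤ y l j) (hs : ∀ l, Summable fun j => w j * y l j)
    (hG : ∀ i, |G i| ≤ ∏ l, y l (i l)) :
    |∑' i : Fin s → ℕ, (∏ l, w (i l)) * G i| ≤ ∏ l, ∑' j, w j * y l j := by
  rw [← Real.norm_eq_abs]
  refine tsum_of_norm_bounded (hasSum_pi_prod (fun l j => mul_nonneg (hw j) (hy l j)) hs)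
    fun i => ?_
  rw [Finset.prod_mul_distrib, norm_mul, Real.norm_eq_abs,
    abs_of_nonneg (Finset.prod_nonneg fun l _ => hw _)]
  exact mul_le_mul_of_nonneg_left (hG i) (Finset.prod_nonneg fun l _ => hw _)

end ProductSums

/-! ### Averages over sampled points and the entropy inequality. -/

namespace OverlapStructure

variable {m : ℕ}

/-- The overlaps of the points with labels `i`. -/
def overlapsAt {s : ℕ} (x : OverlapStructure) (i : Fin s → ℕ) : Fin s → Fin s → ℝ :=
  fun l l' => x.overlap (i l) (i l')

/-- The sum over `m + 1` points sampled with weights `w` of a function `F` of their overlaps times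
a function `c` of the last point. -/
noncomputable def replicaSum (x : OverlapStructure) (w : ℕ → ℝ)
    (F : (Fin (m + 1) → Fin (m + 1) → ℝ) → ℝ) (c : ℕ → ℝ) : ℝ :=
  ∑' i : Fin (m + 1) → ℕ, (∏ l, w (i l)) * (F (x.overlapsAt i) * c (i (Fin.last m)))

/-- The bounds on the factors of the summands of `replicaSum`. -/
def replicaBound (m : ℕ) (B : ℝ) (c : ℕ → ℝ) (l : Fin (m + 1)) (j : ℕ) : ℝ :=
  if l = Fin.last m then B * |c j| else 1

lemma replicaBound_nonneg {B : ℝ} (hB : 0 ≤ B) (c : ℕ → ℝ) (l : Fin (m + 1)) (j : ℕ) :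
    0 ≤ replicaBound m B c l j := by
  unfold replicaBound; split_ifs <;> positivity

lemma prod_replicaBound (B : ℝ) (c : ℕ → ℝ) (i : Fin (m + 1) → ℕ) :
    ∏ l, replicaBound m B c l (i l) = B * |c (i (Fin.last m))| := by
  rw [Fin.prod_univ_castSucc]
  simp [replicaBound]

lemma summable_replicaBound {w : ℕ → ℝ} (hws : Summable w) (B : ℝ) {c : ℕ → ℝ}
    (hc : Summable fun j => w j * |c j|) (l : Fin (m + 1)) :
    Summable fun j => w j * replicaBound m B c l j := by
  unfold replicaBound
  split_ifs
  · exact (hc.mul_left B).congr fun j => by ring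
  · simpa using hws

lemma abs_replicaTerm_le {x : OverlapStructure} {F : (Fin (m + 1) → Fin (m + 1) → ℝ) → ℝ} {B : ℝ}
    (hF : ∀ q, |F q| ≤ B) (c : ℕ → ℝ) (i : Fin (m + 1) → ℕ) :
    |F (x.overlapsAt i) * c (i (Fin.last m))| ≤ ∏ l, replicaBound m B c l (i l) := by
  rw [prod_replicaBound, abs_mul]
  exact mul_le_mul_of_nonneg_right (hF _) (abs_nonneg _)

lemma summable_replicaSum (x : OverlapStructure) {w : ℕ → ℝ}
    {F : (Fin (m + 1) → Fin (m + 1) → ℝ) → ℝ} {B : ℝ} (hF : ∀ q, |F q| ≤ B)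
    (hw : ∀ j, 0 ≤ w j) (hws : Summable w) {c : ℕ → ℝ} (hc : Summable fun j => w j * |c j|) :
    Summable fun i : Fin (m + 1) → ℕ =>
      (∏ l, w (i l)) * (F (x.overlapsAt i) * c (i (Fin.last m))) :=
  summable_replica hw (replicaBound_nonneg ((abs_nonneg _).trans (hF 0)) c)
    (summable_replicaBound hws B hc) (abs_replicaTerm_le hF c)

lemma abs_replicaSum_le (x : OverlapStructure) {w : ℕ → ℝ}
    {F : (Fin (m + 1) → Fin (m + 1) → ℝ) → ℝ} {B : ℝ} (hF : ∀ q, |F q| ≤ B)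
    (hw : ∀ j, 0 ≤ w j) (hws : Summable w) (hw1 : ∑' j, w j = 1) {c : ℕ → ℝ}
    (hc : Summable fun j => w j * |c j|) :
    |x.replicaSum w F c| ≤ B * ∑' j, w j * |c j| := by
  refine (abs_tsum_replica_le hw (replicaBound_nonneg ((abs_nonneg _).trans (hF 0)) c)
    (summable_replicaBound hws B hc) (abs_replicaTerm_le hF c)).trans_eq ?_
  rw [Fin.prod_univ_castSucc]
  simp only [replicaBound, if_true, Fin.castSucc_ne_last, if_false, mul_one, hw1,
    Finset.prod_const_one, one_mul]
  rw [← tsum_mul_left]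
  exact tsum_congr fun j => by ring

lemma replicaSum_add (x : OverlapStructure) {w : ℕ → ℝ}
    {F : (Fin (m + 1) → Fin (m + 1) → ℝ) → ℝ} {B : ℝ} (hF : ∀ q, |F q| ≤ B)
    (hw : ∀ j, 0 ≤ w j) (hws : Summable w) {c d : ℕ → ℝ} (hc : Summable fun j => w j * |c j|)
    (hd : Summable fun j => w j * |d j|) :
    x.replicaSum w F (fun j => c j + d j) = x.replicaSum w F c + x.replicaSum w F d := by
  unfold replicaSum
  rw [← (x.summable_replicaSum hF hw hws hc).tsum_add (x.summable_replicaSum hF hw hws hd)]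
  exact tsum_congr fun i => by ring

lemma replicaSum_const_mul (x : OverlapStructure) (w : ℕ → ℝ)
    (F : (Fin (m + 1) → Fin (m + 1) → ℝ) → ℝ) (b : ℝ) (c : ℕ → ℝ) :
    x.replicaSum w F (fun j => b * c j) = b * x.replicaSum w F c := by
  unfold replicaSum
  rw [← tsum_mul_left]
  exact tsum_congr fun i => by ring

lemma replicaSum_nonneg (x : OverlapStructure) {w : ℕ → ℝ}
    {F : (Fin (m + 1) → Fin (m + 1) → ℝ) → ℝ} (hF : ∀ q, 0 ≤ F q)
    (hw : ∀ j, 0 ≤ w j) {c : ℕ → ℝ} (hc : ∀ j, 0 ≤ c j) : 0 ≤ x.replicaSum w F c :=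
  tsum_nonneg fun _ => mul_nonneg (Finset.prod_nonneg fun _ _ => hw _)
    (mul_nonneg (hF _) (hc _))

lemma replicaSum_relabel {x y : OverlapStructure} {σ : Equiv.Perm ℕ}
    (h : ∀ i j, y.overlap i j = x.overlap (σ i) (σ j)) (w : ℕ → ℝ)
    (F : (Fin (m + 1) → Fin (m + 1) → ℝ) → ℝ) (c : ℕ → ℝ) :
    y.replicaSum (fun j => w (σ j)) F (fun j => c (σ j)) = x.replicaSum w F c := by
  unfold replicaSum
  rw [← (Equiv.arrowCongr (Equiv.refl (Fin (m + 1))) σ).tsum_eq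
    fun i => (∏ l, w (i l)) * (F (x.overlapsAt i) * c (i (Fin.last m)))]
  refine tsum_congr fun i => ?_
  have : y.overlapsAt i = x.overlapsAt fun l => σ (i l) := by
    ext l l'
    exact h _ _
  rw [this]
  rfl

/-- A tilted average is bounded by the logarithmic moment generating function. -/
lemma replicaSum_le_log (x : OverlapStructure) {w : ℕ → ℝ}
    {F : (Fin (m + 1) → Fin (m + 1) → ℝ) → ℝ} {B : ℝ} (hF0 : ∀ q, 0 ≤ F q) (hF : ∀ q, |F q| ≤ B)
    (hw : ∀ j, 0 ≤ w j) (hws : Summable w) (hw1 : ∑' j, w j = 1) {c : ℕ → ℝ}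
    (hc : Summable fun j => w j * |c j|) (he : Summable fun j => w j * Real.exp (c j)) :
    x.replicaSum w F c ≤
      x.replicaSum w F (fun _ => 1) * (Real.log (∑' j, w j * Real.exp (c j)) - 1) + B := by
  set M := ∑' j, w j * Real.exp (c j) with hM
  have hM0 : 0 < M := by
    have : ∃ j, w j ≠ 0 := by
      by_contra! h
      simp [h] at hw1
    obtain ⟨j, hj⟩ := this
    exact he.tsum_pos (fun j => mul_nonneg (hw j) (Real.exp_nonneg _)) j
      (mul_pos (lt_of_le_of_ne (hw j) (Ne.symm hj)) (Real.exp_pos _))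
  have he' : Summable fun j => w j * |Real.exp (c j)| := he.congr fun j => by
    rw [abs_of_pos (Real.exp_pos _)]
  have h1 : Summable fun j => w j * |(1 : ℝ)| := by simpa using hws
  -- The tangent of the exponential at `log M` gives `c ≤ log M - 1 + e^c / M`. This is integrated
  -- against the nonnegative `F`.
  have hle : x.replicaSum w F c ≤
      x.replicaSum w F (fun j => (Real.log M - 1) * 1 + M⁻¹ * Real.exp (c j)) := by
    have hs2 : Summable fun j => w j * |(Real.log M - 1) * 1 + M⁻¹ * Real.exp (c j)| := by
      refine Summable.of_nonneg_of_le (fun j => mul_nonneg (hw j) (abs_nonneg _)) (fun j => ?_)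
        ((hws.mul_left |Real.log M - 1|).add (he.mul_left M⁻¹))
      have := abs_add_le ((Real.log M - 1) * 1) (M⁻¹ * Real.exp (c j))
      rw [mul_one, abs_of_pos (by positivity : 0 < M⁻¹ * Real.exp (c j))] at this
      calc _ ≤ w j * (|Real.log M - 1| + M⁻¹ * Real.exp (c j)) := by
            rw [mul_one]; exact mul_le_mul_of_nonneg_left this (hw j)
        _ = _ := by ring
    refine (x.summable_replicaSum hF hw hws hc).tsum_le_tsum (fun i => ?_)
      (x.summable_replicaSum hF hw hws hs2)
    refine mul_le_mul_of_nonneg_left (mul_le_mul_of_nonneg_left ?_ (hF0 _))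
      (Finset.prod_nonneg fun _ _ => hw _)
    have h := Real.add_one_le_exp (c (i (Fin.last m)) - Real.log M)
    rw [Real.exp_sub, Real.exp_log hM0, div_eq_inv_mul] at h
    linarith
  refine hle.trans ?_
  rw [replicaSum_add x hF hw hws (c := fun _ => (Real.log M - 1) * 1)
    (d := fun j => M⁻¹ * Real.exp (c j)) (hws.mul_right _)
    ((he.mul_left M⁻¹).congr fun j => by
      rw [abs_of_pos (by positivity : 0 < M⁻¹ * Real.exp (c j))]; ring),
    replicaSum_const_mul, replicaSum_const_mul]
  -- The average of `F e^c` is at most `B M`, so after division by `M` the exponential term costs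
  -- only the constant `B`, however large the increments are.
  have h2 := (le_abs_self _).trans (x.abs_replicaSum_le hF hw hws hw1 he')
  have h3 : ∑' j, w j * |Real.exp (c j)| = M := tsum_congr fun j => by
    rw [abs_of_pos (Real.exp_pos _)]
  rw [h3] at h2
  have h4 : M⁻¹ * x.replicaSum w F (fun j => Real.exp (c j)) ≤ B := by
    rw [inv_mul_le_iff₀ hM0, mul_comm]; exact h2
  linarith

end OverlapStructure

/-! ### Composition of steps and bounds for the normalization. -/

namespace OverlapStructure

/-- The normalization of the weights after the increments `a`. -/
noncomputable def partition (x : OverlapStructure) (a : ℕ → ℝ) : ℝ :=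
  ∑' j, x.weight j * Real.exp (a j)

/-- The weights sum up to one. -/
def IsProper (x : OverlapStructure) : Prop := ∑' j, x.weight j = 1

lemma reweight_eq (x : OverlapStructure) (a : ℕ → ℝ) (i : ℕ) :
    x.reweight a i = x.weight i * Real.exp (a i) / x.partition a := rfl

lemma measurable_partition :
    Measurable fun z : OverlapStructure × (ℕ → ℝ) => z.1.partition z.2 := by
  unfold partition
  refine Measurable.tsum fun j => ?_
  exact ((measurable_weight j).comp measurable_fst).mul (by fun_prop)

lemma tsum_reweight {x : OverlapStructure} {a : ℕ → ℝ} (h : x.partition a ≠ 0) :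
    ∑' i, x.reweight a i = 1 := by
  simp only [reweight_eq, tsum_div_const]
  exact div_self h

lemma partition_pos_of_ne {x : OverlapStructure} {a : ℕ → ℝ} {i : ℕ} (hi : x.weight i ≠ 0)
    (h : Summable fun j => x.weight j * Real.exp (a j)) : 0 < x.partition a :=
  h.tsum_pos (fun j => x.weight_mul_exp_nonneg j _) i
    (mul_pos (lt_of_le_of_ne (x.weight_nonneg i) (Ne.symm hi)) (Real.exp_pos _))

lemma IsProper.exists_weight_ne {x : OverlapStructure} (hx : x.IsProper) : ∃ i, x.weight i ≠ 0 := by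
  by_contra! h
  simp [IsProper, h] at hx

lemma IsProper.partition_pos {x : OverlapStructure} (hx : x.IsProper) {a : ℕ → ℝ}
    (h : Summable fun j => x.weight j * Real.exp (a j)) : 0 < x.partition a :=
  let ⟨_, hi⟩ := hx.exists_weight_ne
  partition_pos_of_ne hi h

/-- The normalization of the first step cancels, which is why successive steps compose by adding
their increments. -/
lemma reweight_add {x : OverlapStructure} {a : ℕ → ℝ} (h : x.partition a ≠ 0) (b : ℕ → ℝ) (i : ℕ) :
    x.reweight (a + b) i =
      x.reweight a i * Real.exp (b i) / ∑' j, x.reweight a j * Real.exp (b j) := by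
  have e : ∀ j, x.reweight a j * Real.exp (b j) =
      x.weight j * Real.exp ((a + b) j) / x.partition a := fun j => by
    rw [reweight_eq, Pi.add_apply, Real.exp_add]; ring
  simp only [e, tsum_div_const]
  rw [reweight_eq, div_div_div_cancel_right₀ h]
  rfl

lemma tsum_reweight_mul_exp (x : OverlapStructure) (a b : ℕ → ℝ) :
    ∑' j, x.reweight a j * Real.exp (b j) = x.partition (a + b) / x.partition a := by
  rw [partition, ← tsum_div_const]
  refine tsum_congr fun j => ?_
  rw [reweight_eq, Pi.add_apply, Real.exp_add]; ring

/-- The multiplicative cocycle property of the normalization; `σ` translates the increments into the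
labels of the evolved structure. -/
lemma partition_evolve {x y : OverlapStructure} {a : ℕ → ℝ} {σ : Equiv.Perm ℕ}
    (hσ : ∀ i, y.weight i = x.reweight a (σ i)) (b : ℕ → ℝ) :
    y.partition (fun i => b (σ i)) = x.partition (a + b) / x.partition a := by
  rw [← tsum_reweight_mul_exp, ← σ.tsum_eq]
  simp [partition, hσ]

lemma reweight_evolve {x y : OverlapStructure} {a : ℕ → ℝ} {σ : Equiv.Perm ℕ}
    (hσ : ∀ i, y.weight i = x.reweight a (σ i)) (h : x.partition a ≠ 0) (b : ℕ → ℝ) (i : ℕ) :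
    y.reweight (fun i => b (σ i)) i = x.reweight (a + b) (σ i) := by
  rw [reweight_eq, partition_evolve hσ, reweight_add h, tsum_reweight_mul_exp, hσ]

section Bounds

variable {E : Type*} [NormedAddCommGroup E]

lemma HasExpMoments.summable_exp {x : OverlapStructure} {p : ℕ → E} (h : x.HasExpMoments p)
    {t : ℝ} {a : ℕ → ℝ} (ha : ∀ j, a j ≤ t * ‖p j‖) :
    Summable fun j => x.weight j * Real.exp (a j) :=
  (h t).of_nonneg_of_le (fun j => x.weight_mul_exp_nonneg j _) fun j =>
    mul_le_mul_of_nonneg_left (Real.exp_le_exp.2 (ha j)) (x.weight_nonneg j)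

lemma HasExpMoments.partition_le {x : OverlapStructure} {p : ℕ → E} (h : x.HasExpMoments p)
    {t : ℝ} {a : ℕ → ℝ} (ha : ∀ j, a j ≤ t * ‖p j‖) :
    x.partition a ≤ x.expAverage t p :=
  (h.summable_exp ha).tsum_le_tsum (fun j => mul_le_mul_of_nonneg_left
    (Real.exp_le_exp.2 (ha j)) (x.weight_nonneg j)) (h t)

lemma expAverage_nonneg (x : OverlapStructure) (t : ℝ) (p : ℕ → E) : 0 ≤ x.expAverage t p :=
  tsum_nonneg fun j => x.weight_mul_exp_nonneg j _

lemma HasExpMoments.expAverage_mono {x : OverlapStructure} {p : ℕ → E} (h : x.HasExpMoments p)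
    {t u : ℝ} (htu : t ≤ u) : x.expAverage t p ≤ x.expAverage u p :=
  (h t).tsum_le_tsum (fun j => mul_le_mul_of_nonneg_left (Real.exp_le_exp.2
    (mul_le_mul_of_nonneg_right htu (norm_nonneg _))) (x.weight_nonneg j)) (h u)

lemma HasExpMoments.one_le_expAverage {x : OverlapStructure} {p : ℕ → E} (h : x.HasExpMoments p)
    (hx : x.IsProper) {t : ℝ} (ht : 0 ≤ t) : 1 ≤ x.expAverage t p := by
  refine le_trans (le_of_eq ?_) (h.expAverage_mono ht)
  simpa [expAverage] using hx.symm

/-- Jensen's inequality for the `k`-th power, from Bernoulli's inequality at the mean `V`. It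
reduces products of exponential averages to a single one, whose expectation is known to be finite.
-/
lemma HasExpMoments.expAverage_pow_le {x : OverlapStructure} {p : ℕ → E} (h : x.HasExpMoments p)
    (hx : x.IsProper) {t : ℝ} (ht : 0 ≤ t) (k : ℕ) :
    x.expAverage t p ^ k ≤ x.expAverage (k * t) p := by
  set V := x.expAverage t p with hV
  have hV0 : 0 < V := zero_lt_one.trans_le (h.one_le_expAverage hx ht)
  have key : ∑' j, x.weight j * (1 + k * (V⁻¹ * Real.exp (t * ‖p j‖) - 1)) ≤
      ∑' j, (V⁻¹) ^ k * (x.weight j * Real.exp (k * t * ‖p j‖)) := by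
    refine Summable.tsum_le_tsum (fun j => ?_) ?_ ((h (k * t)).mul_left _)
    · have hb := one_add_mul_le_pow (a := V⁻¹ * Real.exp (t * ‖p j‖) - 1)
        (by have : 0 < V⁻¹ * Real.exp (t * ‖p j‖) := by positivity
            linarith) k
      rw [add_sub_cancel, mul_pow, ← Real.exp_nat_mul, ← mul_assoc] at hb
      calc _ ≤ x.weight j * (V⁻¹ ^ k * Real.exp (k * t * ‖p j‖)) :=
            mul_le_mul_of_nonneg_left hb (x.weight_nonneg j)
        _ = _ := by ring
    · exact ((x.summable_weight.mul_right (1 - k : ℝ)).add ((h t).mul_left (k * V⁻¹))).congr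
        fun j => by ring
  have e1 : ∑' j, x.weight j * (1 + k * (V⁻¹ * Real.exp (t * ‖p j‖) - 1)) = 1 := by
    have : ∀ j, x.weight j * (1 + k * (V⁻¹ * Real.exp (t * ‖p j‖) - 1)) =
        x.weight j * (1 - k : ℝ) + (k * V⁻¹) * (x.weight j * Real.exp (t * ‖p j‖)) :=
      fun j => by ring
    simp only [this]
    rw [(x.summable_weight.mul_right _).tsum_add ((h t).mul_left _), tsum_mul_right, tsum_mul_left,
      hx]
    change 1 * (1 - (k : ℝ)) + k * V⁻¹ * V = 1
    field_simp
    ring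
  rw [e1, tsum_mul_left, inv_pow] at key
  have := (le_inv_mul_iff₀ (pow_pos hV0 k)).1 key
  rwa [mul_one] at this

/-- Jensen's inequality for the inverse: the tangent bound `1 / u ≥ 2 / Z - u / Z²` at `Z`, averaged
over the weights, bounds `1 / Z` by the normalization of the opposite increments. -/
lemma HasExpMoments.inv_partition_le {x : OverlapStructure} {p : ℕ → E} (h : x.HasExpMoments p)
    (hx : x.IsProper) {t : ℝ} {a : ℕ → ℝ} (ha : ∀ j, |a j| ≤ t * ‖p j‖) :
    (x.partition a)⁻¹ ≤ x.expAverage t p := by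
  have hs := h.summable_exp fun j => (le_abs_self _).trans (ha j)
  have hs' := h.summable_exp (a := fun j => - a j) fun j => (neg_le_abs _).trans (ha j)
  have hZ := hx.partition_pos hs
  refine le_trans ?_ (h.partition_le (a := fun j => - a j) fun j => (neg_le_abs _).trans (ha j))
  set Z := x.partition a with hZdef
  have key : ∑' j, x.weight j * (2 * Z⁻¹ - Z⁻¹ ^ 2 * Real.exp (a j)) ≤
      x.partition fun j => - a j := by
    refine Summable.tsum_le_tsum (fun j => mul_le_mul_of_nonneg_left ?_ (x.weight_nonneg j)) ?_ hs'
    · rw [Real.exp_neg]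
      have hu := Real.exp_pos (a j)
      have : (Real.exp (a j))⁻¹ - (2 * Z⁻¹ - Z⁻¹ ^ 2 * Real.exp (a j)) =
          (Real.exp (a j))⁻¹ * (1 - Z⁻¹ * Real.exp (a j)) ^ 2 := by
        field_simp
        ring
      have h2 : 0 ≤ (Real.exp (a j))⁻¹ * (1 - Z⁻¹ * Real.exp (a j)) ^ 2 := by positivity
      linarith
    · exact ((x.summable_weight.mul_right (2 * Z⁻¹)).sub (hs.mul_left (Z⁻¹ ^ 2))).congr
        fun j => by ring
  refine le_trans (le_of_eq ?_) key
  have : ∀ j, x.weight j * (2 * Z⁻¹ - Z⁻¹ ^ 2 * Real.exp (a j)) =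
      x.weight j * (2 * Z⁻¹) - Z⁻¹ ^ 2 * (x.weight j * Real.exp (a j)) := fun j => by ring
  simp only [this]
  rw [(x.summable_weight.mul_right _).tsum_sub (hs.mul_left _), tsum_mul_right, tsum_mul_left, hx]
  change Z⁻¹ = 1 * (2 * Z⁻¹) - Z⁻¹ ^ 2 * Z
  field_simp
  ring

/-- The bound `log u ≤ u - 1` is applied to `Z` and to `1 / Z`. -/
lemma HasExpMoments.abs_log_partition_le {x : OverlapStructure} {p : ℕ → E}
    (h : x.HasExpMoments p) (hx : x.IsProper) {t : ℝ} {a : ℕ → ℝ} (ha : ∀ j, |a j| ≤ t * ‖p j‖) :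
    |Real.log (x.partition a)| ≤ x.expAverage t p := by
  have hs := h.summable_exp fun j => (le_abs_self _).trans (ha j)
  have hZ := hx.partition_pos hs
  have h1 := h.partition_le fun j => (le_abs_self _).trans (ha j)
  have h2 := h.inv_partition_le hx ha
  rw [abs_le]
  constructor
  · have := Real.log_le_sub_one_of_pos (inv_pos.2 hZ)
    rw [Real.log_inv] at this
    linarith
  · have := Real.log_le_sub_one_of_pos hZ
    linarith

end Bounds

end OverlapStructure

/-! ### Proper weights and label-independent functions. -/

namespace OverlapStructure

lemma weight_eq_zero_of_zero {x : OverlapStructure} (h : x.weight 0 = 0) (i : ℕ) :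
    x.weight i = 0 := by
  have h1 : x.weight i ≤ x.weight 0 := x.2.1 (Nat.zero_le i)
  exact le_antisymm (h1.trans h.le) (x.weight_nonneg i)

lemma IsProper.weight_zero_ne {x : OverlapStructure} (hx : x.IsProper) : x.weight 0 ≠ 0 := by
  intro h
  obtain ⟨i, hi⟩ := hx.exists_weight_ne
  exact hi (weight_eq_zero_of_zero h i)

lemma isProper_of_perm {x y : OverlapStructure} {a : ℕ → ℝ} {σ : Equiv.Perm ℕ}
    (hσ : ∀ i, y.weight i = x.reweight a (σ i)) (h : x.partition a ≠ 0) : y.IsProper := by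
  simp only [IsProper, hσ]
  rw [σ.tsum_eq, tsum_reweight h]

lemma isProper_evolve {x : OverlapStructure} {a : ℕ → ℝ} (h : x.partition a ≠ 0) :
    (x.evolve a).IsProper :=
  let ⟨_, hσ, _⟩ := x.exists_perm_evolve a
  isProper_of_perm hσ h

lemma weight_zero_evolve {x : OverlapStructure} (h : x.weight 0 = 0) (a : ℕ → ℝ) :
    (x.evolve a).weight 0 = 0 := by
  obtain ⟨σ, hσ, -⟩ := x.exists_perm_evolve a
  rw [hσ, reweight_eq, weight_eq_zero_of_zero h, zero_mul, zero_div]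

lemma measurableSet_isProper : MeasurableSet {x : OverlapStructure | x.IsProper} :=
  (Measurable.tsum fun j => measurable_weight j) (measurableSet_singleton 1)

/-- `f` does not depend on the labels of the particles. -/
def RelabelInvariant {α : Type*} (f : OverlapStructure → α) : Prop :=
  ∀ x y σ, IsRelabeling x y σ → f y = f x

/-- Two sortings of a common array are compared directly. The array `(w, q)` need not be an overlap
structure, because `w` may be unsorted. -/
lemma RelabelInvariant.eq_of_perm {α : Type*} {f : OverlapStructure → α} (hf : RelabelInvariant f)
    {w : ℕ → ℝ} {q : ℕ → ℕ → ℝ} {x y : OverlapStructure} {σ τ : Equiv.Perm ℕ}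
    (hx : ∀ i, x.weight i = w (σ i)) (hx' : ∀ i j, x.overlap i j = q (σ i) (σ j))
    (hy : ∀ i, y.weight i = w (τ i)) (hy' : ∀ i j, y.overlap i j = q (τ i) (τ j)) : f x = f y := by
  refine hf y x (σ.trans τ.symm) ⟨fun i => ?_, fun i j => ?_⟩
  · simp [hx, hy]
  · simp [hx', hy']

lemma measurable_evolve_left (x : OverlapStructure) : Measurable fun a => x.evolve a :=
  measurable_evolve.comp measurable_prodMk_left

end OverlapStructure

open OverlapStructure

/-! ### Consequences of quasi-stationarity. -/

section Stationarity

lemma evolutionKernel_eq_map {φ : ℝ → ℝ} (hφ : Measurable φ) (r : ℕ) (x : OverlapStructure) :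
    evolutionKernel φ r x = (incrementKernel φ r x).map fun a => x.evolve a := by
  rw [evolutionKernel_apply hφ, incrementKernel_apply hφ,
    Measure.map_map (measurable_evolve_left x) (measurable_pi_comp hφ)]
  rfl

lemma ae_incrementKernel_partition_ne {φ : ℝ → ℝ} (hφ : HasLinearGrowth φ) (r n : ℕ)
    {x : OverlapStructure} (hx : x.weight 0 ≠ 0) :
    ∀ᵐ a ∂walkKernel φ r n x, x.partition a ≠ 0 := by
  filter_upwards [ae_hasExpMoments_walkKernel hφ r n x] with a ha
  exact (partition_pos_of_ne hx (ha.summable_exp (t := 1) fun j => by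
    rw [one_mul]; exact le_abs_self _)).ne'

variable {P : Measure OverlapStructure} [IsProbabilityMeasure P] {φ : ℝ → ℝ} {r : ℕ}

/-- Adjoining the increments turns the invariant kernel into a measure preserving map, so that
composition with one step is an isometry of L². -/
lemma measurePreserving_evolve (hφ : Measurable φ) (h : IsQuasiStationary P φ r) :
    MeasurePreserving (fun z : OverlapStructure × (ℕ → ℝ) => z.1.evolve z.2)
      (P ⊗ₘ incrementKernel φ r) P := by
  refine ⟨measurable_evolve, ?_⟩
  ext s hs
  have h1 := congrArg (fun μ : Measure OverlapStructure => μ s) h.def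
  rw [show (P.bind (evolutionKernel φ r)) s = _ from
    Measure.bind_apply hs (Kernel.aemeasurable _)] at h1
  rw [Measure.map_apply measurable_evolve hs, Measure.compProd_apply (measurable_evolve hs), ← h1]
  refine lintegral_congr fun x => ?_
  rw [evolutionKernel_eq_map hφ,
    Measure.map_apply (measurable_evolve_left x) hs]
  rfl

lemma measurePreserving_fst_compProd (hφ : Measurable φ) :
    MeasurePreserving (Prod.fst : OverlapStructure × (ℕ → ℝ) → OverlapStructure)
      (P ⊗ₘ incrementKernel φ r) P := by
  have := isMarkovKernel_incrementKernel hφ r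
  exact ⟨measurable_fst, Measure.fst_compProd P _⟩

/-- By invariance the property may be checked after one step, and there the weights have been
normalized unless they all vanish. -/
lemma ae_isProper_of_weight_ne (hφ : HasLinearGrowth φ) (h : IsQuasiStationary P φ r) :
    ∀ᵐ x ∂P, x.weight 0 ≠ 0 → x.IsProper := by
  have hS : MeasurableSet {x : OverlapStructure | x.weight 0 ≠ 0 → x.IsProper} := by
    have : {x : OverlapStructure | x.weight 0 ≠ 0 → x.IsProper} =
        {x | x.weight 0 = 0} ∪ {x | x.IsProper} := by
      ext x
      simp only [Set.mem_ofPred_eq, Set.mem_union]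
      tauto
    rw [this]
    exact (measurable_weight 0 (measurableSet_singleton 0)).union measurableSet_isProper
  have hp := measurePreserving_evolve hφ.measurable h
  rw [← hp.map_eq, ae_map_iff hp.aemeasurable hS]
  refine Measure.ae_compProd_of_ae_ae (hp.measurable hS) (Filter.Eventually.of_forall fun x => ?_)
  by_cases hx : x.weight 0 = 0
  · exact Filter.Eventually.of_forall fun a ha => absurd (weight_zero_evolve hx a) ha
  · rw [← walkKernel_one]
    filter_upwards [ae_incrementKernel_partition_ne hφ r 1 hx] with a ha _
    exact isProper_evolve ha

/-- By ergodicity the weights vanish almost surely or sum up to one almost surely. -/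
theorem ae_weight_eq_zero_or_ae_isProper (hφ : HasLinearGrowth φ) (h : IsQuasiStationary P φ r)
    (he : IsErgodicEvolution P φ r) :
    (∀ᵐ x ∂P, ∀ i, x.weight i = 0) ∨ ∀ᵐ x ∂P, x.IsProper := by
  classical
  have hS : MeasurableSet {x : OverlapStructure | x.weight 0 = 0} :=
    measurable_weight 0 (measurableSet_singleton 0)
  -- Vanishing weights stay zero and other weights become proper, so this indicator is unchanged by
  -- a step and is constant by ergodicity.
  set f : OverlapStructure → ℝ := Set.indicator {x | x.weight 0 = 0} fun _ => 1 with hf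
  have hfm : Measurable f := measurable_const.indicator hS
  obtain ⟨c, hc⟩ := he f hfm ⟨1, fun x => by
    by_cases hx : x.weight 0 = 0 <;> simp [hf, hx]⟩ (Filter.Eventually.of_forall fun x => by
      have := isMarkovKernel_incrementKernel hφ.measurable r
      rw [evolutionKernel_eq_map hφ.measurable, integral_map
        (measurable_evolve_left x).aemeasurable hfm.aestronglyMeasurable]
      by_cases hx : x.weight 0 = 0
      · have : ∀ a, f (x.evolve a) = 1 := fun a => by simp [hf, weight_zero_evolve hx a]
        rw [integral_congr_ae (Filter.Eventually.of_forall this)]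
        simp [hf, hx]
      · have : ∀ᵐ a ∂incrementKernel φ r x, f (x.evolve a) = 0 := by
          rw [← walkKernel_one]
          filter_upwards [ae_incrementKernel_partition_ne hφ r 1 hx] with a ha
          simp [hf, (isProper_evolve ha).weight_zero_ne]
        rw [integral_congr_ae this]
        simp [hf, hx])
  by_cases hc0 : c = 0
  · right
    filter_upwards [hc, ae_isProper_of_weight_ne hφ h] with x hx hp
    refine hp fun h0 => ?_
    simp [hf, h0, hc0] at hx
  · left
    filter_upwards [hc] with x hx
    refine weight_eq_zero_of_zero ?_
    by_contra h0
    simp only [hf, Set.indicator, Set.mem_ofPred_eq, h0, if_false] at hx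
    exact hc0 hx.symm

/-- The law of a label-independent function is preserved by `n` steps of the evolution. -/
theorem lintegral_evolve_walkKernel (hφ : HasLinearGrowth φ) (h : IsQuasiStationary P φ r)
    (hP : ∀ᵐ x ∂P, x.IsProper) {f : OverlapStructure → ENNReal} (hf : Measurable f)
    (hfi : RelabelInvariant f) (n : ℕ) :
    ∫⁻ x, ∫⁻ a, f (x.evolve a) ∂walkKernel φ r n x ∂P = ∫⁻ x, f x ∂P := by
  have hfe : Measurable fun z : OverlapStructure × (ℕ → ℝ) => f (z.1.evolve z.2) :=
    hf.comp measurable_evolve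
  induction n with
  | zero =>
    refine lintegral_congr_ae ?_
    filter_upwards [hP] with x hx
    rw [walkKernel, Kernel.const_apply, lintegral_dirac' _ (show Measurable fun a => f (x.evolve a) from
      hf.comp (measurable_evolve_left x))]
    obtain ⟨σ, hσ, hσ'⟩ := x.exists_perm_evolve 0
    refine hfi x _ σ ⟨fun i => ?_, hσ'⟩
    have : x.partition 0 = 1 := by
      simp only [partition, Pi.zero_apply, Real.exp_zero, mul_one]
      exact hx
    rw [hσ, reweight_eq, this]
    simp
  | succ n ih =>
    set g : OverlapStructure → ENNReal := fun x => ∫⁻ a, f (x.evolve a) ∂walkKernel φ r n x with hg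
    have hgm : Measurable g := hfe.lintegral_kernel_prod_right
    have hp := measurePreserving_evolve hφ.measurable h
    rw [← ih, ← hp.lintegral_comp hgm, Measure.lintegral_compProd (show Measurable fun z : OverlapStructure × (ℕ → ℝ) =>
      g (z.1.evolve z.2) from hgm.comp measurable_evolve)]
    refine lintegral_congr_ae ?_
    filter_upwards [hP] with x hx
    rw [lintegral_walkKernel_succ _ _ _ _
      (show Measurable fun a => f (x.evolve a) from hf.comp (measurable_evolve_left x))]
    refine lintegral_congr_ae ?_
    rw [← walkKernel_one]
    filter_upwards [ae_incrementKernel_partition_ne hφ r 1 hx.weight_zero_ne] with a ha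
    obtain ⟨σ, hσ, hσ'⟩ := x.exists_perm_evolve a
    simp only [hg]
    rw [walkKernel_relabel hφ.measurable r n hσ',
      lintegral_map (show Measurable fun b => f ((x.evolve a).evolve b) from
        hf.comp (measurable_evolve_left _)) (by fun_prop)]
    refine lintegral_congr fun b => ?_
    -- Two successive sortings and one sorting of the total increment arrange the same array. The
    -- permutations may differ on ties, which label-independence of `f` absorbs.
    obtain ⟨τ, hτ, hτ'⟩ := x.exists_perm_evolve (a + b)
    obtain ⟨ρ, hρ, hρ'⟩ := (x.evolve a).exists_perm_evolve fun i => b (σ i)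
    refine hfi.eq_of_perm (σ := τ) (τ := ρ.trans σ) hτ hτ' (fun i => ?_) fun i j => ?_
    · rw [hρ, reweight_evolve hσ ha]; rfl
    · rw [hρ', hσ']; rfl

theorem map_evolve_walkKernel (hφ : HasLinearGrowth φ) (h : IsQuasiStationary P φ r)
    (hP : ∀ᵐ x ∂P, x.IsProper) {f : OverlapStructure → ℝ} (hf : Measurable f)
    (hfi : RelabelInvariant f) (n : ℕ) :
    (P ⊗ₘ walkKernel φ r n).map (fun z => f (z.1.evolve z.2)) = P.map f := by
  ext s hs
  have hm : Measurable (s.indicator (1 : ℝ → ENNReal)) := measurable_one.indicator hs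
  have key := lintegral_evolve_walkKernel hφ h hP (hm.comp hf)
    (fun x y σ hxy => by simp [hfi x y σ hxy]) n
  rw [← lintegral_indicator_one hs, ← lintegral_indicator_one hs,
    lintegral_map hm (show Measurable fun z : OverlapStructure × (ℕ → ℝ) =>
      f (z.1.evolve z.2) from hf.comp measurable_evolve),
    lintegral_map hm hf, Measure.lintegral_compProd (show Measurable fun z : OverlapStructure × (ℕ → ℝ) =>
      s.indicator (1 : ℝ → ENNReal) (f (z.1.evolve z.2)) from hm.comp (hf.comp measurable_evolve))]
  exact key

end Stationarity

/-! ### The mean ergodic theorem. -/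

section MeanErgodic

open Filter Topology

/-- The ergodic averages of a vector that is orthogonal to the fixed points tend to zero. -/
lemma tendsto_norm_div_of_contraction {H : Type*} [NormedAddCommGroup H] [InnerProductSpace ℝ H]
    [CompleteSpace H] {T : H →L[ℝ] H} (hT : ‖T‖ ≤ 1) {g : H}
    (hg : ∀ f, T f = f → inner ℝ f g = 0) {U : ℕ → H} (hU0 : U 0 = 0)
    (hU : ∀ n, U (n + 1) = g + T (U n)) :
    Tendsto (fun n : ℕ => ‖U n‖ / n) atTop (𝓝 0) := by
  have hUs : ∀ n, U n = ∑ k ∈ Finset.range n, T^[k] g := by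
    intro n
    induction n with
    | zero => simpa using hU0
    | succ n ih =>
      rw [hU, ih, map_sum, Finset.sum_range_succ', add_comm]
      simp only [Function.iterate_succ_apply', Function.iterate_zero, id]
  -- Birkhoff averages of `g` converge to its projection on the fixed vectors, which is zero by
  -- `hg`.
  have h := T.tendsto_birkhoffAverage_orthogonalProjection hT g
  have h0 : ((T : H →ₗ[ℝ] H).eqLocus ((1 : H →L[ℝ] H) : H →ₗ[ℝ] H)).orthogonalProjectionOnto g
      = 0 := by
    rw [Submodule.orthogonalProjectionOnto_eq_zero_iff]
    intro f hf
    exact hg f (by simpa using hf)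
  rw [h0] at h
  have h2 := h.norm
  simp only [ZeroMemClass.coe_zero, norm_zero] at h2
  refine h2.congr fun n => ?_
  rw [birkhoffAverage, birkhoffSum, norm_smul, hUs]
  simp [div_eq_inv_mul]

end MeanErgodic

/-! ### The transition operator on L². -/

section Koopman

variable {P : Measure OverlapStructure} [IsProbabilityMeasure P] {φ : ℝ → ℝ} {r : ℕ}

/-- The transition operator of the evolution on `L²`. -/
noncomputable def transitionOperator (hφ : Measurable φ) (h : IsQuasiStationary P φ r) :
    Lp ℝ 2 P →L[ℝ] Lp ℝ 2 P :=
  (ContinuousLinearMap.adjoint (Lp.compMeasurePreservingₗᵢ ℝ Prod.fst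
    (measurePreserving_fst_compProd (P := P) (r := r) hφ)).toContinuousLinearMap).comp
    (Lp.compMeasurePreservingₗᵢ ℝ _ (measurePreserving_evolve hφ h)).toContinuousLinearMap

lemma inner_transitionOperator (hφ : Measurable φ) (h : IsQuasiStationary P φ r)
    (f g : Lp ℝ 2 P) : inner ℝ (transitionOperator hφ h f) g =
      inner ℝ (Lp.compMeasurePreservingₗᵢ ℝ _ (measurePreserving_evolve hφ h) f)
        (Lp.compMeasurePreservingₗᵢ ℝ Prod.fst
          (measurePreserving_fst_compProd (P := P) (r := r) hφ) g) := by
  rw [transitionOperator, ContinuousLinearMap.comp_apply, ContinuousLinearMap.adjoint_inner_left]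
  rfl

lemma norm_transitionOperator_le (hφ : Measurable φ) (h : IsQuasiStationary P φ r) :
    ‖transitionOperator hφ h‖ ≤ 1 := by
  refine (ContinuousLinearMap.opNorm_comp_le _ _).trans ?_
  rw [LinearIsometryEquiv.norm_map]
  exact mul_le_one₀ (LinearIsometry.norm_toContinuousLinearMap_le _) (norm_nonneg _)
    (LinearIsometry.norm_toContinuousLinearMap_le _)

/-- The equality case of Cauchy–Schwarz: for a fixed vector, the two isometric copies of `f`, before
and after the step, have inner product equal to the square of their common norm, hence coincide.
Invariance in mean thus becomes invariance along almost every step. -/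
lemma ae_evolve_eq_of_transitionOperator (hφ : Measurable φ) (h : IsQuasiStationary P φ r)
    {f : Lp ℝ 2 P} (hf : transitionOperator hφ h f = f) :
    ∀ᵐ z ∂(P ⊗ₘ incrementKernel φ r), f (z.1.evolve z.2) = f z.1 := by
  set ι₁ := Lp.compMeasurePreservingₗᵢ (E := ℝ) (p := 2) ℝ Prod.fst
          (measurePreserving_fst_compProd (P := P) (r := r) hφ) with h1
  set ι₂ := Lp.compMeasurePreservingₗᵢ (E := ℝ) (p := 2) ℝ _ (measurePreserving_evolve hφ h) with h2
  have hi : inner ℝ (ι₂ f) (ι₁ f) = ‖f‖ ^ 2 := by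
    rw [← inner_transitionOperator hφ h, hf, real_inner_self_eq_norm_sq]
  have h0 : ‖ι₂ f - ι₁ f‖ ^ 2 = 0 := by
    rw [norm_sub_sq_real, hi, ι₁.norm_map, ι₂.norm_map]
    ring
  have he : ι₂ f = ι₁ f := by
    rw [← sub_eq_zero, ← norm_eq_zero]
    exact pow_eq_zero_iff (two_ne_zero) |>.1 h0
  have e1 := Lp.coeFn_compMeasurePreserving f (measurePreserving_fst_compProd (P := P) (r := r) hφ)
  have e2 := Lp.coeFn_compMeasurePreserving f (measurePreserving_evolve hφ h)
  have he' : Lp.compMeasurePreserving _ (measurePreserving_evolve hφ h) f =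
    Lp.compMeasurePreserving Prod.fst (measurePreserving_fst_compProd (P := P) (r := r) hφ) f := he
  rw [he'] at e2
  filter_upwards [e1, e2] with z hz1 hz2
  exact (hz2.symm.trans hz1 : _)

/-- Ergodicity concerns bounded functions only. Invariance along almost every step, unlike
invariance in mean, survives composition with the bounded injective function `arctan`. -/
lemma ae_const_of_transitionOperator (hφ : Measurable φ) (h : IsQuasiStationary P φ r)
    (he : IsErgodicEvolution P φ r) {f : Lp ℝ 2 P} (hf : transitionOperator hφ h f = f) :
    ∃ c : ℝ, ∀ᵐ x ∂P, f x = c := by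
  have := isMarkovKernel_incrementKernel hφ r
  have hfm : Measurable fun x => Real.arctan (f x) :=
    Real.continuous_arctan.measurable.comp (Lp.stronglyMeasurable f).measurable
  obtain ⟨c, hc⟩ := he (fun x => Real.arctan (f x)) hfm
    ⟨Real.pi / 2, fun x => abs_le.2 ⟨(Real.neg_pi_div_two_lt_arctan _).le,
      (Real.arctan_lt_pi_div_two _).le⟩⟩ (by
      filter_upwards [Measure.ae_ae_of_ae_compProd
        (ae_evolve_eq_of_transitionOperator hφ h hf)] with x hx
      rw [evolutionKernel_eq_map hφ, integral_map (measurable_evolve_left x).aemeasurable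
        hfm.aestronglyMeasurable]
      have : ∀ᵐ a ∂incrementKernel φ r x, Real.arctan (f (x.evolve a)) = Real.arctan (f x) := by
        filter_upwards [hx] with a ha
        rw [ha]
      rw [integral_congr_ae this]
      simp)
  refine ⟨Real.tan c, ?_⟩
  filter_upwards [hc] with x hx
  rw [← hx, Real.tan_arctan]

end Koopman

/-! ### Integrability of exponential averages. -/

section ExpAverageIntegrable

variable {E : Type*} [NormedAddCommGroup E] [MeasurableSpace E] [BorelSpace E]
  [SecondCountableTopology E] {φ : ℝ → E}

lemma integrable_expAverage_walkKernel (hφ : HasLinearGrowth φ) (r n : ℕ) (x : OverlapStructure)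
    {t : ℝ} (ht : 0 ≤ t) : Integrable (x.expAverage t) (walkKernel φ r n x) := by
  refine ⟨((measurable_expAverage t).comp measurable_prodMk_left).aestronglyMeasurable, ?_⟩
  rw [hasFiniteIntegral_iff_ofReal (Filter.Eventually.of_forall (x.expAverage_nonneg t))]
  exact (lintegral_expAverage_walkKernel_le hφ r n x ht).trans_lt (hφ.expMoment_pow_lt_top ht n)

lemma integral_expAverage_walkKernel_le (hφ : HasLinearGrowth φ) (r n : ℕ) (x : OverlapStructure)
    {t : ℝ} (ht : 0 ≤ t) :
    ∫ p, x.expAverage t p ∂walkKernel φ r n x ≤ (expMoment φ t ^ n).toReal := by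
  rw [integral_eq_lintegral_of_nonneg_ae (Filter.Eventually.of_forall (x.expAverage_nonneg t))
    ((measurable_expAverage t).comp measurable_prodMk_left).aestronglyMeasurable]
  exact ENNReal.toReal_mono (hφ.expMoment_pow_lt_top ht n).ne
    (lintegral_expAverage_walkKernel_le hφ r n x ht)

lemma integrable_expAverage_compProd (hφ : HasLinearGrowth φ) (r n : ℕ)
    (P : Measure OverlapStructure) [IsProbabilityMeasure P] {t : ℝ} (ht : 0 ≤ t) :
    Integrable (fun z : OverlapStructure × (ℕ → E) => z.1.expAverage t z.2)
      (P ⊗ₘ walkKernel φ r n) := by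
  refine ⟨(measurable_expAverage t).aestronglyMeasurable, ?_⟩
  rw [hasFiniteIntegral_iff_ofReal (Filter.Eventually.of_forall fun z => z.1.expAverage_nonneg t _),
    Measure.lintegral_compProd (measurable_expAverage t).ennreal_ofReal]
  refine lt_of_le_of_lt (lintegral_mono fun x => lintegral_expAverage_walkKernel_le hφ r n x ht) ?_
  simpa using hφ.expMoment_pow_lt_top ht n

lemma ae_compProd_isProper_hasExpMoments (hφ : HasLinearGrowth φ) (r n : ℕ)
    {P : Measure OverlapStructure} [IsProbabilityMeasure P] (hP : ∀ᵐ x ∂P, x.IsProper) :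
    ∀ᵐ z ∂(P ⊗ₘ walkKernel φ r n), z.1.IsProper ∧ z.1.HasExpMoments z.2 := by
  have hm : MeasurableSet {z : OverlapStructure × (ℕ → E) |
      z.1.IsProper ∧ z.1.HasExpMoments z.2} := by
    refine (measurable_fst measurableSet_isProper).inter ?_
    have : {z : OverlapStructure × (ℕ → E) | z.1.HasExpMoments z.2} =
        ⋂ t : ℕ, {z | (∑' j, ENNReal.ofReal (z.1.weight j * Real.exp (t * ‖z.2 j‖))) < ⊤} := by
      ext z
      simp only [hasExpMoments_iff, Set.mem_ofPred_eq, Set.mem_iInter]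
      refine forall_congr' fun t => ⟨fun h => ?_, fun h => ?_⟩
      · exact h.tsum_ofReal_lt_top
      · exact (ENNReal.summable_toReal h.ne).congr fun j =>
          ENNReal.toReal_ofReal (z.1.weight_mul_exp_nonneg j _)
    change MeasurableSet {z : OverlapStructure × (ℕ → E) | z.1.HasExpMoments z.2}
    rw [this]
    refine MeasurableSet.iInter fun t => measurableSet_lt (Measurable.tsum fun j => ?_)
      measurable_const
    exact (((measurable_weight j).comp measurable_fst).mul (by fun_prop)).ennreal_ofReal
  refine Measure.ae_compProd_of_ae_ae hm ?_
  filter_upwards [hP] with x hx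
  filter_upwards [ae_hasExpMoments_walkKernel hφ r n x] with p hp
  exact ⟨hx, hp⟩

lemma integral_walkKernel_succ {f : (ℕ → E) → ℝ} (r n : ℕ) {x : OverlapStructure}
    (hf : Integrable f (walkKernel φ r (n + 1) x)) :
    ∫ a, f a ∂walkKernel φ r (n + 1) x =
      ∫ a, ∫ b, f (a + b) ∂walkKernel φ r n x ∂incrementKernel φ r x := by
  rw [walkKernel_succ_apply] at hf ⊢
  have hm : AEMeasurable (fun p : (ℕ → E) × (ℕ → E) => p.1 + p.2)
    ((incrementKernel φ r x).prod (walkKernel φ r n x)) := by fun_prop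
  rw [integral_map hm hf.1, integral_prod (fun p => f (p.1 + p.2)) ((integrable_map_measure hf.1 hm).1 hf)]

end ExpAverageIntegrable

/-! ### Moments of the logarithm of the normalization. -/

section FreeEnergy

variable {P : Measure OverlapStructure} [IsProbabilityMeasure P] {φ : ℝ → ℝ} {r : ℕ}

lemma measurable_log_partition :
    Measurable fun z : OverlapStructure × (ℕ → ℝ) => Real.log (z.1.partition z.2) :=
  measurable_partition.log

lemma measurable_log_partition_left (x : OverlapStructure) :
    Measurable fun a => Real.log (x.partition a) :=
  measurable_log_partition.comp measurable_prodMk_left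

lemma OverlapStructure.HasExpMoments.abs_log_partition_sub_le {x : OverlapStructure} {a : ℕ → ℝ}
    (h : x.HasExpMoments a) (hx : x.IsProper) (d : ℝ) :
    |Real.log (x.partition a) - d| ≤ x.expAverage 1 a + |d| :=
  (abs_sub _ _).trans (add_le_add_left (h.abs_log_partition_le hx (t := 1) (by simp)) _)

lemma OverlapStructure.HasExpMoments.log_partition_sub_sq_le {x : OverlapStructure} {a : ℕ → ℝ}
    (h : x.HasExpMoments a) (hx : x.IsProper) (d : ℝ) :
    (Real.log (x.partition a) - d) ^ 2 ≤ 2 * x.expAverage 2 a + 2 * d ^ 2 := by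
  have h1 := h.abs_log_partition_sub_le hx d
  have h2 := h.expAverage_pow_le hx (t := 1) zero_le_one 2
  have h3 := x.expAverage_nonneg 1 a
  have h4 : |Real.log (x.partition a) - d| ^ 2 ≤ (x.expAverage 1 a + |d|) ^ 2 := by gcongr
  rw [sq_abs] at h4
  norm_num at h2
  nlinarith [sq_abs d, sq_nonneg (x.expAverage 1 a - |d|)]

lemma integrable_log_partition_sub (hφ : HasLinearGrowth φ) (r n : ℕ) {x : OverlapStructure}
    (hx : x.IsProper) (d : ℝ) :
    Integrable (fun a => Real.log (x.partition a) - d) (walkKernel φ r n x) := by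
  refine ((integrable_expAverage_walkKernel hφ r n x zero_le_one).add
    (integrable_const |d|)).mono' ((measurable_log_partition_left x).sub_const d).aestronglyMeasurable ?_
  filter_upwards [ae_hasExpMoments_walkKernel hφ r n x] with a ha
  exact ha.abs_log_partition_sub_le hx d

lemma integrable_log_partition_sub_sq (hφ : HasLinearGrowth φ) (r n : ℕ) {x : OverlapStructure}
    (hx : x.IsProper) (d : ℝ) :
    Integrable (fun a => (Real.log (x.partition a) - d) ^ 2) (walkKernel φ r n x) := by
  refine (((integrable_expAverage_walkKernel hφ r n x zero_le_two).const_mul 2).add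
    (integrable_const (2 * d ^ 2))).mono'
    (((measurable_log_partition_left x).sub_const d).pow_const 2).aestronglyMeasurable ?_
  filter_upwards [ae_hasExpMoments_walkKernel hφ r n x] with a ha
  rw [Real.norm_of_nonneg (sq_nonneg _)]
  exact ha.log_partition_sub_sq_le hx d

lemma memLp_log_partition_sub (hφ : HasLinearGrowth φ) (hP : ∀ᵐ x ∂P, x.IsProper) (r n : ℕ)
    (d : ℝ) : MemLp (fun z : OverlapStructure × (ℕ → ℝ) => Real.log (z.1.partition z.2) - d) 2
      (P ⊗ₘ walkKernel φ r n) := by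
  rw [memLp_two_iff_integrable_sq (measurable_log_partition.sub_const d).aestronglyMeasurable]
  refine (((integrable_expAverage_compProd hφ r n P zero_le_two).const_mul 2).add
    (integrable_const (2 * d ^ 2))).mono'
    ((measurable_log_partition.sub_const d).pow_const 2).aestronglyMeasurable ?_
  filter_upwards [ae_compProd_isProper_hasExpMoments hφ r n hP] with z hz
  rw [Real.norm_of_nonneg (sq_nonneg _)]
  exact hz.2.log_partition_sub_sq_le hz.1 d

/-- The conditional mean of the centered logarithm of the normalization after `n` steps. -/
noncomputable def meanLog (φ : ℝ → ℝ) (r n : ℕ) (d : ℝ) (x : OverlapStructure) : ℝ :=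
  ∫ a, (Real.log (x.partition a) - d) ∂walkKernel φ r n x

/-- The conditional second moment of the centered logarithm of the normalization after `n` steps. -/
noncomputable def meanSqLog (φ : ℝ → ℝ) (r n : ℕ) (d : ℝ) (x : OverlapStructure) : ℝ :=
  ∫ a, (Real.log (x.partition a) - d) ^ 2 ∂walkKernel φ r n x

lemma measurable_meanLog (φ : ℝ → ℝ) (r n : ℕ) (d : ℝ) : Measurable (meanLog φ r n d) :=
  (measurable_log_partition.sub_const d).stronglyMeasurable.integral_kernel_prod_right'.measurable

lemma measurable_meanSqLog (φ : ℝ → ℝ) (r n : ℕ) (d : ℝ) : Measurable (meanSqLog φ r n d) :=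
  ((measurable_log_partition.sub_const d).pow_const
    2).stronglyMeasurable.integral_kernel_prod_right'.measurable

lemma abs_meanLog_le (hφ : HasLinearGrowth φ) (r n : ℕ) (d : ℝ) {x : OverlapStructure}
    (hx : x.IsProper) : |meanLog φ r n d x| ≤ (expMoment φ 1 ^ n).toReal + |d| := by
  have := isMarkovKernel_walkKernel hφ.measurable r n
  calc _ ≤ ∫ a, |Real.log (x.partition a) - d| ∂walkKernel φ r n x := abs_integral_le_integral_abs
    _ ≤ ∫ a, (x.expAverage 1 a + |d|) ∂walkKernel φ r n x := by
        refine integral_mono_ae (integrable_log_partition_sub hφ r n hx d).abs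
          ((integrable_expAverage_walkKernel hφ r n x zero_le_one).add (integrable_const _)) ?_
        filter_upwards [ae_hasExpMoments_walkKernel hφ r n x] with a ha
        exact ha.abs_log_partition_sub_le hx d
    _ ≤ _ := by
        rw [integral_add (integrable_expAverage_walkKernel hφ r n x zero_le_one)
          (integrable_const _)]
        have := integral_expAverage_walkKernel_le hφ r n x zero_le_one
        simpa using this

lemma memLp_meanLog (hφ : HasLinearGrowth φ) (hP : ∀ᵐ x ∂P, x.IsProper) (r n : ℕ) (d : ℝ) :
    MemLp (meanLog φ r n d) 2 P := by
  refine MemLp.of_bound (measurable_meanLog φ r n d).aestronglyMeasurable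
    ((expMoment φ 1 ^ n).toReal + |d|) ?_
  filter_upwards [hP] with x hx
  exact abs_meanLog_le hφ r n d hx

lemma integrable_meanSqLog (hφ : HasLinearGrowth φ) (hP : ∀ᵐ x ∂P, x.IsProper) (r n : ℕ) (d : ℝ) :
    Integrable (meanSqLog φ r n d) P := by
  have := (memLp_two_iff_integrable_sq
    (measurable_log_partition.sub_const d).aestronglyMeasurable).1
    (memLp_log_partition_sub hφ hP r n d)
  refine ((Measure.integrable_compProd_iff this.1).1 this).2.congr
    (Filter.Eventually.of_forall fun x => ?_)
  simp only [meanSqLog, Real.norm_of_nonneg (sq_nonneg _)]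

/-- After a first step `a`, the logarithm of the normalization splits. -/
lemma integral_log_partition_add (hφ : HasLinearGrowth φ) (r n : ℕ) {x : OverlapStructure}
    {a : ℕ → ℝ} (ha : 0 < x.partition a) {g : ℝ → ℝ} (hg : Measurable g) :
    ∫ b, g (Real.log (x.partition (a + b))) ∂walkKernel φ r n x =
      ∫ b, g (Real.log (x.partition a) + Real.log ((x.evolve a).partition b))
        ∂walkKernel φ r n (x.evolve a) := by
  obtain ⟨σ, hσ, hσ'⟩ := x.exists_perm_evolve a
  have hy : (x.evolve a).IsProper := isProper_evolve ha.ne'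
  have hb : ∀ᵐ b ∂walkKernel φ r n (x.evolve a), 0 < (x.evolve a).partition b := by
    filter_upwards [ae_hasExpMoments_walkKernel hφ r n (x.evolve a)] with b hb
    exact hy.partition_pos (hb.summable_exp (t := 1) fun j => by
      rw [one_mul]; exact le_abs_self _)
  have h1 : ∫ b, g (Real.log (x.partition a) + Real.log ((x.evolve a).partition b))
        ∂walkKernel φ r n (x.evolve a) =
      ∫ b, g (Real.log (x.partition a * (x.evolve a).partition b))
        ∂walkKernel φ r n (x.evolve a) := by
    refine integral_congr_ae ?_
    filter_upwards [hb] with b hb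
    rw [Real.log_mul ha.ne' hb.ne']
  have hm : Measurable fun b => g (Real.log (x.partition a * (x.evolve a).partition b)) :=
    hg.comp (((measurable_partition.comp measurable_prodMk_left).const_mul _).log)
  rw [h1, walkKernel_relabel hφ.measurable r n hσ', integral_map
    (Measurable.aemeasurable (by fun_prop)) hm.aestronglyMeasurable]
  refine integral_congr_ae (Filter.Eventually.of_forall fun b => ?_)
  simp only
  rw [partition_evolve hσ, mul_div_cancel₀ _ ha.ne']

end FreeEnergy

/-! ### The law of large numbers for the free energy. -/

section LawOfLargeNumbers

open Filter Topology

variable {P : Measure OverlapStructure} [IsProbabilityMeasure P] {φ : ℝ → ℝ} {r : ℕ}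

lemma ae_incrementKernel_partition_pos (hφ : HasLinearGrowth φ) (r : ℕ) {x : OverlapStructure}
    (hx : x.IsProper) : ∀ᵐ a ∂incrementKernel φ r x, 0 < x.partition a := by
  rw [← walkKernel_one]
  filter_upwards [ae_hasExpMoments_walkKernel hφ r 1 x] with a ha
  exact hx.partition_pos (ha.summable_exp (t := 1) fun j => by rw [one_mul]; exact le_abs_self _)

/-- The logarithm of the normalization is additive along the steps. With the centering split as `d +
e`, this is the recursion `U (n + 1) = g + T (U n)` of the mean ergodic theorem. -/
lemma meanLog_succ (hφ : HasLinearGrowth φ) (r n : ℕ) (d e : ℝ) {x : OverlapStructure}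
    (hx : x.IsProper) : meanLog φ r (n + 1) (d + e) x =
      meanLog φ r 1 d x + ∫ a, meanLog φ r n e (x.evolve a) ∂incrementKernel φ r x := by
  have hint : Integrable (fun a => meanLog φ r n e (x.evolve a)) (incrementKernel φ r x) := by
    refine Integrable.of_bound ((measurable_meanLog φ r n e).comp
      (measurable_evolve_left x)).aestronglyMeasurable ((expMoment φ 1 ^ n).toReal + |e|) ?_
    filter_upwards [ae_incrementKernel_partition_pos hφ r hx] with a ha
    exact abs_meanLog_le hφ r n e (isProper_evolve ha.ne')
  have hint1 := integrable_log_partition_sub hφ r 1 hx d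
  rw [walkKernel_one] at hint1
  rw [meanLog, integral_walkKernel_succ r n (integrable_log_partition_sub hφ r (n + 1) hx _),
    meanLog, walkKernel_one, ← integral_add hint1 hint]
  refine integral_congr_ae ?_
  filter_upwards [ae_incrementKernel_partition_pos hφ r hx] with a ha
  have hy : (x.evolve a).IsProper := isProper_evolve ha.ne'
  have := isMarkovKernel_walkKernel hφ.measurable r n
  rw [integral_log_partition_add hφ r n ha (g := fun u => u - (d + e)) (by fun_prop), meanLog]
  have e1 : ∀ b, Real.log (x.partition a) + Real.log ((x.evolve a).partition b) - (d + e) =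
      (Real.log (x.partition a) - d) + (Real.log ((x.evolve a).partition b) - e) :=
    fun b => by ring
  simp only [e1]
  rw [integral_add (integrable_const _) (integrable_log_partition_sub hφ r n hy e)]
  simp

/-- The square of the sum is expanded. Given the first step, the later steps enter the cross term
only through their conditional mean, and invariance removes the first step from the last term. -/
lemma integral_meanSqLog_succ (hφ : HasLinearGrowth φ) (h : IsQuasiStationary P φ r)
    (hP : ∀ᵐ x ∂P, x.IsProper) (n : ℕ) (d e : ℝ) :
    ∫ x, meanSqLog φ r (n + 1) (d + e) x ∂P =
      ∫ z, (Real.log (z.1.partition z.2) - d) ^ 2 ∂(P ⊗ₘ incrementKernel φ r) +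
      2 * ∫ z, (Real.log (z.1.partition z.2) - d) * meanLog φ r n e (z.1.evolve z.2)
        ∂(P ⊗ₘ incrementKernel φ r) + ∫ x, meanSqLog φ r n e x ∂P := by
  have hp := measurePreserving_evolve hφ.measurable h
  have hL := memLp_log_partition_sub hφ hP r 1 d
  rw [walkKernel_one] at hL
  have hU := (memLp_meanLog hφ hP r n e).comp_measurePreserving hp
  have i1 := hL.integrable_sq
  have i2 : Integrable (fun z : OverlapStructure × (ℕ → ℝ) =>
      (Real.log (z.1.partition z.2) - d) * meanLog φ r n e (z.1.evolve z.2))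
      (P ⊗ₘ incrementKernel φ r) := hL.integrable_mul hU
  have i3 : Integrable (fun z : OverlapStructure × (ℕ → ℝ) => meanSqLog φ r n e (z.1.evolve z.2))
      (P ⊗ₘ incrementKernel φ r) :=
    hp.integrable_comp_of_integrable (integrable_meanSqLog hφ hP r n e)
  have e3 : ∫ x, meanSqLog φ r n e x ∂P =
      ∫ z, meanSqLog φ r n e (z.1.evolve z.2) ∂(P ⊗ₘ incrementKernel φ r) := by
    conv_lhs => rw [← hp.map_eq]
    exact integral_map hp.aemeasurable (measurable_meanSqLog φ r n e).aestronglyMeasurable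
  have i12 := i1.add (i2.const_mul 2)
  rw [e3, ← integral_const_mul, ← integral_add i1 (i2.const_mul 2)]
  have := integral_add i12 i3
  simp only [Pi.add_apply] at this
  rw [← this]
  refine Eq.trans ?_ (Measure.integral_compProd (i12.add i3)).symm
  refine integral_congr_ae ?_
  filter_upwards [hP] with x hx
  rw [meanSqLog, integral_walkKernel_succ r n (integrable_log_partition_sub_sq hφ r (n + 1) hx _)]
  refine integral_congr_ae ?_
  filter_upwards [ae_incrementKernel_partition_pos hφ r hx] with a ha
  have hy : (x.evolve a).IsProper := isProper_evolve ha.ne'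
  have := isMarkovKernel_walkKernel hφ.measurable r n
  rw [integral_log_partition_add hφ r n ha (g := fun u => (u - (d + e)) ^ 2) (by fun_prop)]
  have e1 : ∀ b, (Real.log (x.partition a) + Real.log ((x.evolve a).partition b) - (d + e)) ^ 2 =
      (Real.log (x.partition a) - d) ^ 2 + (2 * (Real.log (x.partition a) - d)) *
        (Real.log ((x.evolve a).partition b) - e) +
        (Real.log ((x.evolve a).partition b) - e) ^ 2 :=
    fun b => by ring
  simp only [e1]
  rw [integral_add (f := fun b => (Real.log (x.partition a) - d) ^ 2 +
    (2 * (Real.log (x.partition a) - d)) * (Real.log ((x.evolve a).partition b) - e))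
    ((integrable_const _).add ((integrable_log_partition_sub hφ r n hy e).const_mul _))
    (integrable_log_partition_sub_sq hφ r n hy e),
    integral_add (integrable_const _) ((integrable_log_partition_sub hφ r n hy e).const_mul _),
    integral_const_mul]
  simp [meanLog, meanSqLog, mul_assoc]

/-- The expected logarithm of the normalization of one step. -/
noncomputable def freeEnergy (P : Measure OverlapStructure) (φ : ℝ → ℝ) (r : ℕ) : ℝ :=
  ∫ z, Real.log (z.1.partition z.2) ∂(P ⊗ₘ incrementKernel φ r)

/-- Centering by the free energy makes the one-step mean orthogonal to constants, which by
ergodicity are the only fixed vectors of the transition operator. -/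
lemma tendsto_norm_meanLog_div (hφ : HasLinearGrowth φ) (h : IsQuasiStationary P φ r)
    (hP : ∀ᵐ x ∂P, x.IsProper) (he : IsErgodicEvolution P φ r) :
    Tendsto (fun n : ℕ => ‖(memLp_meanLog hφ hP r n (n * freeEnergy P φ r)).toLp‖ / n)
      atTop (𝓝 0) := by
  have := isMarkovKernel_incrementKernel hφ.measurable r
  have hp := measurePreserving_evolve hφ.measurable h
  have hp1 := measurePreserving_fst_compProd (P := P) (r := r) hφ.measurable
  set Λ := freeEnergy P φ r with hΛ
  set U : ℕ → Lp ℝ 2 P := fun n => (memLp_meanLog hφ hP r n (n * Λ)).toLp with hU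
  have hUc : ∀ n, U n =ᵐ[P] meanLog φ r n (n * Λ) := fun n => MemLp.coeFn_toLp _
  have hU0 : U 0 = 0 := by
    rw [Lp.eq_zero_iff_ae_eq_zero]
    filter_upwards [hUc 0, hP] with x hx hxp
    rw [hx, meanLog, walkKernel, Kernel.const_apply, integral_dirac']
    · have : x.partition 0 = 1 := by
        simp only [partition, Pi.zero_apply, Real.exp_zero, mul_one]
        exact hxp
      simp [this]
    · exact ((measurable_log_partition_left x).sub_const _).stronglyMeasurable
  refine tendsto_norm_div_of_contraction (norm_transitionOperator_le hφ.measurable h)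
    (g := U 1) (fun f hf => ?_) hU0 fun n => ?_
  · obtain ⟨c, hc⟩ := ae_const_of_transitionOperator hφ.measurable h he hf
    have hL := (memLp_log_partition_sub hφ hP r 1 0).integrable one_le_two
    rw [walkKernel_one] at hL
    simp only [sub_zero] at hL
    have h0 : ∫ x, meanLog φ r 1 Λ x ∂P = 0 := by
      simp only [meanLog, walkKernel_one]
      rw [← Measure.integral_compProd (f := fun z : OverlapStructure × (ℕ → ℝ) =>
          Real.log (z.1.partition z.2) - Λ) (hL.sub (integrable_const _)),
        integral_sub hL (integrable_const _)]
      simp [hΛ, freeEnergy]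
    rw [L2.inner_def]
    have e1 : ∀ᵐ x ∂P, inner ℝ (f x) (U 1 x) = c * meanLog φ r 1 Λ x := by
      filter_upwards [hc, hUc 1] with x h1 h2
      rw [h1, h2]
      simp [mul_comm]
    rw [integral_congr_ae e1, integral_const_mul, h0, mul_zero]
  · refine ext_inner_right ℝ fun f => ?_
    rw [inner_add_left, inner_transitionOperator, L2.inner_def, L2.inner_def, L2.inner_def]
    have c1 := Lp.coeFn_compMeasurePreserving f hp1
    have c2 := Lp.coeFn_compMeasurePreserving (U n) hp
    have c3 := hp.quasiMeasurePreserving.ae (hUc n)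
    have hfU : Integrable (fun z : OverlapStructure × (ℕ → ℝ) =>
        f z.1 * meanLog φ r n (n * Λ) (z.1.evolve z.2)) (P ⊗ₘ incrementKernel φ r) :=
      ((Lp.memLp f).comp_measurePreserving hp1).integrable_mul
        ((memLp_meanLog hφ hP r n (n * Λ)).comp_measurePreserving hp)
    have e2 : ∫ z, inner ℝ (Lp.compMeasurePreservingₗᵢ ℝ _ hp (U n) z)
        (Lp.compMeasurePreservingₗᵢ ℝ Prod.fst hp1 f z) ∂(P ⊗ₘ incrementKernel φ r) =
        ∫ x, f x * ∫ a, meanLog φ r n (n * Λ) (x.evolve a) ∂incrementKernel φ r x ∂P := by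
      have : ∀ᵐ z ∂(P ⊗ₘ incrementKernel φ r), inner ℝ (Lp.compMeasurePreservingₗᵢ ℝ _ hp (U n) z)
        (Lp.compMeasurePreservingₗᵢ ℝ Prod.fst hp1 f z) =
          f z.1 * meanLog φ r n (n * Λ) (z.1.evolve z.2) := by
        filter_upwards [c1, c2, c3] with z h1 h2 h3
        change inner ℝ (Lp.compMeasurePreserving _ hp (U n) z)
          (Lp.compMeasurePreserving Prod.fst hp1 f z) = _
        rw [h1, h2, Function.comp_apply, Function.comp_apply, h3]
        simp
      rw [integral_congr_ae this, Measure.integral_compProd hfU]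
      simp only [integral_const_mul]
    rw [e2]
    have hfU2 : Integrable (fun x =>
        f x * ∫ a, meanLog φ r n (n * Λ) (x.evolve a) ∂incrementKernel φ r x) P := by
      exact Integrable.congr (f := fun x =>
        ∫ a, f x * meanLog φ r n (n * Λ) (x.evolve a) ∂incrementKernel φ r x) hfU.integral_compProd
        (Eventually.of_forall fun x => integral_const_mul _ _)
    have hfU1 : Integrable (fun x => f x * meanLog φ r 1 Λ x) P :=
      (Lp.memLp f).integrable_mul (memLp_meanLog hφ hP r 1 Λ)
    have e3 : ∫ x, inner ℝ (U 1 x) (f x) ∂P = ∫ x, f x * meanLog φ r 1 Λ x ∂P := by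
      refine integral_congr_ae ?_
      filter_upwards [hUc 1] with x h1
      rw [h1]
      simp
    rw [e3, ← integral_add hfU1 hfU2]
    refine integral_congr_ae ?_
    filter_upwards [hUc (n + 1), hP] with x h1 hx
    rw [h1]
    have : ((n + 1 : ℕ) : ℝ) * Λ = Λ + n * Λ := by push_cast; ring
    rw [this, meanLog_succ hφ r n Λ (n * Λ) hx]
    simp only [RCLike.inner_apply, conj_trivial]
    ring

/-- The law of large numbers for the logarithm of the normalization. -/
theorem tendsto_integral_meanSqLog (hφ : HasLinearGrowth φ) (h : IsQuasiStationary P φ r)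
    (hP : ∀ᵐ x ∂P, x.IsProper) (he : IsErgodicEvolution P φ r) :
    Tendsto (fun n : ℕ => (∫ x, meanSqLog φ r n (n * freeEnergy P φ r) x ∂P) / (n : ℝ) ^ 2)
      atTop (𝓝 0) := by
  have hp := measurePreserving_evolve hφ.measurable h
  set Λ := freeEnergy P φ r with hΛ
  set V : ℕ → ℝ := fun n => ∫ x, meanSqLog φ r n (n * Λ) x ∂P with hV
  set u : ℕ → ℝ := fun n => ‖(memLp_meanLog hφ hP r n (n * Λ)).toLp‖ with hu
  have hu0 : Tendsto (fun n : ℕ => u n / n) atTop (𝓝 0) := tendsto_norm_meanLog_div hφ h hP he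
  have hL := memLp_log_partition_sub hφ hP r 1 Λ
  rw [walkKernel_one] at hL
  set A := ∫ z, (Real.log (z.1.partition z.2) - Λ) ^ 2 ∂(P ⊗ₘ incrementKernel φ r) with hA
  set B := ‖hL.toLp‖ with hB
  have hV0 : ∀ n, 0 ≤ V n := fun n => integral_nonneg fun x => integral_nonneg fun a => sq_nonneg _
  -- The cross term is bounded by Cauchy–Schwarz; composition with one step does not change the norm
  -- `u n`.
  have hrec : ∀ n, V (n + 1) ≤ V n + (A + 2 * (B * u n)) := by
    intro n
    have : ((n + 1 : ℕ) : ℝ) * Λ = Λ + n * Λ := by push_cast; ring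
    simp only [hV, this]
    rw [integral_meanSqLog_succ hφ h hP n Λ (n * Λ)]
    have hU := (memLp_meanLog hφ hP r n (n * Λ)).comp_measurePreserving hp
    set ℓ : Lp ℝ 2 (P ⊗ₘ incrementKernel φ r) := hL.toLp with hℓ
    set v : Lp ℝ 2 (P ⊗ₘ incrementKernel φ r) := hU.toLp with hv
    have hin := real_inner_le_norm ℓ v
    have hn : ‖v‖ = u n := by
      have := Lp.norm_compMeasurePreserving (memLp_meanLog hφ hP r n (n * Λ)).toLp hp
      rwa [Lp.toLp_compMeasurePreserving] at this
    rw [hn, L2.inner_def] at hin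
    have e1 : ∀ᵐ z ∂(P ⊗ₘ incrementKernel φ r), inner ℝ (ℓ z) (v z) =
        (Real.log (z.1.partition z.2) - Λ) * meanLog φ r n (n * Λ) (z.1.evolve z.2) := by
      filter_upwards [hL.coeFn_toLp, hU.coeFn_toLp] with z h1 h2
      rw [h1, h2]
      simp [mul_comm]
    rw [integral_congr_ae e1] at hin
    linarith
  have hVs : ∀ n, V n ≤ ∑ k ∈ Finset.range n, (A + 2 * (B * u k)) := by
    intro n
    induction n with
    | zero =>
      have h1 : ∀ᵐ x ∂P, meanSqLog φ r 0 ((0 : ℕ) * Λ) x = 0 := by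
        filter_upwards [hP] with x hx
        rw [meanSqLog, walkKernel, Kernel.const_apply, integral_dirac']
        · have : x.partition 0 = 1 := by
            simp only [partition, Pi.zero_apply, Real.exp_zero, mul_one]
            exact hx
          simp [this]
        · exact (((measurable_log_partition_left x).sub_const _).pow_const 2).stronglyMeasurable
      simp only [hV, Finset.range_zero, Finset.sum_empty]
      rw [integral_congr_ae h1]
      simp
    | succ n ih =>
      rw [Finset.sum_range_succ]
      linarith [hrec n]
  -- Since `u k = o(k)`, the increments of `V` are bounded by a sequence that is `o(k)`, and their
  -- sums are `o(n²)`.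
  have hlin : (fun k : ℕ => A + 2 * (B * u k)) =o[atTop] fun k : ℕ => (k : ℝ) := by
    rw [Asymptotics.isLittleO_iff_tendsto' (by
      filter_upwards [eventually_ne_atTop 0] with k hk h0
      exact absurd h0 (by exact_mod_cast hk))]
    have h1 : Tendsto (fun k : ℕ => A / (k : ℝ)) atTop (𝓝 0) := tendsto_const_div_atTop_nhds_zero_nat A
    have h2 := h1.add (hu0.const_mul (2 * B))
    rw [mul_zero, add_zero] at h2
    exact h2.congr fun k => by ring
  have hsum := hlin.sum_range (fun k => Nat.cast_nonneg k) (by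
    have : Tendsto (fun n : ℕ => ((n - 1 : ℕ) : ℝ)) atTop atTop :=
      tendsto_natCast_atTop_atTop.comp (tendsto_sub_atTop_nat 1)
    refine tendsto_atTop_mono' _ ?_ this
    filter_upwards [eventually_ge_atTop 1] with n hn
    exact Finset.single_le_sum (f := fun i : ℕ => (i : ℝ)) (fun i _ => Nat.cast_nonneg i)
      (Finset.mem_range.2 (by omega : n - 1 < n)))
  have hO : (fun n => ∑ k ∈ Finset.range n, (k : ℝ)) =O[atTop] fun n : ℕ => (n : ℝ) ^ 2 := by
    refine Asymptotics.IsBigO.of_bound 1 (Eventually.of_forall fun n => ?_)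
    rw [Real.norm_of_nonneg (Finset.sum_nonneg fun k _ => Nat.cast_nonneg k), one_mul,
      Real.norm_of_nonneg (by positivity)]
    refine (Finset.sum_le_card_nsmul _ _ (n : ℝ) fun k hk => ?_).trans_eq ?_
    · exact_mod_cast (Finset.mem_range.1 hk).le
    · simp [sq]
  have hfin := (hsum.trans_isBigO hO).tendsto_div_nhds_zero
  refine squeeze_zero (fun n => div_nonneg (hV0 n) (by positivity)) (fun n => ?_) hfin
  exact div_le_div_of_nonneg_right (hVs n) (by positivity)

end LawOfLargeNumbers

/-! ### Bounds for tilted averages. -/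

section GibbsBounds

variable {m : ℕ} {F : (Fin (m + 1) → Fin (m + 1) → ℝ) → ℝ}

lemma measurable_overlapsAt {s : ℕ} (i : Fin s → ℕ) :
    Measurable fun x : OverlapStructure => x.overlapsAt i :=
  measurable_pi_lambda _ fun _ => measurable_pi_lambda _ fun _ => measurable_overlap _ _

lemma measurable_replicaSum {Ω : Type*} [MeasurableSpace Ω] (hF : Measurable F)
    {X : Ω → OverlapStructure} {W c : Ω → ℕ → ℝ} (hX : Measurable X) (hW : Measurable W)
    (hc : Measurable c) : Measurable fun ω => (X ω).replicaSum (W ω) F (c ω) := by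
  unfold replicaSum
  refine Measurable.tsum fun i => ?_
  refine Measurable.mul ?_ (Measurable.mul ?_ ?_)
  · exact Finset.measurable_prod _ fun l _ => (measurable_pi_apply _).comp hW
  · exact hF.comp ((measurable_overlapsAt i).comp hX)
  · exact (measurable_pi_apply _).comp hc

lemma measurable_reweight_comp {Ω : Type*} [MeasurableSpace Ω] {X : Ω → OverlapStructure}
    {a : Ω → ℕ → ℝ} (hX : Measurable X) (ha : Measurable a) :
    Measurable fun ω => (X ω).reweight (a ω) :=
  measurable_reweight.comp (hX.prodMk ha)

variable {E : Type*} [NormedAddCommGroup E]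

namespace OverlapStructure

lemma HasExpMoments.reweight_mul_le {x : OverlapStructure} {p : ℕ → E} (h : x.HasExpMoments p)
    (hx : x.IsProper) {a c : ℕ → ℝ} {C : ℝ} (ha : ∀ j, |a j| ≤ ‖p j‖)
    (hc : ∀ j, |c j| ≤ C * Real.exp ‖p j‖) (j : ℕ) :
    x.reweight a j * |c j| ≤ C * x.expAverage 1 p * (x.weight j * Real.exp (2 * ‖p j‖)) := by
  have h1 := h.inv_partition_le hx (t := 1) (a := a) (by simpa using ha)
  have h2 : Real.exp (a j) ≤ Real.exp ‖p j‖ := Real.exp_le_exp.2 ((le_abs_self _).trans (ha j))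
  have hw := x.weight_nonneg j
  have hV := x.expAverage_nonneg 1 p
  have hC : 0 ≤ C * Real.exp ‖p j‖ := (abs_nonneg _).trans (hc j)
  have hC' : 0 ≤ C := nonneg_of_mul_nonneg_left hC (Real.exp_pos _)
  have hp0 : 0 ≤ (x.partition a)⁻¹ := inv_nonneg.2 (tsum_nonneg fun j => x.weight_mul_exp_nonneg j _)
  calc x.reweight a j * |c j| = x.weight j * Real.exp (a j) * (x.partition a)⁻¹ * |c j| := by
        rw [reweight_eq]; ring
    _ ≤ x.weight j * Real.exp ‖p j‖ * x.expAverage 1 p * (C * Real.exp ‖p j‖) := by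
        gcongr
        exact hc j
    _ = _ := by rw [two_mul, Real.exp_add]; ring

lemma HasExpMoments.summable_reweight_mul {x : OverlapStructure} {p : ℕ → E}
    (h : x.HasExpMoments p) (hx : x.IsProper) {a c : ℕ → ℝ} {C : ℝ} (ha : ∀ j, |a j| ≤ ‖p j‖)
    (hc : ∀ j, |c j| ≤ C * Real.exp ‖p j‖) : Summable fun j => x.reweight a j * |c j| :=
  ((h 2).mul_left (C * x.expAverage 1 p)).of_nonneg_of_le
    (fun j => mul_nonneg (x.reweight_nonneg a j) (abs_nonneg _)) (h.reweight_mul_le hx ha hc)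

lemma HasExpMoments.partition_ne {x : OverlapStructure} {p : ℕ → E}
    (h : x.HasExpMoments p) (hx : x.IsProper) {a : ℕ → ℝ} (ha : ∀ j, |a j| ≤ ‖p j‖) :
    x.partition a ≠ 0 :=
  (hx.partition_pos (h.summable_exp (t := 1) fun j => by
    rw [one_mul]; exact (le_abs_self _).trans (ha j))).ne'

lemma HasExpMoments.abs_replicaSum_le {x : OverlapStructure} {p : ℕ → E}
    (h : x.HasExpMoments p) (hx : x.IsProper) {a c : ℕ → ℝ} {C B : ℝ} (hF : ∀ q, |F q| ≤ B)
    (ha : ∀ j, |a j| ≤ ‖p j‖) (hc : ∀ j, |c j| ≤ C * Real.exp ‖p j‖) :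
    |x.replicaSum (x.reweight a) F c| ≤ B * C * x.expAverage 4 p := by
  have hC : 0 ≤ C := nonneg_of_mul_nonneg_left ((abs_nonneg _).trans (hc 0)) (Real.exp_pos _)
  have hB : 0 ≤ B := (abs_nonneg _).trans (hF 0)
  have h1 := OverlapStructure.abs_replicaSum_le x hF (x.reweight_nonneg a) (x.summable_reweight a)
    (tsum_reweight (h.partition_ne hx ha)) (h.summable_reweight_mul hx ha hc)
  have h2 := (h.summable_reweight_mul hx ha hc).tsum_le_tsum (h.reweight_mul_le hx ha hc)
    ((h 2).mul_left (C * x.expAverage 1 p))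
  rw [tsum_mul_left] at h2
  have h3 := h.expAverage_mono (t := 1) (u := 2) one_le_two
  -- The tilt and `c` contribute one exponential each, and the inverse normalization one more
  -- average; the product of two averages at exponent `2` is absorbed at exponent `4`.
  have h4 := h.expAverage_pow_le hx (t := 2) zero_le_two 2
  norm_num at h4
  have h5 := x.expAverage_nonneg 2 p
  refine h1.trans ?_
  rw [mul_assoc]
  refine mul_le_mul_of_nonneg_left (h2.trans ?_) hB
  rw [mul_assoc]
  refine mul_le_mul_of_nonneg_left ?_ hC
  calc _ ≤ x.expAverage 2 p * x.expAverage 2 p := mul_le_mul_of_nonneg_right h3 h5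
    _ ≤ _ := by rw [← sq]; exact h4

lemma reweight_relabel {x y : OverlapStructure} {σ : Equiv.Perm ℕ}
    (h : ∀ i, y.weight i = x.weight (σ i)) (a : ℕ → ℝ) :
    y.reweight (fun i => a (σ i)) = fun i => x.reweight a (σ i) := by
  ext i
  have : y.partition (fun i => a (σ i)) = x.partition a := by
    rw [partition, partition, ← σ.tsum_eq fun j => x.weight j * Real.exp (a j)]
    simp [h]
  rw [reweight_eq, reweight_eq, this, h]

end OverlapStructure

end GibbsBounds

/-! ### Two walks driven by the same Gaussian field. -/

section PairWalk

variable {m : ℕ} {F : (Fin (m + 1) → Fin (m + 1) → ℝ) → ℝ}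
  {P : Measure OverlapStructure} [IsProbabilityMeasure P] {φ : ℝ → ℝ × ℝ} {r : ℕ}

/-- The average, over points sampled from the weights with increments the first components of `p`,
of `F` times the difference of the components of `p` at the last point. -/
noncomputable def pairGibbs (F : (Fin (m + 1) → Fin (m + 1) → ℝ) → ℝ) (x : OverlapStructure)
    (p : ℕ → ℝ × ℝ) : ℝ :=
  x.replicaSum (x.reweight fun i => (p i).1) F fun i => (p i).2 - (p i).1

lemma measurable_pairGibbs (hF : Measurable F) :
    Measurable fun z : OverlapStructure × (ℕ → ℝ × ℝ) => pairGibbs F z.1 z.2 :=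
  measurable_replicaSum hF measurable_fst (measurable_reweight_comp measurable_fst (by fun_prop))
    (by fun_prop)

lemma measurable_pairGibbs_left (hF : Measurable F) (x : OverlapStructure) :
    Measurable (pairGibbs F x) :=
  measurable_replicaSum hF (X := fun _ => x) measurable_const
    (measurable_reweight_comp (X := fun _ => x) measurable_const (by fun_prop)) (by fun_prop)

lemma abs_snd_sub_fst_le (u : ℝ × ℝ) : |u.2 - u.1| ≤ 2 * Real.exp ‖u‖ := by
  have h1 : |u.1| ≤ ‖u‖ := norm_fst_le u
  have h2 : |u.2| ≤ ‖u‖ := norm_snd_le u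
  have h3 := Real.add_one_le_exp ‖u‖
  have h4 := abs_sub u.2 u.1
  linarith

lemma abs_fst_le_norm (u : ℝ × ℝ) : |u.1| ≤ ‖u‖ := norm_fst_le u

lemma abs_snd_le_norm (u : ℝ × ℝ) : |u.2| ≤ ‖u‖ := norm_snd_le u

lemma abs_pairGibbs_le {B : ℝ} (hFB : ∀ q, |F q| ≤ B) {x : OverlapStructure}
    {p : ℕ → ℝ × ℝ} (h : x.HasExpMoments p) (hx : x.IsProper) :
    |pairGibbs F x p| ≤ B * 2 * x.expAverage 4 p :=
  h.abs_replicaSum_le hx hFB (fun j => abs_fst_le_norm (p j)) fun j => abs_snd_sub_fst_le (p j)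

/-- The mean of `pairGibbs` after `n` steps. -/
noncomputable def meanPairGibbs (F : (Fin (m + 1) → Fin (m + 1) → ℝ) → ℝ) (φ : ℝ → ℝ × ℝ)
    (r n : ℕ) (x : OverlapStructure) : ℝ :=
  ∫ p, pairGibbs F x p ∂walkKernel φ r n x

lemma measurable_meanPairGibbs (hF : Measurable F) (n : ℕ) :
    Measurable (meanPairGibbs F φ r n) :=
  (measurable_pairGibbs hF).stronglyMeasurable.integral_kernel_prod_right'.measurable

lemma integrable_pairGibbs (hF : Measurable F) {B : ℝ} (hFB : ∀ q, |F q| ≤ B)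
    (hφ : HasLinearGrowth φ) (n : ℕ) {x : OverlapStructure} (hx : x.IsProper) :
    Integrable (pairGibbs F x) (walkKernel φ r n x) := by
  refine ((integrable_expAverage_walkKernel hφ r n x (t := 4) (by norm_num)).const_mul
    (B * 2)).mono' (measurable_pairGibbs_left hF _).aestronglyMeasurable ?_
  filter_upwards [ae_hasExpMoments_walkKernel hφ r n x] with p hp
  exact abs_pairGibbs_le hFB hp hx

lemma integral_abs_pairGibbs_le (hF : Measurable F) {B : ℝ} (hFB : ∀ q, |F q| ≤ B)
    (hφ : HasLinearGrowth φ) (n : ℕ) {x : OverlapStructure} (hx : x.IsProper) :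
    ∫ p, |pairGibbs F x p| ∂walkKernel φ r n x ≤ B * 2 * (expMoment φ 4 ^ n).toReal := by
  have hB : 0 ≤ B := (abs_nonneg _).trans (hFB 0)
  calc _ ≤ ∫ p, B * 2 * x.expAverage 4 p ∂walkKernel φ r n x := by
        refine integral_mono_ae (integrable_pairGibbs hF hFB hφ n hx).abs
          ((integrable_expAverage_walkKernel hφ r n x (by norm_num)).const_mul _) ?_
        filter_upwards [ae_hasExpMoments_walkKernel hφ r n x] with p hp
        exact abs_pairGibbs_le hFB hp hx
    _ ≤ _ := by
        rw [integral_const_mul]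
        exact mul_le_mul_of_nonneg_left
          (integral_expAverage_walkKernel_le hφ r n x (by norm_num)) (by positivity)

lemma abs_meanPairGibbs_le (hF : Measurable F) {B : ℝ} (hFB : ∀ q, |F q| ≤ B)
    (hφ : HasLinearGrowth φ) (n : ℕ) {x : OverlapStructure} (hx : x.IsProper) :
    |meanPairGibbs F φ r n x| ≤ B * 2 * (expMoment φ 4 ^ n).toReal :=
  abs_integral_le_integral_abs.trans (integral_abs_pairGibbs_le hF hFB hφ n hx)

lemma relabelInvariant_meanPairGibbs (hF : Measurable F) (hφ : Measurable φ) (n : ℕ) :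
    RelabelInvariant (meanPairGibbs F φ r n) := by
  intro x y σ hσ
  have hm : Measurable fun (p : ℕ → ℝ × ℝ) i => p (σ i) := by fun_prop
  rw [meanPairGibbs, walkKernel_relabel hφ r n hσ.2, integral_map hm.aemeasurable
    (measurable_pairGibbs_left hF _).aestronglyMeasurable]
  refine integral_congr_ae (Filter.Eventually.of_forall fun p => ?_)
  simp only [pairGibbs]
  rw [reweight_relabel hσ.1 fun i => (p i).1]
  exact replicaSum_relabel hσ.2 (x.reweight fun i => (p i).1) F fun i => (p i).2 - (p i).1

/-- The part of the mean that is due to the increments `q` after the increments `p`. -/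
lemma pairGibbs_evolve {x y : OverlapStructure} {σ : Equiv.Perm ℕ} {p : ℕ → ℝ × ℝ}
    (hσ : ∀ i, y.weight i = x.reweight (fun i => (p i).1) (σ i))
    (hσ' : ∀ i j, y.overlap i j = x.overlap (σ i) (σ j))
    (hp : x.partition (fun i => (p i).1) ≠ 0) (q : ℕ → ℝ × ℝ) :
    pairGibbs F y (fun i => q (σ i)) =
      x.replicaSum (x.reweight fun i => ((p + q) i).1) F fun i => (q i).2 - (q i).1 := by
  have h1 : y.reweight (fun i => (q (σ i)).1) =
      fun i => x.reweight (fun i => ((p + q) i).1) (σ i) :=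
    funext fun i => reweight_evolve hσ hp (fun i => (q i).1) i
  rw [pairGibbs, h1]
  exact replicaSum_relabel hσ' _ F fun i => (q i).2 - (q i).1

lemma ae_hasExpMoments_partition_ne (hφ : HasLinearGrowth φ) (n : ℕ) {x : OverlapStructure}
    (hx : x.IsProper) : ∀ᵐ p ∂walkKernel φ r n x, x.partition (fun i => (p i).1) ≠ 0 := by
  filter_upwards [ae_hasExpMoments_walkKernel hφ r n x] with p hp
  exact hp.partition_ne hx fun j => abs_fst_le_norm (p j)

lemma integral_pairGibbs_evolve (hF : Measurable F) (hφ : Measurable φ) (n : ℕ)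
    {x : OverlapStructure} {p : ℕ → ℝ × ℝ} (hp : x.partition (fun i => (p i).1) ≠ 0)
    (g : ℝ → ℝ) (hg : Measurable g) :
    ∫ q, g (x.replicaSum (x.reweight fun i => ((p + q) i).1) F fun i => (q i).2 - (q i).1)
      ∂walkKernel φ r n x =
      ∫ q, g (pairGibbs F (x.evolve fun i => (p i).1) q)
        ∂walkKernel φ r n (x.evolve fun i => (p i).1) := by
  obtain ⟨σ, hσ, hσ'⟩ := x.exists_perm_evolve fun i => (p i).1
  have hm : Measurable fun (p : ℕ → ℝ × ℝ) i => p (σ i) := by fun_prop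
  rw [walkKernel_relabel hφ r n hσ', integral_map hm.aemeasurable
    (show Measurable fun q => g (pairGibbs F (x.evolve fun i => (p i).1) q) from
      hg.comp (measurable_pairGibbs_left hF _)).aestronglyMeasurable]
  refine integral_congr_ae (Filter.Eventually.of_forall fun q => ?_)
  simp only
  rw [pairGibbs_evolve hσ hσ' hp]

lemma integrable_pairGibbs_evolve (hF : Measurable F) {B : ℝ} (hFB : ∀ q, |F q| ≤ B)
    (hφ : HasLinearGrowth φ) (n : ℕ)
    {x : OverlapStructure} {p : ℕ → ℝ × ℝ} (hp : x.partition (fun i => (p i).1) ≠ 0) :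
    Integrable (fun q => x.replicaSum (x.reweight fun i => ((p + q) i).1) F
      fun i => (q i).2 - (q i).1) (walkKernel φ r n x) := by
  obtain ⟨σ, hσ, hσ'⟩ := x.exists_perm_evolve fun i => (p i).1
  have hm : Measurable fun (p : ℕ → ℝ × ℝ) i => p (σ i) := by fun_prop
  have := integrable_pairGibbs (r := r) hF hFB hφ n (isProper_evolve hp)
  rw [walkKernel_relabel hφ.measurable r n hσ', integrable_map_measure
    (measurable_pairGibbs_left hF _).aestronglyMeasurable
    hm.aemeasurable] at this
  refine this.congr (Filter.Eventually.of_forall fun q => ?_)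
  simp only [Function.comp]
  rw [pairGibbs_evolve hσ hσ' hp]

/-- The tilt depends only on the sum of the increments, so independent steps may be taken in any
order. The share of each block of steps is computed as if the other block had come first and
produced the evolved structure. -/
lemma meanPairGibbs_succ (hF : Measurable F) {B : ℝ} (hFB : ∀ q, |F q| ≤ B)
    (hφ : HasLinearGrowth φ) (n : ℕ) {x : OverlapStructure} (hx : x.IsProper) :
    meanPairGibbs F φ r (n + 1) x =
      (∫ p, meanPairGibbs F φ r n (x.evolve fun i => (p i).1) ∂walkKernel φ r 1 x) +
        ∫ q, meanPairGibbs F φ r 1 (x.evolve fun i => (q i).1) ∂walkKernel φ r n x := by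
  have := isMarkovKernel_walkKernel hφ.measurable r n
  have := isMarkovKernel_walkKernel hφ.measurable r 1
  have mX : Measurable fun z : (ℕ → ℝ × ℝ) × (ℕ → ℝ × ℝ) =>
      x.reweight fun i => ((z.1 + z.2) i).1 :=
    measurable_reweight_comp (X := fun _ => x) measurable_const
      (a := fun z : (ℕ → ℝ × ℝ) × (ℕ → ℝ × ℝ) => fun i => ((z.1 + z.2) i).1)
      (measurable_pi_lambda _ fun i => by simp only [Pi.add_apply]; fun_prop)
  set D2 : (ℕ → ℝ × ℝ) × (ℕ → ℝ × ℝ) → ℝ := fun z =>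
    x.replicaSum (x.reweight fun i => ((z.1 + z.2) i).1) F fun i => (z.2 i).2 - (z.2 i).1 with hD2
  set D1 : (ℕ → ℝ × ℝ) × (ℕ → ℝ × ℝ) → ℝ := fun z =>
    x.replicaSum (x.reweight fun i => ((z.1 + z.2) i).1) F fun i => (z.1 i).2 - (z.1 i).1 with hD1
  have mD2 : Measurable D2 := measurable_replicaSum hF measurable_const mX (by fun_prop)
  have mD1 : Measurable D1 := measurable_replicaSum hF measurable_const mX (by fun_prop)
  have hae1 := ae_hasExpMoments_partition_ne (r := r) hφ 1 hx
  have haen := ae_hasExpMoments_partition_ne (r := r) hφ n hx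
  have i2 : Integrable D2 ((walkKernel φ r 1 x).prod (walkKernel φ r n x)) := by
    rw [integrable_prod_iff mD2.aestronglyMeasurable]
    refine ⟨?_, ?_⟩
    · filter_upwards [hae1] with p hp
      exact integrable_pairGibbs_evolve hF hFB hφ n hp
    · refine Integrable.of_bound
        (mD2.norm.stronglyMeasurable.integral_prod_right).aestronglyMeasurable
        (B * 2 * (expMoment φ 4 ^ n).toReal) ?_
      filter_upwards [hae1] with p hp
      rw [Real.norm_of_nonneg (integral_nonneg fun _ => norm_nonneg _)]
      refine (integral_pairGibbs_evolve hF hφ.measurable n hp (fun u => |u|)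
        (by fun_prop)).trans_le ?_
      exact integral_abs_pairGibbs_le hF hFB hφ n (isProper_evolve hp)
  have hswap : ∀ p q : ℕ → ℝ × ℝ, D1 (p, q) = D2 (q, p) := fun p q => by
    simp only [hD1, hD2, add_comm]
  have i1' : Integrable (fun z : (ℕ → ℝ × ℝ) × (ℕ → ℝ × ℝ) => D2 z)
      ((walkKernel φ r n x).prod (walkKernel φ r 1 x)) := by
    rw [integrable_prod_iff mD2.aestronglyMeasurable]
    refine ⟨?_, ?_⟩
    · filter_upwards [haen] with p hp
      exact integrable_pairGibbs_evolve hF hFB hφ 1 hp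
    · refine Integrable.of_bound
        (mD2.norm.stronglyMeasurable.integral_prod_right).aestronglyMeasurable
        (B * 2 * (expMoment φ 4 ^ 1).toReal) ?_
      filter_upwards [haen] with p hp
      rw [Real.norm_of_nonneg (integral_nonneg fun _ => norm_nonneg _)]
      refine (integral_pairGibbs_evolve hF hφ.measurable 1 hp (fun u => |u|)
        (by fun_prop)).trans_le ?_
      exact integral_abs_pairGibbs_le hF hFB hφ 1 (isProper_evolve hp)
  have i1 : Integrable D1 ((walkKernel φ r 1 x).prod (walkKernel φ r n x)) :=
    i1'.swap.congr (Filter.Eventually.of_forall fun z => (hswap z.1 z.2).symm)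
  have hsum : ∀ᵐ z ∂(walkKernel φ r 1 x).prod (walkKernel φ r n x),
      pairGibbs F x (z.1 + z.2) = D2 z + D1 z := by
    have hw : ∀ᵐ z ∂(walkKernel φ r 1 x).prod (walkKernel φ r n x),
        x.HasExpMoments (fun j => ‖z.1 j‖ + ‖z.2 j‖) := by
      have h1 := (ae_hasExpMoments_walkKernel hφ r 1 x)
      have h2 := (ae_hasExpMoments_walkKernel hφ r n x)
      filter_upwards [Measure.quasiMeasurePreserving_fst.ae h1,
        Measure.quasiMeasurePreserving_snd.ae h2] with z hz1 hz2
      refine ((x.hasExpMoments_iff _).2 fun t => ?_)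
      -- The product of two exponentials is at most the sum of their squares, which doubles the
      -- exponents.
      refine (((hz1 (2 * t)).add (hz2 (2 * t)))).of_nonneg_of_le
        (fun j => x.weight_mul_exp_nonneg j _) fun j => ?_
      rw [← mul_add, Real.norm_of_nonneg (by positivity), mul_add, Real.exp_add]
      refine mul_le_mul_of_nonneg_left ?_ (x.weight_nonneg j)
      have e1 : Real.exp (2 * t * ‖z.1 j‖) = Real.exp (t * ‖z.1 j‖) ^ 2 := by
        rw [← Real.exp_nat_mul]; congr 1; push_cast; ring
      have e2 : Real.exp (2 * t * ‖z.2 j‖) = Real.exp (t * ‖z.2 j‖) ^ 2 := by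
        rw [← Real.exp_nat_mul]; congr 1; push_cast; ring
      rw [e1, e2]
      nlinarith [sq_nonneg (Real.exp (t * ‖z.1 j‖) - Real.exp (t * ‖z.2 j‖)),
        sq_nonneg (Real.exp (t * ‖z.1 j‖)), sq_nonneg (Real.exp (t * ‖z.2 j‖))]
    filter_upwards [hw] with z hz
    have ha : ∀ j, |((z.1 + z.2) j).1| ≤ ‖‖z.1 j‖ + ‖z.2 j‖‖ := fun j => by
      rw [Real.norm_of_nonneg (by positivity)]
      exact (abs_fst_le_norm _).trans (norm_add_le _ _)
    have hexp : ∀ u v : ℝ, 0 ≤ v → u ≤ v → Real.exp u ≤ Real.exp ‖v‖ := fun u v hv huv =>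
      Real.exp_le_exp.2 (huv.trans (le_abs_self v))
    have hc2 : ∀ j, |(z.2 j).2 - (z.2 j).1| ≤ 2 * Real.exp ‖‖z.1 j‖ + ‖z.2 j‖‖ := fun j =>
      (abs_snd_sub_fst_le _).trans (mul_le_mul_of_nonneg_left
        (hexp _ _ (by positivity) (le_add_of_nonneg_left (norm_nonneg _))) zero_le_two)
    have hc1 : ∀ j, |(z.1 j).2 - (z.1 j).1| ≤ 2 * Real.exp ‖‖z.1 j‖ + ‖z.2 j‖‖ := fun j =>
      (abs_snd_sub_fst_le _).trans (mul_le_mul_of_nonneg_left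
        (hexp _ _ (by positivity) (le_add_of_nonneg_right (norm_nonneg _))) zero_le_two)
    rw [hD2, hD1, pairGibbs]
    simp only
    rw [← replicaSum_add x hFB (x.reweight_nonneg _) (x.summable_reweight _)
      (hz.summable_reweight_mul hx ha hc2) (hz.summable_reweight_mul hx ha hc1)]
    congr 1
    ext j
    simp only [Pi.add_apply, Prod.fst_add, Prod.snd_add]
    ring
  have hprod : walkKernel φ r (n + 1) x =
      ((walkKernel φ r 1 x).prod (walkKernel φ r n x)).map fun p => p.1 + p.2 := by
    rw [walkKernel_succ_apply, walkKernel_one]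
  rw [meanPairGibbs, hprod, integral_map (by fun_prop)
    (measurable_pairGibbs_left hF _).aestronglyMeasurable]
  rw [integral_congr_ae hsum, integral_add i2 i1, integral_prod _ i2]
  congr 1
  · refine integral_congr_ae ?_
    filter_upwards [hae1] with p hp
    exact integral_pairGibbs_evolve hF hφ.measurable n hp id measurable_id
  · rw [integral_prod_symm _ i1]
    refine integral_congr_ae ?_
    filter_upwards [haen] with q hq
    simp only [hswap]
    exact integral_pairGibbs_evolve hF hφ.measurable 1 hq id measurable_id

end PairWalk

/-! ### The inequality between increments and free energies. -/

section PairInequality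

variable {m : ℕ} {F : (Fin (m + 1) → Fin (m + 1) → ℝ) → ℝ}
  {P : Measure OverlapStructure} [IsProbabilityMeasure P] {φ : ℝ → ℝ × ℝ} {r : ℕ}

lemma HasLinearGrowth.fst (hφ : HasLinearGrowth φ) : HasLinearGrowth fun y => (φ y).1 := by
  obtain ⟨C, c, h⟩ := hφ.bound
  exact ⟨hφ.measurable.fst, C, c, fun y => (norm_fst_le _).trans (h y)⟩

lemma HasLinearGrowth.snd (hφ : HasLinearGrowth φ) : HasLinearGrowth fun y => (φ y).2 := by
  obtain ⟨C, c, h⟩ := hφ.bound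
  exact ⟨hφ.measurable.snd, C, c, fun y => (norm_snd_le _).trans (h y)⟩

lemma walkKernel_fst (hφ : Measurable φ) (r n : ℕ) (x : OverlapStructure) :
    walkKernel (fun y => (φ y).1) r n x = (walkKernel φ r n x).map fun p i => (p i).1 :=
  walkKernel_map hφ measurable_fst rfl (fun _ _ => rfl) r n x

lemma walkKernel_snd (hφ : Measurable φ) (r n : ℕ) (x : OverlapStructure) :
    walkKernel (fun y => (φ y).2) r n x = (walkKernel φ r n x).map fun p i => (p i).2 :=
  walkKernel_map hφ measurable_snd rfl (fun _ _ => rfl) r n x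

lemma integral_evolve_walkKernel {φ : ℝ → ℝ} (hφ : HasLinearGrowth φ) (h : IsQuasiStationary P φ r)
    (hP : ∀ᵐ x ∂P, x.IsProper) {f : OverlapStructure → ℝ} (hf : Measurable f)
    (hfi : RelabelInvariant f) (hfP : Integrable f P) (n : ℕ) :
    Integrable (fun x => ∫ a, f (x.evolve a) ∂walkKernel φ r n x) P ∧
      ∫ x, ∫ a, f (x.evolve a) ∂walkKernel φ r n x ∂P = ∫ x, f x ∂P := by
  have := isMarkovKernel_walkKernel hφ.measurable r n
  have hmap := map_evolve_walkKernel hφ h hP hf hfi n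
  have hm : Measurable fun z : OverlapStructure × (ℕ → ℝ) => f (z.1.evolve z.2) :=
    hf.comp measurable_evolve
  have h1 : Integrable (fun z : OverlapStructure × (ℕ → ℝ) => f (z.1.evolve z.2))
      (P ⊗ₘ walkKernel φ r n) := by
    have h2 : Integrable id (P.map f) :=
      (integrable_map_measure aestronglyMeasurable_id hf.aemeasurable).2 hfP
    rw [← hmap] at h2
    exact (integrable_map_measure aestronglyMeasurable_id hm.aemeasurable).1 h2
  refine ⟨Integrable.integral_compProd h1, ?_⟩
  rw [← Measure.integral_compProd h1]
  have e1 := integral_map hm.aemeasurable (μ := P ⊗ₘ walkKernel φ r n) (f := id)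
    aestronglyMeasurable_id
  have e2 := integral_map hf.aemeasurable (μ := P) (f := id) aestronglyMeasurable_id
  simp only [id] at e1 e2
  rw [← e1, hmap, e2]

lemma integral_evolve_fst_walkKernel (hφ : HasLinearGrowth φ)
    (h : IsQuasiStationary P (fun y => (φ y).1) r)
    (hP : ∀ᵐ x ∂P, x.IsProper) {f : OverlapStructure → ℝ} (hf : Measurable f)
    (hfi : RelabelInvariant f) (hfP : Integrable f P) (n : ℕ) :
    Integrable (fun x => ∫ p, f (x.evolve fun i => (p i).1) ∂walkKernel φ r n x) P ∧
      ∫ x, ∫ p, f (x.evolve fun i => (p i).1) ∂walkKernel φ r n x ∂P = ∫ x, f x ∂P := by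
  have e : ∀ x, ∫ p, f (x.evolve fun i => (p i).1) ∂walkKernel φ r n x =
      ∫ a, f (x.evolve a) ∂walkKernel (fun y => (φ y).1) r n x := fun x => by
    rw [walkKernel_fst hφ.measurable, integral_map (Measurable.aemeasurable (by fun_prop))
      (show Measurable fun a => f (x.evolve a) from
        hf.comp (measurable_evolve_left x)).aestronglyMeasurable]
  simp only [e]
  exact integral_evolve_walkKernel hφ.fst h hP hf hfi hfP n

lemma integrable_meanPairGibbs (hF : Measurable F) {B : ℝ} (hFB : ∀ q, |F q| ≤ B)
    (hφ : HasLinearGrowth φ) (hP : ∀ᵐ x ∂P, x.IsProper) (n : ℕ) :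
    Integrable (meanPairGibbs F φ r n) P := by
  refine Integrable.of_bound (measurable_meanPairGibbs hF n).aestronglyMeasurable
    (B * 2 * (expMoment φ 4 ^ n).toReal) ?_
  filter_upwards [hP] with x hx
  exact abs_meanPairGibbs_le hF hFB hφ n hx

/-- Tilting by the first components is the stationary evolution, so each of the `n` steps
contributes the same amount. -/
lemma integral_meanPairGibbs (hF : Measurable F) {B : ℝ} (hFB : ∀ q, |F q| ≤ B)
    (hφ : HasLinearGrowth φ) (hP : ∀ᵐ x ∂P, x.IsProper)
    (h : IsQuasiStationary P (fun y => (φ y).1) r) (n : ℕ) :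
    ∫ x, meanPairGibbs F φ r n x ∂P = n * ∫ x, meanPairGibbs F φ r 1 x ∂P := by
  induction n with
  | zero =>
    have : ∀ x, meanPairGibbs F φ r 0 x = 0 := fun x => by
      rw [meanPairGibbs, walkKernel, Kernel.const_apply,
        integral_dirac' _ _ (measurable_pairGibbs_left hF x).stronglyMeasurable]
      simp [pairGibbs, replicaSum]
    simp [this]
  | succ n ih =>
    have h1 := integral_evolve_fst_walkKernel hφ h hP (measurable_meanPairGibbs hF n)
      (relabelInvariant_meanPairGibbs hF hφ.measurable n)
      (integrable_meanPairGibbs (r := r) hF hFB hφ hP n) 1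
    have h2 := integral_evolve_fst_walkKernel hφ h hP (measurable_meanPairGibbs hF 1)
      (relabelInvariant_meanPairGibbs hF hφ.measurable 1)
      (integrable_meanPairGibbs (r := r) hF hFB hφ hP 1) n
    have e : meanPairGibbs F φ r (n + 1) =ᵐ[P] fun x =>
        (∫ p, meanPairGibbs F φ r n (x.evolve fun i => (p i).1) ∂walkKernel φ r 1 x) +
        ∫ q, meanPairGibbs F φ r 1 (x.evolve fun i => (q i).1) ∂walkKernel φ r n x := by
      filter_upwards [hP] with x hx
      exact meanPairGibbs_succ hF hFB hφ n hx
    rw [integral_congr_ae e, integral_add h1.1 h2.1, h1.2, h2.2, ih]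
    push_cast
    ring

/-- The average of `F` over points sampled from the weights. -/
noncomputable def sampleAverage (F : (Fin (m + 1) → Fin (m + 1) → ℝ) → ℝ) (x : OverlapStructure) :
    ℝ :=
  x.replicaSum x.weight F fun _ => 1

lemma measurable_weight_pi : Measurable fun x : OverlapStructure => x.weight :=
  measurable_pi_lambda _ fun i => measurable_weight i

lemma measurable_sampleAverage (hF : Measurable F) : Measurable (sampleAverage F) :=
  measurable_replicaSum hF measurable_id measurable_weight_pi measurable_const

lemma relabelInvariant_sampleAverage : RelabelInvariant (sampleAverage F) := by
  intro x y σ hσ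
  have : y.weight = fun i => x.weight (σ i) := funext hσ.1
  rw [sampleAverage, this]
  exact replicaSum_relabel hσ.2 x.weight F fun _ => 1

lemma sampleAverage_evolve (x : OverlapStructure) (a : ℕ → ℝ) :
    sampleAverage F (x.evolve a) = x.replicaSum (x.reweight a) F fun _ => 1 := by
  obtain ⟨σ, hσ, hσ'⟩ := x.exists_perm_evolve a
  rw [sampleAverage, show (x.evolve a).weight = fun i => x.reweight a (σ i) from funext hσ]
  exact replicaSum_relabel hσ' _ F fun _ => 1

lemma abs_sampleAverage_le {B : ℝ} (hFB : ∀ q, |F q| ≤ B) {x : OverlapStructure} (hx : x.IsProper) :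
    |sampleAverage F x| ≤ B := by
  have := x.abs_replicaSum_le hFB x.weight_nonneg x.summable_weight hx (c := fun _ => 1)
    (by simpa using x.summable_weight)
  have hx' : ∑' i, x.weight i = 1 := hx
  rw [sampleAverage]
  simpa only [abs_one, mul_one, hx'] using this

lemma sampleAverage_nonneg (hF : ∀ q, 0 ≤ F q) (x : OverlapStructure) : 0 ≤ sampleAverage F x :=
  x.replicaSum_nonneg hF x.weight_nonneg fun _ => zero_le_one

lemma integrable_sampleAverage (hF : Measurable F) {B : ℝ} (hFB : ∀ q, |F q| ≤ B)
    (hP : ∀ᵐ x ∂P, x.IsProper) : Integrable (sampleAverage F) P := by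
  refine Integrable.of_bound (measurable_sampleAverage hF).aestronglyMeasurable B ?_
  filter_upwards [hP] with x hx
  exact abs_sampleAverage_le hFB hx

lemma abs_le_add_sq_div (u : ℝ) {δ : ℝ} (hδ : 0 < δ) : |u| ≤ δ + u ^ 2 / δ := by
  have : 0 ≤ (|u| - δ) ^ 2 := sq_nonneg _
  rw [← sq_abs u]
  rw [← sub_le_iff_le_add', le_div_iff₀ hδ]
  nlinarith [mul_nonneg (abs_nonneg u) hδ.le]

lemma integral_affine {Ω : Type*} [MeasurableSpace Ω] {μ : Measure Ω} [IsProbabilityMeasure μ]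
    {f g k : Ω → ℝ} (hf : Integrable f μ) (hg : Integrable g μ) (hk : Integrable k μ)
    (a B c d : ℝ) :
    Integrable (fun z => f z * a + B * (c + (g z / d + k z / d)) + B) μ ∧
    ∫ z, (f z * a + B * (c + (g z / d + k z / d)) + B) ∂μ =
      (∫ z, f z ∂μ) * a + B * (c + ((∫ z, g z ∂μ) / d + (∫ z, k z ∂μ) / d)) + B := by
  have h1 : Integrable (fun z => f z * a) μ := hf.mul_const a
  have h2 : Integrable (fun z => g z / d) μ := hg.div_const d
  have h3 : Integrable (fun z => k z / d) μ := hk.div_const d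
  have h4 : Integrable (fun z => g z / d + k z / d) μ := h2.add h3
  have h5 : Integrable (fun z => c + (g z / d + k z / d)) μ := (integrable_const c).add h4
  have h6 : Integrable (fun z => B * (c + (g z / d + k z / d))) μ := h5.const_mul B
  have h7 : Integrable (fun z => f z * a + B * (c + (g z / d + k z / d))) μ := h1.add h6
  refine ⟨h7.add (integrable_const B), ?_⟩
  rw [integral_add h7 (integrable_const B), integral_add h1 h6, integral_mul_const,
    integral_const_mul, integral_add (integrable_const c) h4, integral_add h2 h3, integral_div,
    integral_div]
  simp

/-- The entropy inequality is applied to the difference of the walks, whose exponential has tilted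
average `Z₂ / Z₁`. Deviations of the logarithms from `d` and `e` are traded for squares through `|u|
≤ δ + u² / δ`, since only second moments are controlled later. -/
lemma pairGibbs_le {B : ℝ} (hF0 : ∀ q, 0 ≤ F q) (hFB : ∀ q, |F q| ≤ B) {x : OverlapStructure}
    {p : ℕ → ℝ × ℝ} (h : x.HasExpMoments p) (hx : x.IsProper) (d e : ℝ) {δ : ℝ} (hδ : 0 < δ) :
    pairGibbs F x p ≤ sampleAverage F (x.evolve fun i => (p i).1) * (e - d) +
      B * (2 * δ + ((Real.log (x.partition fun i => (p i).1) - d) ^ 2 / δ +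
        (Real.log (x.partition fun i => (p i).2) - e) ^ 2 / δ)) + B := by
  have hp1 := h.partition_ne hx (a := fun i => (p i).1) fun j => abs_fst_le_norm (p j)
  have hp2 := h.partition_ne hx (a := fun i => (p i).2) fun j => abs_snd_le_norm (p j)
  have hadd : ((fun i => (p i).1) + fun i => (p i).2 - (p i).1) = fun i => (p i).2 := by
    ext i; simp
  have hlog := tsum_reweight_mul_exp x (fun i => (p i).1) fun i => (p i).2 - (p i).1
  rw [hadd] at hlog
  have hse : Summable fun j => x.reweight (fun i => (p i).1) j *
      Real.exp ((p j).2 - (p j).1) := by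
    by_contra hn
    rw [tsum_eq_zero_of_not_summable hn] at hlog
    exact div_ne_zero hp2 hp1 hlog.symm
  have h1 := x.replicaSum_le_log hF0 hFB (x.reweight_nonneg fun i => (p i).1)
    (x.summable_reweight _) (tsum_reweight hp1) (c := fun i => (p i).2 - (p i).1)
    (h.summable_reweight_mul hx (fun j => abs_fst_le_norm (p j)) fun j => abs_snd_sub_fst_le (p j))
    hse
  rw [hlog, Real.log_div hp2 hp1, ← sampleAverage_evolve] at h1
  set L1 := Real.log (x.partition fun i => (p i).1)
  set L2 := Real.log (x.partition fun i => (p i).2)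
  have h2 := sampleAverage_nonneg hF0 (x.evolve fun i => (p i).1)
  have h3 := (le_abs_self _).trans (abs_sampleAverage_le hFB (isProper_evolve hp1))
  set D := sampleAverage F (x.evolve fun i => (p i).1)
  have h4 := abs_le_add_sq_div (L1 - d) hδ
  have h5 := abs_le_add_sq_div (L2 - e) hδ
  have h6 := neg_abs_le (L1 - d)
  have h7 := le_abs_self (L2 - e)
  refine h1.trans ?_
  have h8 : L2 - L1 - 1 ≤ (e - d) + (|L1 - d| + |L2 - e|) := by linarith
  have h9 : D * (|L1 - d| + |L2 - e|) ≤ B * (|L1 - d| + |L2 - e|) :=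
    mul_le_mul_of_nonneg_right h3 (by positivity)
  have h10 : B * (|L1 - d| + |L2 - e|) ≤
      B * (2 * δ + ((L1 - d) ^ 2 / δ + (L2 - e) ^ 2 / δ)) :=
    mul_le_mul_of_nonneg_left (by linarith) (h2.trans h3)
  have h11 := mul_le_mul_of_nonneg_left h8 h2
  linarith

lemma integrable_log_fst_sq (hφ : HasLinearGrowth φ) (n : ℕ) {x : OverlapStructure}
    (hx : x.IsProper) (d : ℝ) :
    Integrable (fun p : ℕ → ℝ × ℝ => (Real.log (x.partition fun i => (p i).1) - d) ^ 2)
      (walkKernel φ r n x) ∧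
    ∫ p, (Real.log (x.partition fun i => (p i).1) - d) ^ 2 ∂walkKernel φ r n x =
      meanSqLog (fun y => (φ y).1) r n d x := by
  have hm : AEMeasurable (fun (p : ℕ → ℝ × ℝ) i => (p i).1) (walkKernel φ r n x) :=
    Measurable.aemeasurable (by fun_prop)
  have hm' : Measurable fun a => (Real.log (x.partition a) - d) ^ 2 :=
    ((measurable_log_partition_left x).sub_const d).pow_const 2
  have h := integrable_log_partition_sub_sq hφ.fst r n hx d
  rw [walkKernel_fst hφ.measurable] at h
  refine ⟨(integrable_map_measure hm'.aestronglyMeasurable hm).1 h, ?_⟩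
  rw [meanSqLog, walkKernel_fst hφ.measurable, integral_map hm hm'.aestronglyMeasurable]

lemma integrable_log_snd_sq (hφ : HasLinearGrowth φ) (n : ℕ) {x : OverlapStructure}
    (hx : x.IsProper) (d : ℝ) :
    Integrable (fun p : ℕ → ℝ × ℝ => (Real.log (x.partition fun i => (p i).2) - d) ^ 2)
      (walkKernel φ r n x) ∧
    ∫ p, (Real.log (x.partition fun i => (p i).2) - d) ^ 2 ∂walkKernel φ r n x =
      meanSqLog (fun y => (φ y).2) r n d x := by
  have hm : AEMeasurable (fun (p : ℕ → ℝ × ℝ) i => (p i).2) (walkKernel φ r n x) :=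
    Measurable.aemeasurable (by fun_prop)
  have hm' : Measurable fun a => (Real.log (x.partition a) - d) ^ 2 :=
    ((measurable_log_partition_left x).sub_const d).pow_const 2
  have h := integrable_log_partition_sub_sq hφ.snd r n hx d
  rw [walkKernel_snd hφ.measurable] at h
  refine ⟨(integrable_map_measure hm'.aestronglyMeasurable hm).1 h, ?_⟩
  rw [meanSqLog, walkKernel_snd hφ.measurable, integral_map hm hm'.aestronglyMeasurable]

lemma meanPairGibbs_le (hF : Measurable F) {B : ℝ} (hF0 : ∀ q, 0 ≤ F q) (hFB : ∀ q, |F q| ≤ B)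
    (hφ : HasLinearGrowth φ) (n : ℕ) {x : OverlapStructure} (hx : x.IsProper)
    (d e : ℝ) {δ : ℝ} (hδ : 0 < δ) :
    meanPairGibbs F φ r n x ≤
      (∫ p, sampleAverage F (x.evolve fun i => (p i).1) ∂walkKernel φ r n x) * (e - d) +
      B * (2 * δ + (meanSqLog (fun y => (φ y).1) r n d x / δ +
        meanSqLog (fun y => (φ y).2) r n e x / δ)) + B := by
  have := isMarkovKernel_walkKernel hφ.measurable r n
  have h1 := integrable_log_fst_sq (r := r) hφ n hx d
  have h2 := integrable_log_snd_sq (r := r) hφ n hx e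
  have hD : Integrable (fun p : ℕ → ℝ × ℝ => sampleAverage F (x.evolve fun i => (p i).1))
      (walkKernel φ r n x) := by
    refine Integrable.of_bound (Measurable.aestronglyMeasurable
      ((measurable_sampleAverage hF).comp ((measurable_evolve_left x).comp (by fun_prop)))) B ?_
    filter_upwards [ae_hasExpMoments_walkKernel hφ r n x] with p hp
    exact abs_sampleAverage_le hFB (isProper_evolve
      (hp.partition_ne hx fun j => abs_fst_le_norm (p j)))
  have hI := integral_affine hD h1.1 h2.1 (e - d) B (2 * δ) δ
  calc meanPairGibbs F φ r n x ≤ ∫ p, (sampleAverage F (x.evolve fun i => (p i).1) * (e - d) +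
        B * (2 * δ + ((Real.log (x.partition fun i => (p i).1) - d) ^ 2 / δ +
        (Real.log (x.partition fun i => (p i).2) - e) ^ 2 / δ)) + B) ∂walkKernel φ r n x := by
        refine integral_mono_ae (integrable_pairGibbs hF hFB hφ n hx) hI.1 ?_
        filter_upwards [ae_hasExpMoments_walkKernel hφ r n x] with p hp
        exact pairGibbs_le hF0 hFB hp hx d e hδ
    _ = _ := by
        rw [hI.2, h1.2, h2.2]

/-- The left side grows exactly linearly in the number of steps, while the entropy inequality loses
a constant and fluctuations that are `o(n)` by the law of large numbers. Dividing by `n` leaves the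
sharp one-step bound. -/
theorem integral_meanPairGibbs_one_le (hF : Measurable F) {B : ℝ} (hF0 : ∀ q, 0 ≤ F q)
    (hFB : ∀ q, |F q| ≤ B) (hφ : HasLinearGrowth φ) (hP : ∀ᵐ x ∂P, x.IsProper)
    (h1 : IsQuasiStationary P (fun y => (φ y).1) r)
    (h2 : IsQuasiStationary P (fun y => (φ y).2) r)
    (e1 : IsErgodicEvolution P (fun y => (φ y).1) r)
    (e2 : IsErgodicEvolution P (fun y => (φ y).2) r) :
    ∫ x, meanPairGibbs F φ r 1 x ∂P ≤ (∫ x, sampleAverage F x ∂P) *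
      (freeEnergy P (fun y => (φ y).2) r - freeEnergy P (fun y => (φ y).1) r) := by
  set Λ1 := freeEnergy P (fun y => (φ y).1) r with hΛ1
  set Λ2 := freeEnergy P (fun y => (φ y).2) r with hΛ2
  have t1 := tendsto_integral_meanSqLog hφ.fst h1 hP e1
  have t2 := tendsto_integral_meanSqLog hφ.snd h2 hP e2
  rw [← hΛ1] at t1
  rw [← hΛ2] at t2
  have key : ∀ δ : ℝ, 0 < δ → ∀ n : ℕ, 0 < n →
      ∫ x, meanPairGibbs F φ r 1 x ∂P ≤ (∫ x, sampleAverage F x ∂P) * (Λ2 - Λ1) +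
        B * (2 * δ + ((∫ x, meanSqLog (fun y => (φ y).1) r n (n * Λ1) x ∂P) / (n : ℝ) ^ 2 / δ +
          (∫ x, meanSqLog (fun y => (φ y).2) r n (n * Λ2) x ∂P) / (n : ℝ) ^ 2 / δ)) +
        B / n := by
    intro δ hδ n hn
    have hn' : (0 : ℝ) < n := Nat.cast_pos.2 hn
    have hD := integral_evolve_fst_walkKernel hφ h1 hP (measurable_sampleAverage hF)
      relabelInvariant_sampleAverage (integrable_sampleAverage hF hFB hP) n
    -- The tolerance grows like `δ n`, so that after division by `n` the second moments appear as `V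
    -- / (n² δ)`.
    have hI := integral_affine hD.1 (integrable_meanSqLog hφ.fst hP r n (n * Λ1))
      (integrable_meanSqLog hφ.snd hP r n (n * Λ2)) (n * Λ2 - n * Λ1) B (2 * (δ * n)) (δ * n)
    have : ∫ x, meanPairGibbs F φ r n x ∂P ≤
        ∫ x, ((∫ p, sampleAverage F (x.evolve fun i => (p i).1) ∂walkKernel φ r n x) *
          (n * Λ2 - n * Λ1) +
        B * (2 * (δ * n) + (meanSqLog (fun y => (φ y).1) r n (n * Λ1) x / (δ * n) +
          meanSqLog (fun y => (φ y).2) r n (n * Λ2) x / (δ * n))) + B) ∂P := by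
      refine integral_mono_ae (integrable_meanPairGibbs hF hFB hφ hP n) hI.1 ?_
      filter_upwards [hP] with x hx
      exact meanPairGibbs_le hF hF0 hFB hφ n hx _ _ (by positivity)
    rw [integral_meanPairGibbs hF hFB hφ hP h1 n, hI.2, hD.2] at this
    rw [← mul_le_mul_iff_right₀ hn']
    refine this.trans (le_of_eq ?_)
    field_simp
  have key2 : ∀ δ : ℝ, 0 < δ → ∫ x, meanPairGibbs F φ r 1 x ∂P ≤
      (∫ x, sampleAverage F x ∂P) * (Λ2 - Λ1) + B * (2 * δ) := by
    intro δ hδ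
    have t3 := ((((t1.div_const δ).add (t2.div_const δ)).const_add (2 * δ)).const_mul B)
    have t4 := (t3.const_add ((∫ x, sampleAverage F x ∂P) * (Λ2 - Λ1))).add
      (tendsto_const_div_atTop_nhds_zero_nat B)
    simp only [zero_div, add_zero] at t4
    refine ge_of_tendsto t4 ?_
    filter_upwards [Filter.eventually_gt_atTop 0] with n hn
    exact key δ hδ n hn
  have t5 : Filter.Tendsto (fun δ : ℝ => (∫ x, sampleAverage F x ∂P) * (Λ2 - Λ1) + B * (2 * δ))
      (nhdsWithin 0 (Set.Ioi 0)) (nhds ((∫ x, sampleAverage F x ∂P) * (Λ2 - Λ1) + B * (2 * 0))) :=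
    (Continuous.tendsto (by fun_prop) 0).mono_left nhdsWithin_le_nhds
  simp only [mul_zero, add_zero] at t5
  refine ge_of_tendsto t5 ?_
  filter_upwards [self_mem_nhdsWithin] with δ hδ
  exact key2 δ hδ

end PairInequality

/-! ### Derivative of a tilted average for a fixed field. -/

namespace OverlapStructure

variable {m : ℕ} {F : (Fin (m + 1) → Fin (m + 1) → ℝ) → ℝ} {E : Type*} [NormedAddCommGroup E]

/-- The derivative of `replicaSum` with normalized weights `w` along increments with speed `b`. -/
noncomputable def replicaSumDeriv (x : OverlapStructure) (w : ℕ → ℝ)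
    (F : (Fin (m + 1) → Fin (m + 1) → ℝ) → ℝ) (c b : ℕ → ℝ) : ℝ :=
  ∑' i : Fin (m + 1) → ℕ, (∏ l, w (i l)) *
    (F (x.overlapsAt i) * c (i (Fin.last m)) * ∑ l, (b (i l) - ∑' k, w k * b k))

section Deterministic

variable {x : OverlapStructure} {p : ℕ → E} {I : Set ℝ} {α α' : ℝ → ℕ → ℝ}

lemma reweight_le_of_hasExpMoments (h : x.HasExpMoments p) (hx : x.IsProper) {a : ℕ → ℝ}
    (ha : ∀ j, |a j| ≤ ‖p j‖) (j : ℕ) :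
    x.reweight a j ≤ x.expAverage 2 p * (x.weight j * Real.exp ‖p j‖) := by
  have h1 := h.inv_partition_le hx (t := 2) (a := a) fun j => (ha j).trans
    (by linarith [norm_nonneg (p j)])
  rw [reweight_eq, div_eq_mul_inv, mul_comm]
  exact mul_le_mul h1 (mul_le_mul_of_nonneg_left
    (Real.exp_le_exp.2 ((le_abs_self _).trans (ha j))) (x.weight_nonneg j))
    (x.weight_mul_exp_nonneg _ _) (x.expAverage_nonneg _ _)

lemma abs_tsum_reweight_mul_le (h : x.HasExpMoments p) (hx : x.IsProper) {a b : ℕ → ℝ}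
    (ha : ∀ j, |a j| ≤ ‖p j‖) (hb : ∀ j, |b j| ≤ Real.exp ‖p j‖) :
    |∑' k, x.reweight a k * b k| ≤ x.expAverage 2 p ^ 2 := by
  have hs : Summable fun k => x.expAverage 2 p * (x.weight k * Real.exp (2 * ‖p k‖)) :=
    (h 2).mul_left _
  rw [sq, ← Real.norm_eq_abs]
  nth_rewrite 2 [expAverage]
  rw [← tsum_mul_left]
  refine tsum_of_norm_bounded hs.hasSum fun k => ?_
  rw [norm_mul, Real.norm_of_nonneg (x.reweight_nonneg _ _), Real.norm_eq_abs, two_mul,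
    Real.exp_add]
  calc _ ≤ x.expAverage 2 p * (x.weight k * Real.exp ‖p k‖) * Real.exp ‖p k‖ :=
        mul_le_mul (reweight_le_of_hasExpMoments h hx ha k) (hb k) (abs_nonneg _)
          (mul_nonneg (x.expAverage_nonneg _ _) (x.weight_mul_exp_nonneg _ _))
    _ = _ := by ring

/-- The logarithmic derivative of a normalized weight is its speed minus the weighted mean speed.
The common bound by `p` allows the normalization to be differentiated term by term. -/
lemma hasDerivAt_reweight (h : x.HasExpMoments p) (hx : x.IsProper) (hI : IsOpen I)
    (hI' : IsPreconnected I) (hα : ∀ t ∈ I, ∀ j, HasDerivAt (fun t => α t j) (α' t j) t)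
    (ha : ∀ t ∈ I, ∀ j, |α t j| ≤ ‖p j‖) (hb : ∀ t ∈ I, ∀ j, |α' t j| ≤ Real.exp ‖p j‖)
    {t : ℝ} (ht : t ∈ I) (j : ℕ) :
    HasDerivAt (fun t => x.reweight (α t) j)
      (x.reweight (α t) j * (α' t j - ∑' k, x.reweight (α t) k * α' t k)) t := by
  have hZ := h.partition_ne hx (ha t ht)
  have hd : ∀ s ∈ I, ∀ k, HasDerivAt (fun t => x.weight k * Real.exp (α t k))
      (x.weight k * (Real.exp (α s k) * α' s k)) s := fun s hs k =>
    ((hα s hs k).exp).const_mul _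
  have h1 : HasDerivAt (fun t => x.partition (α t))
      (∑' k, x.weight k * (Real.exp (α t k) * α' t k)) t := by
    refine hasDerivAt_tsum_of_isPreconnected (h 2) hI hI' (fun k s hs => hd s hs k)
      (fun k s hs => ?_) ht ?_ ht
    · rw [norm_mul, norm_mul, Real.norm_of_nonneg (x.weight_nonneg k),
        Real.norm_of_nonneg (Real.exp_nonneg _), Real.norm_eq_abs, two_mul, Real.exp_add]
      exact mul_le_mul_of_nonneg_left (mul_le_mul (Real.exp_le_exp.2
        ((le_abs_self _).trans (ha s hs k))) (hb s hs k) (abs_nonneg _) (Real.exp_nonneg _))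
        (x.weight_nonneg k)
    · exact h.summable_exp (t := 1) fun k => by
        rw [one_mul]; exact (le_abs_self _).trans (ha t ht k)
  have h2 := (hd t ht j).div h1 hZ
  refine h2.congr_deriv ?_
  have e : ∑' k, x.reweight (α t) k * α' t k =
      (∑' k, x.weight k * (Real.exp (α t k) * α' t k)) / x.partition (α t) := by
    rw [← tsum_div_const]
    exact tsum_congr fun k => by rw [reweight_eq]; ring
  rw [e, reweight_eq]
  field_simp

/-- Each point receives three exponentials: one from its own weight, and two from bounding `c` and
the speeds crudely by the product over all points. The power `m + 3` collects `m + 1` normalizations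
and the square that bounds the mean speed. -/
lemma abs_replicaSumDeriv_term_le (h : x.HasExpMoments p) (hx : x.IsProper) {a b c : ℕ → ℝ}
    {B C : ℝ} (hF : ∀ q, |F q| ≤ B) (ha : ∀ j, |a j| ≤ ‖p j‖) (hb : ∀ j, |b j| ≤ Real.exp ‖p j‖)
    (hc : ∀ j, |c j| ≤ C * Real.exp ‖p j‖) (i : Fin (m + 1) → ℕ) :
    |(∏ l, x.reweight a (i l)) * (F (x.overlapsAt i) * c (i (Fin.last m)) *
        ∑ l, (b (i l) - ∑' k, x.reweight a k * b k))| ≤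
      2 * (m + 1) * B * C * x.expAverage 2 p ^ (m + 3) *
        ∏ l, (x.weight (i l) * Real.exp (3 * ‖p (i l)‖)) := by
  set V := x.expAverage 2 p with hV
  have hV1 : 1 ≤ V := h.one_le_expAverage hx zero_le_two
  have hB : 0 ≤ B := (abs_nonneg _).trans (hF 0)
  have hC : 0 ≤ C := nonneg_of_mul_nonneg_left ((abs_nonneg _).trans (hc 0)) (Real.exp_pos _)
  set e : Fin (m + 1) → ℝ := fun l => Real.exp ‖p (i l)‖ with he
  have he1 : ∀ l, 1 ≤ e l := fun l => Real.one_le_exp (norm_nonneg _)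
  have hle : ∀ l, e l ≤ ∏ l, e l := fun l => by
    rw [← Finset.mul_prod_erase _ _ (Finset.mem_univ l)]
    exact le_mul_of_one_le_right (zero_le_one.trans (he1 l)) (Finset.one_le_prod fun k _ => he1 k)
  have hT0 : 0 ≤ ∏ l, e l := Finset.prod_nonneg fun l _ => zero_le_one.trans (he1 l)
  have h1 : |∏ l, x.reweight a (i l)| ≤ V ^ (m + 1) * ∏ l, (x.weight (i l) * e l) := by
    rw [abs_of_nonneg (Finset.prod_nonneg fun l _ => x.reweight_nonneg _ _)]
    calc _ ≤ ∏ l, V * (x.weight (i l) * e l) := Finset.prod_le_prod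
          (fun l _ => x.reweight_nonneg _ _)
          fun l _ => reweight_le_of_hasExpMoments h hx ha (i l)
      _ = _ := by rw [Finset.prod_mul_distrib]; simp
  have h2 : |F (x.overlapsAt i) * c (i (Fin.last m))| ≤ B * (C * ∏ l, e l) := by
    rw [abs_mul]
    exact mul_le_mul (hF _) ((hc _).trans (mul_le_mul_of_nonneg_left (hle (Fin.last m)) hC))
      (abs_nonneg _) hB
  have hA := abs_tsum_reweight_mul_le h hx ha hb
  have h3 : |∑ l, (b (i l) - ∑' k, x.reweight a k * b k)| ≤
      (m + 1) * (2 * V ^ 2 * ∏ l, e l) := by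
    refine (Finset.abs_sum_le_sum_abs _ _).trans ?_
    calc _ ≤ ∑ _l : Fin (m + 1), 2 * V ^ 2 * ∏ l, e l := by
          refine Finset.sum_le_sum fun l _ => ?_
          have h4 := abs_sub (b (i l)) (∑' k, x.reweight a k * b k)
          have h5 : |b (i l)| ≤ ∏ l, e l := (hb _).trans (hle l)
          have h6 : 1 ≤ ∏ l, e l := (he1 l).trans (hle l)
          have h7 : 1 ≤ V ^ 2 := one_le_pow₀ hV1
          nlinarith
      _ = _ := by simp
  rw [abs_mul, abs_mul]
  have e3 : ∏ l, (x.weight (i l) * Real.exp (3 * ‖p (i l)‖)) =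
      (∏ l, (x.weight (i l) * e l)) * (∏ l, e l) * ∏ l, e l := by
    rw [← Finset.prod_mul_distrib, ← Finset.prod_mul_distrib]
    refine Finset.prod_congr rfl fun l _ => ?_
    rw [show 3 * ‖p (i l)‖ = ‖p (i l)‖ + ‖p (i l)‖ + ‖p (i l)‖ by ring, Real.exp_add, Real.exp_add]
    ring
  have hw0 : 0 ≤ ∏ l, (x.weight (i l) * e l) :=
    Finset.prod_nonneg fun l _ => x.weight_mul_exp_nonneg _ _
  calc _ ≤ (V ^ (m + 1) * ∏ l, (x.weight (i l) * e l)) *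
        (B * (C * ∏ l, e l) * ((m + 1) * (2 * V ^ 2 * ∏ l, e l))) := by
        refine mul_le_mul h1 (mul_le_mul h2 h3 (abs_nonneg _) (by positivity)) (by positivity)
          (by positivity)
    _ = _ := by rw [e3]; ring

lemma hasSum_prod_weight_mul_exp (h : x.HasExpMoments p) (t : ℝ) (s : ℕ) :
    HasSum (fun i : Fin s → ℕ => ∏ l, (x.weight (i l) * Real.exp (t * ‖p (i l)‖)))
      (x.expAverage t p ^ s) := by
  have := hasSum_pi_prod (s := s) (f := fun _ j => x.weight j * Real.exp (t * ‖p j‖))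
    (fun _ j => x.weight_mul_exp_nonneg _ _) fun _ => h t
  simpa [expAverage] using this

lemma abs_replicaSumDeriv_le (h : x.HasExpMoments p) (hx : x.IsProper) {a b c : ℕ → ℝ}
    {B C : ℝ} (hF : ∀ q, |F q| ≤ B) (ha : ∀ j, |a j| ≤ ‖p j‖) (hb : ∀ j, |b j| ≤ Real.exp ‖p j‖)
    (hc : ∀ j, |c j| ≤ C * Real.exp ‖p j‖) :
    |x.replicaSumDeriv (x.reweight a) F c b| ≤
      2 * (m + 1) * B * C * x.expAverage ((2 * m + 4 : ℕ) * 3) p := by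
  have hB : 0 ≤ B := (abs_nonneg _).trans (hF 0)
  have hC : 0 ≤ C := nonneg_of_mul_nonneg_left ((abs_nonneg _).trans (hc 0)) (Real.exp_pos _)
  have h1 : ‖x.replicaSumDeriv (x.reweight a) F c b‖ ≤ _ :=
    tsum_of_norm_bounded ((hasSum_prod_weight_mul_exp h 3 (m + 1)).mul_left
      (2 * (m + 1) * B * C * x.expAverage 2 p ^ (m + 3)))
      (abs_replicaSumDeriv_term_le h hx hF ha hb hc)
  refine h1.trans ?_
  have h2 := h.expAverage_mono (t := 2) (u := 3) (by norm_num)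
  have h3 := x.expAverage_nonneg 2 p
  have h4 := x.expAverage_nonneg 3 p
  rw [mul_assoc _ (x.expAverage 2 p ^ (m + 3))]
  refine mul_le_mul_of_nonneg_left ?_ (by positivity)
  calc _ ≤ x.expAverage 3 p ^ (m + 3) * x.expAverage 3 p ^ (m + 1) := by gcongr
    -- The prefactor has power `m + 3` and the sum over the `m + 1` points has power `m + 1`.
    _ = x.expAverage 3 p ^ (2 * m + 4) := by rw [← pow_add]; congr 1; omega
    _ ≤ _ := h.expAverage_pow_le hx (by norm_num) _

lemma hasDerivAt_replicaSum (h : x.HasExpMoments p) (hx : x.IsProper) (hI : IsOpen I)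
    (hI' : IsPreconnected I) (hα : ∀ t ∈ I, ∀ j, HasDerivAt (fun t => α t j) (α' t j) t)
    (ha : ∀ t ∈ I, ∀ j, |α t j| ≤ ‖p j‖) (hb : ∀ t ∈ I, ∀ j, |α' t j| ≤ Real.exp ‖p j‖)
    {c : ℕ → ℝ} {B C : ℝ} (hF : ∀ q, |F q| ≤ B) (hc : ∀ j, |c j| ≤ C * Real.exp ‖p j‖)
    {t : ℝ} (ht : t ∈ I) :
    HasDerivAt (fun t => x.replicaSum (x.reweight (α t)) F c)
      (x.replicaSumDeriv (x.reweight (α t)) F c (α' t)) t := by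
  refine hasDerivAt_tsum_of_isPreconnected
    (g := fun i t => (∏ l, x.reweight (α t) (i l)) * (F (x.overlapsAt i) * c (i (Fin.last m))))
    (g' := fun i t => (∏ l, x.reweight (α t) (i l)) * (F (x.overlapsAt i) * c (i (Fin.last m)) *
        ∑ l, (α' t (i l) - ∑' k, x.reweight (α t) k * α' t k)))
    ((hasSum_prod_weight_mul_exp h 3 (m + 1)).summable.mul_left
      (2 * (m + 1) * B * C * x.expAverage 2 p ^ (m + 3))) hI hI' (fun i s hs => ?_)
    (fun i s hs => abs_replicaSumDeriv_term_le h hx hF (ha s hs) (hb s hs) hc i) ht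
    (x.summable_replicaSum hF (x.reweight_nonneg _) (x.summable_reweight _)
      (h.summable_reweight_mul hx (ha t ht) hc)) ht
  have h1 := (HasDerivAt.fun_finsetProd (u := Finset.univ) fun l _ =>
    hasDerivAt_reweight h hx hI hI' hα ha hb hs (i l)).mul_const
      (F (x.overlapsAt i) * c (i (Fin.last m)))
  refine h1.congr_deriv ?_
  have e : ∀ l, (∏ k ∈ Finset.univ.erase l, x.reweight (α s) (i k)) •
      (x.reweight (α s) (i l) * (α' s (i l) - ∑' k, x.reweight (α s) k * α' s k)) =
      (∏ k, x.reweight (α s) (i k)) * (α' s (i l) - ∑' k, x.reweight (α s) k * α' s k) := by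
    intro l
    rw [← Finset.mul_prod_erase _ _ (Finset.mem_univ l), smul_eq_mul]
    ring
  simp only [e, ← Finset.mul_sum]
  ring

end Deterministic

end OverlapStructure

/-! ### Taylor bounds and linear growth of the increments. -/

section EvolutionFunction

variable {ψ : ℝ → ℝ}

lemma IsEvolutionFunction.differentiable (hψ : IsEvolutionFunction ψ) : Differentiable ℝ ψ :=
  hψ.contDiff.differentiable (by norm_num)

lemma IsEvolutionFunction.differentiable_deriv (hψ : IsEvolutionFunction ψ) :
    Differentiable ℝ (deriv ψ) := by
  have h : ContDiff ℝ (1 + 1) ψ := hψ.contDiff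
  exact ((contDiff_succ_iff_deriv.1 h).2.2).differentiable (by norm_num)

lemma abs_sub_le_of_abs_deriv_le {f : ℝ → ℝ} {K : ℝ} (hf : Differentiable ℝ f)
    (hK : ∀ x, |deriv f x| ≤ K) (u v : ℝ) : |f v - f u| ≤ K * |v - u| :=
  convex_univ.norm_image_sub_le_of_norm_deriv_le (fun x _ => hf x) (fun x _ => hK x)
    (Set.mem_univ u) (Set.mem_univ v)

/-- The mean value inequality for `s ↦ f (s + h) - f' (h) s` between `0` and `u`, where its
derivative is at most `K |u|`. -/
lemma abs_sub_sub_mul_le_sq {f : ℝ → ℝ} {K : ℝ} (hf : Differentiable ℝ f)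
    (hf' : Differentiable ℝ (deriv f)) (hK : ∀ x, |deriv (deriv f) x| ≤ K) (h u : ℝ) :
    |f (u + h) - f h - deriv f h * u| ≤ K * u ^ 2 := by
  have hd : ∀ s, HasDerivAt (fun s => f (s + h) - deriv f h * s) (deriv f (s + h) - deriv f h) s :=
    fun s => by
      have h1 : HasDerivAt (fun s => f (s + h)) (deriv f (s + h)) s :=
        (hf (s + h)).hasDerivAt.comp_add_const s h
      exact (h1.sub ((hasDerivAt_id s).const_mul (deriv f h))).congr_deriv (by simp)
  have hb : ∀ s ∈ Set.uIcc 0 u, ‖deriv f (s + h) - deriv f h‖ ≤ K * |u| := fun s hs => by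
    have h1 := abs_sub_le_of_abs_deriv_le hf' hK h (s + h)
    have h2 : |s| ≤ |u| := by simpa using Set.abs_sub_left_of_mem_uIcc hs
    have h3 : 0 ≤ K := (abs_nonneg _).trans (hK 0)
    rw [add_sub_cancel_right] at h1
    exact h1.trans (mul_le_mul_of_nonneg_left h2 h3)
  have := (convex_uIcc 0 u).norm_image_sub_le_of_norm_hasDerivWithin_le
    (fun s _ => (hd s).hasDerivWithinAt) hb Set.left_mem_uIcc Set.right_mem_uIcc
  rw [Real.norm_eq_abs, Real.norm_eq_abs, sub_zero, mul_assoc, abs_mul_abs_self] at this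
  refine le_trans (le_of_eq ?_) (this.trans_eq (by ring))
  congr 1
  simp
  ring

lemma abs_evolutionFunction_le {K : ℝ} (hψ : IsEvolutionFunction ψ) (hK : ∀ x, |deriv ψ x| ≤ K)
    (h β y : ℝ) : |ψ (β * y + h)| ≤ |ψ h| + K * |β| * |y| := by
  have h1 := abs_sub_le_of_abs_deriv_le hψ.differentiable hK h (β * y + h)
  rw [add_sub_cancel_right, abs_mul] at h1
  have h2 := abs_sub_abs_le_abs_sub (ψ (β * y + h)) (ψ h)
  linarith

lemma IsEvolutionFunction.hasLinearGrowth_pair (hψ : IsEvolutionFunction ψ) (h β γ : ℝ) :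
    HasLinearGrowth fun y => (ψ (β * y + h), ψ (γ * y + h)) := by
  obtain ⟨K, hK⟩ := hψ.bounded_deriv
  have hm := hψ.differentiable.continuous.measurable
  have hK0 : 0 ≤ K := (abs_nonneg _).trans (hK 0)
  refine ⟨by fun_prop, |ψ h|, K * (|β| + |γ|), fun y => ?_⟩
  rw [Prod.norm_def]
  refine max_le ((abs_evolutionFunction_le hψ hK h β y).trans ?_)
    ((abs_evolutionFunction_le hψ hK h γ y).trans ?_)
  · gcongr; exact le_add_of_nonneg_right (abs_nonneg _)
  · gcongr; exact le_add_of_nonneg_left (abs_nonneg _)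

/-- An affine function of `|y|` that dominates the increments and their speeds. -/
noncomputable def growthBound (C y : ℝ) : ℝ := C * (1 + |y|)

lemma growthBound_nonneg {C : ℝ} (hC : 1 ≤ C) (y : ℝ) : 0 ≤ growthBound C y := by
  unfold growthBound; positivity

lemma hasLinearGrowth_growthBound {C : ℝ} (hC : 1 ≤ C) : HasLinearGrowth (growthBound C) := by
  refine ⟨by unfold growthBound; fun_prop, C, C, fun y => ?_⟩
  rw [Real.norm_of_nonneg (growthBound_nonneg hC y), growthBound]
  linarith

lemma one_add_sq_le_exp_growthBound {C : ℝ} (hC : 1 ≤ C) (y : ℝ) :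
    1 + y ^ 2 ≤ 2 * Real.exp ‖growthBound C y‖ := by
  rw [Real.norm_of_nonneg (growthBound_nonneg hC y)]
  have h1 : 1 + |y| ≤ growthBound C y := by
    unfold growthBound
    exact le_mul_of_one_le_left (by positivity) hC
  have h2 := Real.quadratic_le_exp_of_nonneg (growthBound_nonneg hC y)
  have h3 : (1 + |y|) ^ 2 ≤ growthBound C y ^ 2 := by gcongr
  have h4 := abs_nonneg y
  nlinarith [sq_abs y]

end EvolutionFunction

/-! ### Exponential moments of functions of the Gaussian field. -/

section GaussianField

variable {P : Measure OverlapStructure} [IsProbabilityMeasure P] {θ : ℝ → ℝ} {r : ℕ}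

lemma compProd_walkKernel_one (hθ : Measurable θ) : P ⊗ₘ walkKernel θ r 1 =
    (P ⊗ₘ gaussianFieldKernel r).map (Prod.map id fun κ i => θ (κ i)) := by
  rw [walkKernel_one, incrementKernel, Measure.compProd_map (measurable_pi_comp hθ)]

lemma integrable_expAverage_gaussian (hθ : HasLinearGrowth θ) {t : ℝ} (ht : 0 ≤ t) :
    Integrable (fun z : OverlapStructure × (ℕ → ℝ) => z.1.expAverage t fun i => θ (z.2 i))
      (P ⊗ₘ gaussianFieldKernel r) := by
  have h := integrable_expAverage_compProd hθ r 1 P ht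
  rw [compProd_walkKernel_one hθ.measurable] at h
  exact (integrable_map_measure (measurable_expAverage t).aestronglyMeasurable
    (measurable_id.prodMap (measurable_pi_comp hθ.measurable)).aemeasurable).1 h

lemma ae_gaussian_isProper_hasExpMoments (hθ : HasLinearGrowth θ) (hP : ∀ᵐ x ∂P, x.IsProper) :
    ∀ᵐ z ∂(P ⊗ₘ gaussianFieldKernel r), z.1.IsProper ∧ z.1.HasExpMoments fun i => θ (z.2 i) := by
  have h := ae_compProd_isProper_hasExpMoments hθ r 1 hP
  rw [compProd_walkKernel_one hθ.measurable] at h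
  exact ae_of_ae_map (measurable_id.prodMap (measurable_pi_comp hθ.measurable)).aemeasurable h

end GaussianField

/-! ### Differentiation of tilted averages in the inverse temperature. -/

section TiltedAverage

variable {m : ℕ} {F : (Fin (m + 1) → Fin (m + 1) → ℝ) → ℝ} {B : ℝ}
  {P : Measure OverlapStructure} [IsProbabilityMeasure P] {ψ f : ℝ → ℝ} {h : ℝ} {r : ℕ}

/-- The average of `F` times a function `f` of the field at the last point, over points sampled
from the weights tilted by the increments `ψ (t * κ + h)`. -/
noncomputable def tiltedAverage (P : Measure OverlapStructure) (ψ : ℝ → ℝ) (h : ℝ) (r : ℕ)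
    (F : (Fin (m + 1) → Fin (m + 1) → ℝ) → ℝ) (f : ℝ → ℝ) (t : ℝ) : ℝ :=
  ∫ z, z.1.replicaSum (z.1.reweight fun j => ψ (t * z.2 j + h)) F (fun j => f (z.2 j))
    ∂(P ⊗ₘ gaussianFieldKernel r)

lemma measurable_tilted (hψ : Measurable ψ) (hF : Measurable F) (hf : Measurable f) (t : ℝ) :
    Measurable fun z : OverlapStructure × (ℕ → ℝ) =>
      z.1.replicaSum (z.1.reweight fun j => ψ (t * z.2 j + h)) F fun j => f (z.2 j) :=
  measurable_replicaSum hF measurable_fst (measurable_reweight_comp measurable_fst (by fun_prop))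
    (by fun_prop)

/-- The constant of the dominating affine function. -/
noncomputable def growthConst (ψ : ℝ → ℝ) (h K : ℝ) : ℝ := 1 + |ψ h| + K

lemma abs_increment_le {K : ℝ} (hψ : IsEvolutionFunction ψ) (hK : ∀ x, |deriv ψ x| ≤ K) {t : ℝ}
    (ht : t ∈ Metric.ball (0 : ℝ) 1) (y : ℝ) :
    |ψ (t * y + h)| ≤ ‖growthBound (growthConst ψ h K) y‖ ∧
      |deriv ψ (t * y + h) * y| ≤ Real.exp ‖growthBound (growthConst ψ h K) y‖ := by
  have hK0 : 0 ≤ K := (abs_nonneg _).trans (hK 0)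
  have hC : 1 ≤ growthConst ψ h K := by
    unfold growthConst
    linarith [abs_nonneg (ψ h)]
  rw [Real.norm_of_nonneg (growthBound_nonneg hC y)]
  have ht' : |t| ≤ 1 := by simpa using (mem_ball_zero_iff.1 ht).le
  have h1 := abs_evolutionFunction_le hψ hK h t y
  have h2 : K * |t| * |y| ≤ K * |y| := by
    rw [mul_assoc]
    exact mul_le_mul_of_nonneg_left (mul_le_of_le_one_left (abs_nonneg _) ht') hK0
  have h3 : |ψ h| + K * |y| ≤ growthBound (growthConst ψ h K) y := by
    unfold growthBound growthConst
    nlinarith [abs_nonneg (ψ h), abs_nonneg y, mul_nonneg (abs_nonneg (ψ h)) (abs_nonneg y)]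
  have h4 := Real.add_one_le_exp (growthBound (growthConst ψ h K) y)
  refine ⟨by linarith, ?_⟩
  rw [abs_mul]
  have h5 := mul_le_mul_of_nonneg_right (hK (t * y + h)) (abs_nonneg y)
  linarith [abs_nonneg (ψ h)]

lemma hasDerivAt_increment (hψ : IsEvolutionFunction ψ) (t y : ℝ) :
    HasDerivAt (fun t => ψ (t * y + h)) (deriv ψ (t * y + h) * y) t := by
  have h1 : HasDerivAt (fun t => t * y + h) y t := by
    simpa using ((hasDerivAt_id t).mul_const y).add_const h
  exact (hψ.differentiable (t * y + h)).hasDerivAt.comp t h1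

/-- The constants in the estimates of tilted averages. -/
noncomputable def tiltBound (m : ℕ) (ψ : ℝ → ℝ) (h K B : ℝ) (z : OverlapStructure × (ℕ → ℝ)) : ℝ :=
  4 * (m + 1) * B * z.1.expAverage ((2 * m + 4 : ℕ) * 3)
    fun j => growthBound (growthConst ψ h K) (z.2 j)

lemma one_le_growthConst {K : ℝ} (hK : ∀ x, |deriv ψ x| ≤ K) : 1 ≤ growthConst ψ h K := by
  have hK0 : 0 ≤ K := (abs_nonneg _).trans (hK 0)
  unfold growthConst
  linarith [abs_nonneg (ψ h)]

lemma integrable_tiltBound {K : ℝ} (hK : ∀ x, |deriv ψ x| ≤ K) :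
    Integrable (tiltBound m ψ h K B) (P ⊗ₘ gaussianFieldKernel r) :=
  (integrable_expAverage_gaussian (hasLinearGrowth_growthBound (one_le_growthConst hK))
    (by positivity)).const_mul _

/-- The exceptional null set depends neither on `t` nor on `f`, and the bound does not depend on
`t`, as differentiation under the integral requires. The bound is linear in `D`, which keeps track
of the size of the Taylor remainder. -/
lemma ae_tilted {K : ℝ} (hψ : IsEvolutionFunction ψ) (hK : ∀ x, |deriv ψ x| ≤ K)
    (hP : ∀ᵐ x ∂P, x.IsProper) (hFB : ∀ q, |F q| ≤ B) :
    ∀ᵐ z ∂(P ⊗ₘ gaussianFieldKernel r), z.1.IsProper ∧ ∀ (f : ℝ → ℝ) (D : ℝ),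
      (∀ y, |f y| ≤ D * (1 + y ^ 2)) →
      ∀ t ∈ Metric.ball (0 : ℝ) 1,
        HasDerivAt (fun t => z.1.replicaSum (z.1.reweight fun j => ψ (t * z.2 j + h)) F
          fun j => f (z.2 j))
          (z.1.replicaSumDeriv (z.1.reweight fun j => ψ (t * z.2 j + h)) F (fun j => f (z.2 j))
            fun j => deriv ψ (t * z.2 j + h) * z.2 j) t ∧
        |z.1.replicaSumDeriv (z.1.reweight fun j => ψ (t * z.2 j + h)) F (fun j => f (z.2 j))
            fun j => deriv ψ (t * z.2 j + h) * z.2 j| ≤ D * tiltBound m ψ h K B z ∧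
        |z.1.replicaSum (z.1.reweight fun j => ψ (t * z.2 j + h)) F
          fun j => f (z.2 j)| ≤ D * tiltBound m ψ h K B z := by
  have hC := one_le_growthConst (h := h) hK
  filter_upwards [ae_gaussian_isProper_hasExpMoments (r := r) (hasLinearGrowth_growthBound hC) hP]
    with z hz
  refine ⟨hz.1, fun f D hf t ht => ?_⟩
  have hB : 0 ≤ B := (abs_nonneg _).trans (hFB 0)
  have hD : 0 ≤ D := by
    have := (abs_nonneg _).trans (hf 0)
    simpa using this
  have hc : ∀ j, |f (z.2 j)| ≤ (D * 2) * Real.exp ‖growthBound (growthConst ψ h K) (z.2 j)‖ :=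
    fun j => (hf _).trans (by
      rw [mul_assoc]
      exact mul_le_mul_of_nonneg_left (one_add_sq_le_exp_growthBound hC _) hD)
  refine ⟨hasDerivAt_replicaSum (α' := fun t j => deriv ψ (t * z.2 j + h) * z.2 j)
    hz.2 hz.1 Metric.isOpen_ball
    (convex_ball (0 : ℝ) 1).isPreconnected (fun t _ j => hasDerivAt_increment hψ t (z.2 j))
    (fun t ht j => (abs_increment_le hψ hK ht _).1)
    (fun t ht j => (abs_increment_le hψ hK ht _).2) hFB hc ht, ?_, ?_⟩
  · refine (abs_replicaSumDeriv_le hz.2 hz.1 hFB (fun j => (abs_increment_le hψ hK ht _).1)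
      (fun j => (abs_increment_le hψ hK ht _).2) hc).trans (le_of_eq ?_)
    unfold tiltBound
    ring
  · refine (hz.2.abs_replicaSum_le hz.1 hFB (fun j => (abs_increment_le hψ hK ht _).1) hc).trans ?_
    have h1 := hz.2.expAverage_mono (t := 4) (u := (2 * m + 4 : ℕ) * 3) (by push_cast; nlinarith [Nat.cast_nonneg (α := ℝ) m])
    have h2 := z.1.expAverage_nonneg 4 fun j => growthBound (growthConst ψ h K) (z.2 j)
    unfold tiltBound
    calc _ ≤ B * (D * 2) * z.1.expAverage ((2 * m + 4 : ℕ) * 3)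
          fun j => growthBound (growthConst ψ h K) (z.2 j) := by gcongr
      _ ≤ (D * (4 * (m + 1) * B)) * z.1.expAverage ((2 * m + 4 : ℕ) * 3)
          fun j => growthBound (growthConst ψ h K) (z.2 j) := by
          refine mul_le_mul_of_nonneg_right ?_ (h2.trans h1)
          nlinarith [mul_nonneg hB hD, mul_nonneg (mul_nonneg hB hD) (Nat.cast_nonneg (α := ℝ) m)]
      _ = _ := by ring

lemma integrable_tilted (hψ : IsEvolutionFunction ψ)
    (hP : ∀ᵐ x ∂P, x.IsProper) (hF : Measurable F) (hFB : ∀ q, |F q| ≤ B) (hf : Measurable f)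
    {D : ℝ} (hfD : ∀ y, |f y| ≤ D * (1 + y ^ 2)) {t : ℝ} (ht : t ∈ Metric.ball (0 : ℝ) 1) :
    Integrable (fun z : OverlapStructure × (ℕ → ℝ) =>
      z.1.replicaSum (z.1.reweight fun j => ψ (t * z.2 j + h)) F fun j => f (z.2 j))
      (P ⊗ₘ gaussianFieldKernel r) := by
  obtain ⟨K, hK⟩ := hψ.bounded_deriv
  refine ((integrable_tiltBound (m := m) (B := B) (h := h) hK).const_mul D).mono'
    (measurable_tilted hψ.differentiable.continuous.measurable hF hf t).aestronglyMeasurable ?_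
  filter_upwards [ae_tilted (r := r) (h := h) hψ hK hP hFB] with z hz
  exact (hz.2 f D hfD t ht).2.2

lemma hasDerivAt_tiltedAverage (hψ : IsEvolutionFunction ψ)
    (hP : ∀ᵐ x ∂P, x.IsProper) (hF : Measurable F) (hFB : ∀ q, |F q| ≤ B) (hf : Measurable f)
    {D : ℝ} (hfD : ∀ y, |f y| ≤ D * (1 + y ^ 2)) :
    Integrable (fun z : OverlapStructure × (ℕ → ℝ) =>
      z.1.replicaSumDeriv z.1.weight F (fun j => f (z.2 j)) fun j => deriv ψ h * z.2 j)
      (P ⊗ₘ gaussianFieldKernel r) ∧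
    HasDerivAt (tiltedAverage P ψ h r F f)
      (∫ z, z.1.replicaSumDeriv z.1.weight F (fun j => f (z.2 j)) (fun j => deriv ψ h * z.2 j)
        ∂(P ⊗ₘ gaussianFieldKernel r)) 0 := by
  obtain ⟨K, hK⟩ := hψ.bounded_deriv
  have h0 : (0 : ℝ) ∈ Metric.ball (0 : ℝ) 1 := Metric.mem_ball_self one_pos
  have hae := ae_tilted (r := r) (h := h) hψ hK hP hFB
  have hw : ∀ᵐ z ∂(P ⊗ₘ gaussianFieldKernel r),
      z.1.replicaSumDeriv (z.1.reweight fun j => ψ (0 * z.2 j + h)) F (fun j => f (z.2 j))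
            (fun j => deriv ψ (0 * z.2 j + h) * z.2 j) =
      z.1.replicaSumDeriv z.1.weight F (fun j => f (z.2 j)) fun j => deriv ψ h * z.2 j := by
    filter_upwards [hae] with z hz
    -- At `t = 0` all increments equal `ψ h` and cancel in the normalization.
    have : (z.1.reweight fun j => ψ (0 * z.2 j + h)) = z.1.weight := by
      have hz1 : ∑' j, z.1.weight j = 1 := hz.1
      ext j
      simp [reweight, tsum_mul_right, hz1]
    rw [this]
    simp
  have hm : Measurable fun z : OverlapStructure × (ℕ → ℝ) =>
      z.1.replicaSumDeriv (z.1.reweight fun j => ψ (0 * z.2 j + h)) F (fun j => f (z.2 j))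
            fun j => deriv ψ (0 * z.2 j + h) * z.2 j := by
    have hψm := hψ.differentiable.continuous.measurable
    have hrw : Measurable fun z : OverlapStructure × (ℕ → ℝ) =>
        z.1.reweight fun j => ψ (0 * z.2 j + h) :=
      measurable_reweight_comp measurable_fst (by fun_prop)
    unfold replicaSumDeriv
    refine Measurable.tsum fun i => ?_
    refine Measurable.mul ?_ (Measurable.mul (Measurable.mul ?_ ?_) ?_)
    · exact Finset.measurable_prod _ fun l _ => (measurable_pi_apply _).comp hrw
    · exact hF.comp ((measurable_overlapsAt i).comp measurable_fst)
    · fun_prop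
    · refine Finset.measurable_sum _ fun l _ => Measurable.sub (by fun_prop) ?_
      refine Measurable.tsum fun k => Measurable.mul ?_ (by fun_prop)
      exact (measurable_pi_apply k).comp hrw
  have := hasDerivAt_integral_of_dominated_loc_of_deriv_le (μ := P ⊗ₘ gaussianFieldKernel r)
    (F := fun t z => z.1.replicaSum (z.1.reweight fun j => ψ (t * z.2 j + h)) F
      fun j => f (z.2 j))
    (F' := fun t z => z.1.replicaSumDeriv (z.1.reweight fun j => ψ (t * z.2 j + h)) F
      (fun j => f (z.2 j)) fun j => deriv ψ (t * z.2 j + h) * z.2 j)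
    (x₀ := 0) (bound := fun z => D * tiltBound m ψ h K B z)
    (Metric.ball_mem_nhds 0 one_pos)
    (Filter.Eventually.of_forall fun t =>
      (measurable_tilted hψ.differentiable.continuous.measurable hF hf t).aestronglyMeasurable)
    (integrable_tilted hψ hP hF hFB hf hfD h0) hm.aestronglyMeasurable
    (hae.mono fun z hz t ht => (hz.2 f D hfD t ht).2.1)
    ((integrable_tiltBound hK).const_mul D)
    (hae.mono fun z hz t ht => (hz.2 f D hfD t ht).1)
  refine ⟨this.1.congr hw, ?_⟩
  rw [← integral_congr_ae hw]
  exact this.2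

/-- The constant is uniform in `f`, which enters only through `D`. For a Taylor remainder with `D`
of order `t²`, tilting therefore changes its average by order `t³`. -/
lemma exists_tiltedAverage_sub_le (hψ : IsEvolutionFunction ψ) (h : ℝ) (r : ℕ)
    (hP : ∀ᵐ x ∂P, x.IsProper) (hF : Measurable F) (hFB : ∀ q, |F q| ≤ B) :
    ∃ C, ∀ (f : ℝ → ℝ) (D : ℝ), Measurable f → (∀ y, |f y| ≤ D * (1 + y ^ 2)) →
      ∀ t ∈ Metric.ball (0 : ℝ) 1,
        |tiltedAverage P ψ h r F f t - tiltedAverage P ψ h r F f 0| ≤ C * D * |t| := by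
  obtain ⟨K, hK⟩ := hψ.bounded_deriv
  have h0 : (0 : ℝ) ∈ Metric.ball (0 : ℝ) 1 := Metric.mem_ball_self one_pos
  refine ⟨∫ z, tiltBound m ψ h K B z ∂(P ⊗ₘ gaussianFieldKernel r), fun f D hf hfD t ht => ?_⟩
  rw [tiltedAverage, tiltedAverage, ← integral_sub (integrable_tilted hψ hP hF hFB hf hfD ht)
    (integrable_tilted hψ hP hF hFB hf hfD h0), ← Real.norm_eq_abs]
  have hI := ((integrable_tiltBound (P := P) (r := r) (m := m) (B := B) (h := h) hK).const_mul
    D).mul_const |t|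
  refine (norm_integral_le_of_norm_le hI ?_).trans (le_of_eq ?_)
  · filter_upwards [ae_tilted (r := r) (h := h) hψ hK hP hFB] with z hz
    have := (convex_ball (0 : ℝ) 1).norm_image_sub_le_of_norm_hasDerivWithin_le
      (fun s hs => (hz.2 f D hfD s hs).1.hasDerivWithinAt)
      (fun s hs => (hz.2 f D hfD s hs).2.1) h0 ht
    simpa using this
  · rw [integral_mul_const, integral_const_mul]
    ring

end TiltedAverage

/-! ### Calculus of sampled expectations. -/

section ReplicaAverage

variable {P : Measure OverlapStructure} [IsProbabilityMeasure P] {s : ℕ} {r : ℕ}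

/-- The average of a function of the overlaps over points sampled from the weights. -/
noncomputable def replicaAverage (H : (Fin s → Fin s → ℝ) → ℝ) (x : OverlapStructure) : ℝ :=
  ∑' i : Fin s → ℕ, (∏ l, x.weight (i l)) * H (x.overlapsAt i)

lemma sampledExpectation_eq (H : (Fin s → Fin s → ℝ) → ℝ) :
    sampledExpectation P s H = ∫ x, replicaAverage H x ∂P := rfl

lemma sampleAverage_eq_replicaAverage {m : ℕ} (F : (Fin (m + 1) → Fin (m + 1) → ℝ) → ℝ) :
    sampleAverage F = replicaAverage F := by
  ext x
  simp [sampleAverage, replicaAverage, replicaSum]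

lemma prod_weight_nonneg (x : OverlapStructure) (i : Fin s → ℕ) : 0 ≤ ∏ l, x.weight (i l) :=
  Finset.prod_nonneg fun _ _ => x.weight_nonneg _

lemma hasSum_prod_weight (x : OverlapStructure) (s : ℕ) :
    HasSum (fun i : Fin s → ℕ => ∏ l, x.weight (i l)) ((∑' j, x.weight j) ^ s) := by
  have := hasSum_pi_prod (s := s) (f := fun _ j => x.weight j) (fun _ j => x.weight_nonneg _)
    fun _ => x.summable_weight
  simpa using this

variable {H H' : (Fin s → Fin s → ℝ) → ℝ} {B B' : ℝ}

/-- Boundedness is required only on overlaps of actual structures, because powers of an arbitrary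
real array are not bounded. -/
lemma summable_replicaAverage (hB : ∀ (x : OverlapStructure) (i : Fin s → ℕ),
    |H (x.overlapsAt i)| ≤ B) (x : OverlapStructure) :
    Summable fun i : Fin s → ℕ => (∏ l, x.weight (i l)) * H (x.overlapsAt i) := by
  refine ((hasSum_prod_weight x s).summable.mul_right B).of_norm_bounded fun i => ?_
  rw [norm_mul, Real.norm_of_nonneg (prod_weight_nonneg x i)]
  exact mul_le_mul_of_nonneg_left (hB x i) (prod_weight_nonneg x i)

lemma measurable_replicaAverage (hH : Measurable H) : Measurable (replicaAverage H) := by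
  refine Measurable.tsum fun i => Measurable.mul ?_ (hH.comp (measurable_overlapsAt i))
  exact Finset.measurable_prod _ fun l _ => measurable_weight _

lemma integrable_replicaAverage (hH : Measurable H) (hB : ∀ (x : OverlapStructure)
    (i : Fin s → ℕ), |H (x.overlapsAt i)| ≤ B) : Integrable (replicaAverage H) P := by
  refine Integrable.of_bound (measurable_replicaAverage hH).aestronglyMeasurable |B|
    (Filter.Eventually.of_forall fun x => ?_)
  have h1 : ‖replicaAverage H x‖ ≤ (∑' j, x.weight j) ^ s * |B| := by
    refine tsum_of_norm_bounded ((hasSum_prod_weight x s).mul_right |B|) fun i => ?_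
    rw [norm_mul, Real.norm_of_nonneg (prod_weight_nonneg x i)]
    exact mul_le_mul_of_nonneg_left ((hB x i).trans (le_abs_self B)) (prod_weight_nonneg x i)
  refine h1.trans (mul_le_of_le_one_left (abs_nonneg _) (pow_le_one₀ ?_ x.tsum_weight_le_one))
  exact tsum_nonneg x.weight_nonneg

lemma sampledExpectation_const_mul (c : ℝ) (H : (Fin s → Fin s → ℝ) → ℝ) :
    sampledExpectation P s (fun q => c * H q) = c * sampledExpectation P s H := by
  rw [sampledExpectation_eq, sampledExpectation_eq, ← integral_const_mul]
  refine integral_congr_ae (Filter.Eventually.of_forall fun x => ?_)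
  simp only [replicaAverage, ← tsum_mul_left]
  exact tsum_congr fun i => by ring

lemma sampledExpectation_add (hH : Measurable H) (hB : ∀ (x : OverlapStructure)
    (i : Fin s → ℕ), |H (x.overlapsAt i)| ≤ B) (hH' : Measurable H')
    (hB' : ∀ (x : OverlapStructure) (i : Fin s → ℕ), |H' (x.overlapsAt i)| ≤ B') :
    sampledExpectation P s (fun q => H q + H' q) =
      sampledExpectation P s H + sampledExpectation P s H' := by
  rw [sampledExpectation_eq, sampledExpectation_eq, sampledExpectation_eq,
    ← integral_add (integrable_replicaAverage hH hB) (integrable_replicaAverage hH' hB')]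
  refine integral_congr_ae (Filter.Eventually.of_forall fun x => ?_)
  simp only [replicaAverage]
  rw [← (summable_replicaAverage hB x).tsum_add (summable_replicaAverage hB' x)]
  exact tsum_congr fun i => by ring

lemma sampledExpectation_sum {ι : Type*} (A : Finset ι) {H : ι → (Fin s → Fin s → ℝ) → ℝ}
    (hH : ∀ a, Measurable (H a))
    (hB : ∀ a (x : OverlapStructure) (i : Fin s → ℕ), |H a (x.overlapsAt i)| ≤ B) :
    sampledExpectation P s (fun q => ∑ a ∈ A, H a q) = ∑ a ∈ A, sampledExpectation P s (H a) := by
  simp only [sampledExpectation_eq]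
  rw [← integral_finsetSum A fun a _ => integrable_replicaAverage (hH a) (hB a)]
  refine integral_congr_ae (Filter.Eventually.of_forall fun x => ?_)
  simp only [replicaAverage, Finset.mul_sum]
  exact Summable.tsum_finsetSum fun a _ => summable_replicaAverage (hB a) x

lemma sampledExpectation_congr (h : ∀ (x : OverlapStructure) (i : Fin s → ℕ),
    H (x.overlapsAt i) = H' (x.overlapsAt i)) :
    sampledExpectation P s H = sampledExpectation P s H' := by
  rw [sampledExpectation_eq, sampledExpectation_eq]
  simp only [replicaAverage, h]

/-- Fubini for the last point. It turns a mean over the weights into one more sampled point. -/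
lemma tsum_prod_weight_snoc (x : OverlapStructure) {G : (Fin s → ℕ) → ℕ → ℝ}
    (hG : Summable fun j : Fin (s + 1) → ℕ =>
      (∏ l, x.weight (j l)) * G (fun l => j l.castSucc) (j (Fin.last s))) :
    ∑' j : Fin (s + 1) → ℕ, (∏ l, x.weight (j l)) * G (fun l => j l.castSucc) (j (Fin.last s)) =
      ∑' i : Fin s → ℕ, (∏ l, x.weight (i l)) * ∑' k, x.weight k * G i k := by
  have e : ∀ z : ℕ × (Fin s → ℕ), (∏ l, x.weight ((Fin.snocEquiv fun _ => ℕ) z l)) *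
      G (fun l => (Fin.snocEquiv fun _ => ℕ) z l.castSucc)
        ((Fin.snocEquiv fun _ => ℕ) z (Fin.last s)) =
      (∏ l, x.weight (z.2 l)) * (x.weight z.1 * G z.2 z.1) := fun z => by
    simp [Fin.snocEquiv, Fin.prod_univ_castSucc]
    ring
  rw [← (Fin.snocEquiv fun _ => ℕ).summable_iff] at hG
  have hG' : Summable fun z : ℕ × (Fin s → ℕ) =>
      (∏ l, x.weight (z.2 l)) * (x.weight z.1 * G z.2 z.1) := hG.congr e
  rw [← (Fin.snocEquiv fun _ => ℕ).tsum_eq fun j : Fin (s + 1) → ℕ =>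
    (∏ l, x.weight (j l)) * G (fun l => j l.castSucc) (j (Fin.last s)), tsum_congr e,
    ← (Equiv.prodComm _ _).tsum_eq]
  have hG2 := (Equiv.prodComm (Fin s → ℕ) ℕ).summable_iff.2 hG'
  refine hG2.tsum_prod.trans ?_
  exact tsum_congr fun i => by rw [← tsum_mul_left]; rfl

lemma sampledExpectation_castSucc (hP : ∀ᵐ x ∂P, x.IsProper)
    (hB : ∀ (x : OverlapStructure) (i : Fin s → ℕ), |H (x.overlapsAt i)| ≤ B) :
    sampledExpectation P (s + 1) (fun q => H fun l l' => q l.castSucc l'.castSucc) =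
      sampledExpectation P s H := by
  rw [sampledExpectation_eq, sampledExpectation_eq]
  refine integral_congr_ae ?_
  filter_upwards [hP] with x hx
  have hx1 : ∑' j, x.weight j = 1 := hx
  have h1 := tsum_prod_weight_snoc x (G := fun i _ => H (x.overlapsAt i))
    (summable_replicaAverage (H := fun q : Fin (s + 1) → Fin (s + 1) → ℝ =>
      H fun l l' => q l.castSucc l'.castSucc) (fun x i => hB x fun l => i l.castSucc) x)
  simp only [tsum_mul_right, hx1, one_mul] at h1
  exact h1

end ReplicaAverage

/-! ### Second moments of the Gaussian field. -/

section FieldMoments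

variable {r : ℕ}

lemma memLp_gaussianFieldKernel (r : ℕ) (x : OverlapStructure) (i : ℕ) :
    MemLp (fun κ : ℕ → ℝ => κ i) 2 (gaussianFieldKernel r x) :=
  (gaussianFieldKernel_spec r x).memLp_two i

lemma integrable_mul_gaussianFieldKernel (r : ℕ) (x : OverlapStructure) (i j : ℕ) :
    Integrable (fun κ : ℕ → ℝ => κ i * κ j) (gaussianFieldKernel r x) :=
  (memLp_gaussianFieldKernel r x i).integrable_mul (memLp_gaussianFieldKernel r x j)

lemma integral_mul_gaussianFieldKernel (r : ℕ) (x : OverlapStructure) (i j : ℕ) :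
    ∫ κ, κ i * κ j ∂gaussianFieldKernel r x = x.overlap i j ^ r := by
  have h := gaussianFieldKernel_spec r x
  have h1 := covariance_eq_sub (memLp_gaussianFieldKernel r x i) (memLp_gaussianFieldKernel r x j)
  rw [h.covariance_eq, h.mean_zero, zero_mul, sub_zero] at h1
  exact h1.symm

lemma overlap_self (x : OverlapStructure) (i : ℕ) : x.overlap i i = 1 := x.2.2.2.2.2.2 i

lemma integral_abs_mul_gaussianFieldKernel_le (r : ℕ) (x : OverlapStructure) (i j : ℕ) :
    ∫ κ, |κ i * κ j| ∂gaussianFieldKernel r x ≤ 1 := by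
  have hi := integrable_mul_gaussianFieldKernel r x i i
  have hj := integrable_mul_gaussianFieldKernel r x j j
  have h1 : ∫ κ, |κ i * κ j| ∂gaussianFieldKernel r x ≤
      ∫ κ, 2⁻¹ * (κ i * κ i + κ j * κ j) ∂gaussianFieldKernel r x := by
    refine integral_mono (integrable_mul_gaussianFieldKernel r x i j).abs
      ((hi.add hj).const_mul _) fun κ => ?_
    simp only [abs_mul]
    nlinarith [sq_nonneg (|κ i| - |κ j|), abs_mul_abs_self (κ i), abs_mul_abs_self (κ j)]
  rw [integral_const_mul, integral_add hi hj, integral_mul_gaussianFieldKernel,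
    integral_mul_gaussianFieldKernel, overlap_self, overlap_self] at h1
  norm_num at h1
  simpa only [abs_mul] using h1

/-- The power is a covariance of two Gaussian variables of unit variance. -/
lemma abs_overlap_pow_le (x : OverlapStructure) (i j r : ℕ) : |x.overlap i j ^ r| ≤ 1 := by
  rw [← integral_mul_gaussianFieldKernel]
  exact abs_integral_le_integral_abs.trans (integral_abs_mul_gaussianFieldKernel_le r x i j)

lemma integral_gaussianFieldKernel_eval (r : ℕ) (x : OverlapStructure) (i : ℕ) {f : ℝ → ℝ}
    (hf : Measurable f) : ∫ κ, f (κ i) ∂gaussianFieldKernel r x = ∫ y, f y ∂gaussianReal 0 1 := by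
  rw [← gaussianFieldKernel_map_eval r x i,
    integral_map (measurable_pi_apply i).aemeasurable hf.aestronglyMeasurable]

lemma integrable_gaussianFieldKernel_eval (r : ℕ) (x : OverlapStructure) (i : ℕ) {f : ℝ → ℝ}
    (hf : Integrable f (gaussianReal 0 1)) :
    Integrable (fun κ : ℕ → ℝ => f (κ i)) (gaussianFieldKernel r x) := by
  rw [← gaussianFieldKernel_map_eval r x i] at hf
  exact (integrable_map_measure hf.1 (measurable_pi_apply i).aemeasurable).1 hf

lemma integral_tsum_mul {ι Ω : Type*} [Countable ι] [MeasurableSpace Ω] {ν : Measure Ω}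
    {u : ι → ℝ} (hu : ∀ i, 0 ≤ u i) (hs : Summable u) {G : ι → Ω → ℝ}
    (hG : ∀ i, Integrable (G i) ν) {C : ℝ} (hC : ∀ i, ∫ a, |G i a| ∂ν ≤ C) :
    ∫ a, ∑' i, u i * G i a ∂ν = ∑' i, u i * ∫ a, G i a ∂ν := by
  have h1 := hasSum_integral_of_summable_integral_norm (F := fun i a => u i * G i a)
    (fun i => (hG i).const_mul (u i)) ?_
  · rw [← h1.tsum_eq]
    exact tsum_congr fun i => integral_const_mul _ _
  · refine (hs.mul_right C).of_nonneg_of_le (fun i => integral_nonneg fun a => norm_nonneg _)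
      fun i => ?_
    simp only [norm_mul, Real.norm_of_nonneg (hu i), integral_const_mul]
    exact mul_le_mul_of_nonneg_left (hC i) (hu i)

end FieldMoments

/-! ### First order expansion at inverse temperature zero. -/

section Expansion

variable {m : ℕ} {F : (Fin (m + 1) → Fin (m + 1) → ℝ) → ℝ} {B : ℝ}
  {P : Measure OverlapStructure} [IsProbabilityMeasure P] {ψ f : ℝ → ℝ} {h : ℝ} {r : ℕ}

lemma integrable_one_add_sq_gaussianReal :
    Integrable (fun y : ℝ => 1 + y ^ 2) (gaussianReal 0 1) := by
  refine ((integrable_exp_abs_gaussianReal 1).const_mul (2 * Real.exp 1)).mono' (by fun_prop)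
    (Filter.Eventually.of_forall fun y => ?_)
  have h1 := one_add_sq_le_exp_growthBound le_rfl y
  rw [Real.norm_of_nonneg (growthBound_nonneg le_rfl y), growthBound, one_mul, Real.exp_add] at h1
  rw [Real.norm_of_nonneg (by positivity), one_mul]
  linarith

/-- The tilt is trivial at `0`, and the field at a given particle is standard Gaussian whatever the
overlaps are, so `f` factors out of the average. -/
lemma tiltedAverage_zero (hψ : IsEvolutionFunction ψ) (h : ℝ) (r : ℕ)
    (hP : ∀ᵐ x ∂P, x.IsProper) (hF : Measurable F) (hFB : ∀ q, |F q| ≤ B) (hf : Measurable f)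
    {D : ℝ} (hfD : ∀ y, |f y| ≤ D * (1 + y ^ 2)) :
    tiltedAverage P ψ h r F f 0 = (∫ y, f y ∂gaussianReal 0 1) * sampledExpectation P (m + 1) F := by
  have hfi : Integrable f (gaussianReal 0 1) :=
    (integrable_one_add_sq_gaussianReal.const_mul D).mono' hf.aestronglyMeasurable
      (Filter.Eventually.of_forall hfD)
  have hB : 0 ≤ B := (abs_nonneg _).trans (hFB 0)
  rw [tiltedAverage, Measure.integral_compProd
    (integrable_tilted hψ hP hF hFB hf hfD (Metric.mem_ball_self one_pos)),
    sampledExpectation_eq, ← integral_const_mul]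
  refine integral_congr_ae ?_
  filter_upwards [hP] with x hx
  have hx1 : ∑' j, x.weight j = 1 := hx
  have hw : ∀ κ : ℕ → ℝ, (x.reweight fun j => ψ (0 * κ j + h)) = x.weight := fun κ => by
    ext j
    simp [reweight, tsum_mul_right, hx1]
  simp only [hw, replicaSum]
  rw [integral_tsum_mul (prod_weight_nonneg x) (hasSum_prod_weight x (m + 1)).summable
    (fun i => (integrable_gaussianFieldKernel_eval r x _ hfi).const_mul _)
    (C := B * ∫ y, |f y| ∂gaussianReal 0 1), replicaAverage, ← tsum_mul_left]
  · refine tsum_congr fun i => ?_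
    rw [integral_const_mul, integral_gaussianFieldKernel_eval r x _ hf]
    ring
  · intro i
    simp only [abs_mul, integral_const_mul]
    rw [integral_gaussianFieldKernel_eval r x _ hf.abs]
    exact mul_le_mul_of_nonneg_right (hFB _) (integral_nonneg fun _ => abs_nonneg _)

/-- The function of the overlaps whose average is the derivative of the tilted average. -/
noncomputable def tiltObservable (F : (Fin (m + 1) → Fin (m + 1) → ℝ) → ℝ) (r : ℕ)
    (q : Fin (m + 2) → Fin (m + 2) → ℝ) : ℝ :=
  F (fun l l' => q l.castSucc l'.castSucc) *
    (∑ l : Fin (m + 1), q (Fin.last m).castSucc l.castSucc ^ r -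
      (m + 1) * q (Fin.last m).castSucc (Fin.last (m + 1)) ^ r)

/-- The corresponding function of the field. -/
noncomputable def tiltField (F : (Fin (m + 1) → Fin (m + 1) → ℝ) → ℝ) (x : OverlapStructure)
    (i : Fin (m + 1) → ℕ) (k : ℕ) (κ : ℕ → ℝ) : ℝ :=
  F (x.overlapsAt i) *
    (∑ l : Fin (m + 1), κ (i (Fin.last m)) * κ (i l) - (m + 1) * (κ (i (Fin.last m)) * κ k))

lemma integrable_tiltField (x : OverlapStructure) (i : Fin (m + 1) → ℕ) (k : ℕ) :
    Integrable (tiltField F x i k) (gaussianFieldKernel r x) :=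
  ((integrable_finsetSum _ fun _ _ => integrable_mul_gaussianFieldKernel r x _ _).sub
    ((integrable_mul_gaussianFieldKernel r x _ _).const_mul _)).const_mul _

lemma integral_tiltField (x : OverlapStructure) (j : Fin (m + 2) → ℕ) :
    ∫ κ, tiltField F x (fun l => j l.castSucc) (j (Fin.last (m + 1))) κ ∂gaussianFieldKernel r x =
      tiltObservable F r (x.overlapsAt j) := by
  unfold tiltField
  rw [integral_const_mul, integral_sub
    (integrable_finsetSum _ fun _ _ => integrable_mul_gaussianFieldKernel r x _ _)
    ((integrable_mul_gaussianFieldKernel r x _ _).const_mul _), integral_const_mul,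
    integral_finsetSum _ fun _ _ => integrable_mul_gaussianFieldKernel r x _ _]
  simp only [integral_mul_gaussianFieldKernel]
  rfl

lemma abs_tiltField_le (hFB : ∀ q, |F q| ≤ B) (x : OverlapStructure) (i : Fin (m + 1) → ℕ) (k : ℕ)
    (κ : ℕ → ℝ) : |tiltField F x i k κ| ≤
      B * (∑ l : Fin (m + 1), |κ (i (Fin.last m)) * κ (i l)| +
        (m + 1) * |κ (i (Fin.last m)) * κ k|) := by
  have hB : 0 ≤ B := (abs_nonneg _).trans (hFB 0)
  unfold tiltField
  rw [abs_mul]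
  refine mul_le_mul (hFB _) ((abs_sub _ _).trans ?_) (abs_nonneg _) hB
  rw [abs_mul ((m : ℝ) + 1), abs_of_nonneg (show (0 : ℝ) ≤ m + 1 by positivity)]
  gcongr
  exact Finset.abs_sum_le_sum_abs _ _

lemma integral_abs_tiltField_le (hFB : ∀ q, |F q| ≤ B) (x : OverlapStructure)
    (i : Fin (m + 1) → ℕ) (k : ℕ) :
    ∫ κ, |tiltField F x i k κ| ∂gaussianFieldKernel r x ≤ B * (2 * (m + 1)) := by
  have hB : 0 ≤ B := (abs_nonneg _).trans (hFB 0)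
  have hi := fun a b => (integrable_mul_gaussianFieldKernel r x a b).abs
  have hs := integrable_finsetSum (Finset.univ : Finset (Fin (m + 1)))
    fun l _ => hi (i (Fin.last m)) (i l)
  have ha : Integrable (fun κ : ℕ → ℝ => ∑ l : Fin (m + 1), |κ (i (Fin.last m)) * κ (i l)| +
      (m + 1) * |κ (i (Fin.last m)) * κ k|) (gaussianFieldKernel r x) :=
    hs.add ((hi (i (Fin.last m)) k).const_mul ((m : ℝ) + 1))
  have h1 := integral_mono (integrable_tiltField (F := F) (r := r) x i k).abs
    (ha.const_mul B) (abs_tiltField_le hFB x i k)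
  refine h1.trans ?_
  rw [integral_const_mul, integral_add hs ((hi _ _).const_mul _), integral_const_mul,
    integral_finsetSum _ fun l _ => hi (i (Fin.last m)) (i l)]
  refine mul_le_mul_of_nonneg_left ?_ hB
  have h2 : ∑ l : Fin (m + 1), ∫ κ, |κ (i (Fin.last m)) * κ (i l)| ∂gaussianFieldKernel r x ≤
      ∑ _l : Fin (m + 1), (1 : ℝ) :=
    Finset.sum_le_sum fun l _ => integral_abs_mul_gaussianFieldKernel_le r x _ _
  have h3 := mul_le_mul_of_nonneg_left
    (integral_abs_mul_gaussianFieldKernel_le r x (i (Fin.last m)) k)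
    (show (0 : ℝ) ≤ m + 1 by positivity)
  simp only [Finset.sum_const, Finset.card_univ, Fintype.card_fin, nsmul_eq_mul, mul_one] at h2
  push_cast at h2
  linarith

lemma summable_tiltField (hFB : ∀ q, |F q| ≤ B) {x : OverlapStructure} {κ : ℕ → ℝ}
    (hκ : x.HasExpMoments κ) :
    Summable fun j : Fin (m + 2) → ℕ => (∏ l, x.weight (j l)) *
      tiltField F x (fun l => j l.castSucc) (j (Fin.last (m + 1))) κ := by
  have hB : 0 ≤ B := (abs_nonneg _).trans (hFB 0)
  refine ((hasSum_prod_weight_mul_exp hκ 2 (m + 2)).summable.mul_left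
    (B * (2 * (m + 1)))).of_norm_bounded fun j => ?_
  rw [norm_mul, Real.norm_of_nonneg (prod_weight_nonneg x j), Finset.prod_mul_distrib,
    mul_left_comm]
  refine mul_le_mul_of_nonneg_left ((abs_tiltField_le hFB x _ _ κ).trans ?_)
    (prod_weight_nonneg x j)
  have h1 : ∀ l, |κ (j l)| ≤ ∏ l, Real.exp ‖κ (j l)‖ := fun l => by
    have h2 := Real.add_one_le_exp ‖κ (j l)‖
    rw [← Finset.mul_prod_erase _ _ (Finset.mem_univ l)]
    refine le_trans ?_ (le_mul_of_one_le_right (Real.exp_nonneg _)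
      (Finset.one_le_prod fun k _ => Real.one_le_exp (norm_nonneg _)))
    rw [Real.norm_eq_abs] at h2 ⊢
    linarith
  have e : ∏ l, Real.exp (2 * ‖κ (j l)‖) =
      (∏ l, Real.exp ‖κ (j l)‖) * ∏ l, Real.exp ‖κ (j l)‖ := by
    rw [← Finset.prod_mul_distrib]
    exact Finset.prod_congr rfl fun l _ => by rw [← Real.exp_add]; ring_nf
  have h3 : ∀ l l', |κ (j l) * κ (j l')| ≤ ∏ l, Real.exp (2 * ‖κ (j l)‖) := fun l l' => by
    rw [abs_mul, e]
    exact mul_le_mul (h1 l) (h1 l') (abs_nonneg _) ((abs_nonneg _).trans (h1 l))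
  rw [mul_assoc]
  refine mul_le_mul_of_nonneg_left ?_ hB
  have h4 : ∑ l : Fin (m + 1), |κ (j (Fin.last m).castSucc) * κ (j l.castSucc)| ≤
      ∑ _l : Fin (m + 1), ∏ l, Real.exp (2 * ‖κ (j l)‖) :=
    Finset.sum_le_sum fun l _ => h3 _ _
  have h5 := mul_le_mul_of_nonneg_left (h3 (Fin.last m).castSucc (Fin.last (m + 1)))
    (show (0 : ℝ) ≤ m + 1 by positivity)
  simp only [Finset.sum_const, Finset.card_univ, Fintype.card_fin, nsmul_eq_mul] at h4
  push_cast at h4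
  linarith

/-- Each of the `m + 1` tilted weights subtracts the same mean field. As an average over the
weights, this mean is an additional sampled point with multiplicity `m + 1`. -/
lemma replicaSumDeriv_eq (hFB : ∀ q, |F q| ≤ B) {x : OverlapStructure} (hx : x.IsProper)
    {κ : ℕ → ℝ} (hκ : x.HasExpMoments κ) (a : ℝ) :
    x.replicaSumDeriv x.weight F κ (fun j => a * κ j) =
      a * ∑' j : Fin (m + 2) → ℕ, (∏ l, x.weight (j l)) *
        tiltField F x (fun l => j l.castSucc) (j (Fin.last (m + 1))) κ := by
  have hx1 : ∑' j, x.weight j = 1 := hx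
  have hs : Summable fun k => x.weight k * κ k := by
    refine (hκ 1).of_norm_bounded fun k => ?_
    rw [norm_mul, Real.norm_of_nonneg (x.weight_nonneg k), one_mul]
    exact mul_le_mul_of_nonneg_left (by linarith [Real.add_one_le_exp ‖κ k‖]) (x.weight_nonneg k)
  rw [tsum_prod_weight_snoc x (G := fun i k => tiltField F x i k κ) (summable_tiltField hFB hκ),
    replicaSumDeriv, ← tsum_mul_left]
  refine tsum_congr fun i => ?_
  have e : ∀ k, x.weight k * tiltField F x i k κ =
      x.weight k * (F (x.overlapsAt i) * (κ (i (Fin.last m)) * ∑ l : Fin (m + 1), κ (i l))) -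
        x.weight k * κ k * (F (x.overlapsAt i) * ((m + 1) * κ (i (Fin.last m)))) := fun k => by
    rw [tiltField, ← Finset.mul_sum]
    ring
  have e2 : ∀ k, x.weight k * (a * κ k) = a * (x.weight k * κ k) := fun k => by ring
  simp only [e, e2]
  rw [(x.summable_weight.mul_right _).tsum_sub (hs.mul_right _), tsum_mul_right, tsum_mul_right,
    hx1, tsum_mul_left, Finset.sum_sub_distrib, ← Finset.mul_sum]
  simp only [Finset.sum_const, Finset.card_univ, Fintype.card_fin, nsmul_eq_mul]
  push_cast
  ring

lemma hasLinearGrowth_id : HasLinearGrowth fun y : ℝ => y :=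
  ⟨measurable_id, 0, 1, fun y => by simp⟩

lemma abs_le_one_mul_one_add_sq (y : ℝ) : |y| ≤ 1 * (1 + y ^ 2) := by
  nlinarith [sq_nonneg (|y| - 1), sq_abs y, abs_nonneg y]

/-- The derivative contains only products of two field values. Given the structure, their
expectations are `r`-th powers of overlaps, so the field integrates out. -/
theorem hasDerivAt_tiltedAverage_id (hψ : IsEvolutionFunction ψ) (h : ℝ) (r : ℕ)
    (hP : ∀ᵐ x ∂P, x.IsProper) (hF : Measurable F) (hFB : ∀ q, |F q| ≤ B) :
    HasDerivAt (tiltedAverage P ψ h r F fun y => y)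
      (deriv ψ h * sampledExpectation P (m + 2) (tiltObservable F r)) 0 := by
  obtain ⟨h1, h2⟩ := hasDerivAt_tiltedAverage (h := h) (r := r) hψ hP hF hFB measurable_id
    abs_le_one_mul_one_add_sq
  refine h2.congr_deriv ?_
  rw [Measure.integral_compProd h1, sampledExpectation_eq, ← integral_const_mul]
  refine integral_congr_ae ?_
  filter_upwards [hP, Measure.ae_ae_of_ae_compProd
    (ae_gaussian_isProper_hasExpMoments (r := r) hasLinearGrowth_id hP)] with x hx hκ
  have e : ∀ᵐ κ ∂gaussianFieldKernel r x,
      x.replicaSumDeriv x.weight F κ (fun j => deriv ψ h * κ j) =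
      deriv ψ h * ∑' j : Fin (m + 2) → ℕ, (∏ l, x.weight (j l)) *
        tiltField F x (fun l => j l.castSucc) (j (Fin.last (m + 1))) κ :=
    hκ.mono fun κ hk => replicaSumDeriv_eq hFB hx hk.2 _
  refine (integral_congr_ae e).trans ?_
  rw [integral_const_mul, integral_tsum_mul (prod_weight_nonneg x)
    (hasSum_prod_weight x (m + 2)).summable (fun j => integrable_tiltField x _ _)
    (fun j => integral_abs_tiltField_le hFB x _ _)]
  simp only [integral_tiltField]
  rfl

lemma tiltedAverage_affine (hψ : IsEvolutionFunction ψ) (h : ℝ) (r : ℕ)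
    (hP : ∀ᵐ x ∂P, x.IsProper) (hF : Measurable F) (hFB : ∀ q, |F q| ≤ B) (hf : Measurable f)
    {D : ℝ} (hfD : ∀ y, |f y| ≤ D * (1 + y ^ 2)) (a : ℝ) {t : ℝ}
    (ht : t ∈ Metric.ball (0 : ℝ) 1) :
    tiltedAverage P ψ h r F (fun y => a * y + f y) t =
      a * tiltedAverage P ψ h r F (fun y => y) t + tiltedAverage P ψ h r F f t := by
  obtain ⟨K, hK⟩ := hψ.bounded_deriv
  have hC := one_le_growthConst (h := h) hK
  have hs : ∀ (g : ℝ → ℝ) (D : ℝ), (∀ y, |g y| ≤ D * (1 + y ^ 2)) →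
      ∀ᵐ z ∂(P ⊗ₘ gaussianFieldKernel r), Summable fun j =>
        z.1.reweight (fun j => ψ (t * z.2 j + h)) j * |g (z.2 j)| := fun g D hg => by
    filter_upwards [ae_gaussian_isProper_hasExpMoments (r := r) (hasLinearGrowth_growthBound hC) hP]
      with z hz
    have hD : 0 ≤ D := by simpa using (abs_nonneg _).trans (hg 0)
    refine hz.2.summable_reweight_mul hz.1 (C := D * 2)
      (fun j => (abs_increment_le hψ hK ht _).1) fun j => (hg _).trans ?_
    rw [mul_assoc]
    exact mul_le_mul_of_nonneg_left (one_add_sq_le_exp_growthBound hC _) hD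
  have hid : ∀ y, |a * y| ≤ |a| * (1 + y ^ 2) := fun y => by
    rw [abs_mul]
    exact mul_le_mul_of_nonneg_left (by simpa using abs_le_one_mul_one_add_sq y) (abs_nonneg a)
  simp only [tiltedAverage]
  rw [← integral_const_mul, ← integral_add
    ((integrable_tilted (f := fun y => y) hψ hP hF hFB measurable_id abs_le_one_mul_one_add_sq ht).const_mul a)
    (integrable_tilted hψ hP hF hFB hf hfD ht)]
  refine integral_congr_ae ?_
  filter_upwards [hs _ _ hid, hs _ _ hfD] with z h1 h2
  rw [z.1.replicaSum_add hFB (z.1.reweight_nonneg _) (z.1.summable_reweight _) h1 h2,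
    replicaSum_const_mul]

end Expansion

/-! ### From the inequality to an equality. -/

section Identity

open Filter Topology

/-- Comparing first order terms in an inequality between two functions vanishing at `0`. -/
lemma deriv_eq_of_eventually_le {g k : ℝ → ℝ} {g' k' a b E C : ℝ} (hg : HasDerivAt g g' 0)
    (hk : HasDerivAt k k' 0) (hg0 : g 0 = 0) (hk0 : k 0 = 0) (ha : a ≠ 0) (hb : b ≠ 0)
    (H : ∀ v : ℝ, |v| < 1 / 2 → v ≠ 0 → ∀ᶠ ε in 𝓝[>] (0 : ℝ),
      a * (b * ε * v) * g (b * ε) ≤ E * (a * (b * ε * v) * k (b * ε * (1 + v))) + C * |b * ε| ^ 3) :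
    g' = E * k' := by
  have slope : ∀ {f : ℝ → ℝ} {f' : ℝ} (_ : HasDerivAt f f' 0) (_ : f 0 = 0) (c : ℝ),
      Tendsto (fun ε => f (c * ε) / ε) (𝓝[>] 0) (𝓝 (f' * c)) := by
    intro f f' hf hf0 c
    have h1 : HasDerivAt (fun ε : ℝ => c * ε) c 0 := by simpa using (hasDerivAt_id (0 : ℝ)).const_mul c
    have h2 : HasDerivAt (fun ε => f (c * ε)) (f' * c) 0 :=
      HasDerivAt.comp (h₂ := f) 0 (by simpa using hf) h1
    refine h2.tendsto_slope_zero_right.congr fun ε => ?_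
    simp [hf0, div_eq_inv_mul]
  -- The two main terms are of order `ε²`: one factor comes from the difference of the parameters
  -- and one from the vanishing of `g` and `k` at `0`. Division by `ε²` removes the cubic error.
  have key : ∀ v : ℝ, |v| < 1 / 2 → v ≠ 0 → a * v * g' ≤ a * v * (E * k' * (1 + v)) := by
    intro v hv hv0
    have t1 := (slope hg hg0 b).const_mul (a * b * v)
    have t2 := ((slope hk hk0 (b * (1 + v))).const_mul (E * (a * b * v))).add
      ((continuous_const_mul (C * |b| ^ 3)).tendsto 0 |>.mono_left nhdsWithin_le_nhds)
    have h1 := le_of_tendsto_of_tendsto t1 t2 (by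
      filter_upwards [H v hv hv0, self_mem_nhdsWithin] with ε hε hpos
      have hpos' : 0 < ε := hpos
      rw [abs_mul, abs_of_pos hpos'] at hε
      have h2 := div_le_div_of_nonneg_right hε (sq_nonneg ε)
      have e1 : a * (b * ε * v) * g (b * ε) / ε ^ 2 = a * b * v * (g (b * ε) / ε) := by
        field_simp
      have e2 : (E * (a * (b * ε * v) * k (b * ε * (1 + v))) + C * (|b| * ε) ^ 3) / ε ^ 2 =
          E * (a * b * v) * (k (b * (1 + v) * ε) / ε) + C * |b| ^ 3 * ε := by
        rw [show b * (1 + v) * ε = b * ε * (1 + v) by ring]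
        field_simp
      rw [e1, e2] at h2
      exact h2)
    have hb2 : 0 < b ^ 2 := by positivity
    have h3 : b ^ 2 * (a * v * g') ≤ b ^ 2 * (a * v * (E * k' * (1 + v))) := by
      linarith
    exact le_of_mul_le_mul_left h3 hb2
  have hlim : Tendsto (fun v : ℝ => a * (E * k' * (1 + v))) (𝓝 0) (𝓝 (a * (E * k' * (1 + 0)))) :=
    Continuous.tendsto (by fun_prop) 0
  simp only [add_zero, mul_one] at hlim
  have hsmall : ∀ᶠ v in 𝓝 (0 : ℝ), |v| < 1 / 2 :=
    (continuous_abs.tendsto 0).eventually_lt_const (by norm_num)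
  -- Cancelling `v` keeps the inequality for `v > 0` and reverses it for `v < 0`; the limits `v → 0`
  -- from the two sides give both directions.
  have hle : a * g' ≤ a * (E * k') := by
    refine ge_of_tendsto (hlim.mono_left (nhdsWithin_le_nhds (s := Set.Ioi 0))) ?_
    filter_upwards [nhdsWithin_le_nhds hsmall, self_mem_nhdsWithin] with v hv hpos
    have hpos' : 0 < v := hpos
    have := key v hv hpos'.ne'
    refine le_of_mul_le_mul_left ?_ hpos'
    linarith
  have hge : a * (E * k') ≤ a * g' := by
    refine le_of_tendsto (hlim.mono_left (nhdsWithin_le_nhds (s := Set.Iio 0))) ?_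
    filter_upwards [nhdsWithin_le_nhds hsmall, self_mem_nhdsWithin] with v hv hneg
    have hneg' : v < 0 := hneg
    have := key v hv hneg'.ne
    refine le_of_mul_le_mul_left ?_ (neg_pos.2 hneg')
    linarith
  exact mul_left_cancel₀ ha (le_antisymm hle hge)

variable {m : ℕ} {F : (Fin (m + 1) → Fin (m + 1) → ℝ) → ℝ} {B : ℝ}
  {P : Measure OverlapStructure} [IsProbabilityMeasure P] {ψ : ℝ → ℝ} {h : ℝ} {r : ℕ}

lemma abs_evolutionFunction_sub_le {K : ℝ} (hψ : IsEvolutionFunction ψ)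
    (hK : ∀ x, |deriv ψ x| ≤ K) (h t u y : ℝ) :
    |ψ (u * y + h) - ψ (t * y + h)| ≤ K * |u - t| * (1 + y ^ 2) := by
  have hK0 : 0 ≤ K := (abs_nonneg _).trans (hK 0)
  have h1 := abs_sub_le_of_abs_deriv_le hψ.differentiable hK (t * y + h) (u * y + h)
  rw [show u * y + h - (t * y + h) = (u - t) * y by ring, abs_mul, ← mul_assoc] at h1
  exact h1.trans (mul_le_mul_of_nonneg_left (by simpa using abs_le_one_mul_one_add_sq y)
    (by positivity))

lemma integral_meanPairGibbs_eq (hψ : IsEvolutionFunction ψ) (hP : ∀ᵐ x ∂P, x.IsProper)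
    (hF : Measurable F) (hFB : ∀ q, |F q| ≤ B) {t : ℝ} (ht : t ∈ Metric.ball (0 : ℝ) 1) (u : ℝ) :
    ∫ x, meanPairGibbs F (fun y => (ψ (t * y + h), ψ (u * y + h))) r 1 x ∂P =
      tiltedAverage P ψ h r F (fun y => ψ (u * y + h) - ψ (t * y + h)) t := by
  obtain ⟨K, hK⟩ := hψ.bounded_deriv
  have hm := hψ.differentiable.continuous.measurable
  rw [tiltedAverage, Measure.integral_compProd (integrable_tilted
    (f := fun y => ψ (u * y + h) - ψ (t * y + h)) hψ hP hF hFB (by fun_prop)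
    (abs_evolutionFunction_sub_le hψ hK h t u) ht)]
  refine integral_congr_ae (Eventually.of_forall fun x => ?_)
  have hp : Measurable fun y => (ψ (t * y + h), ψ (u * y + h)) := by fun_prop
  simp only [meanPairGibbs]
  rw [walkKernel_one, incrementKernel_apply hp, integral_map (measurable_pi_comp hp).aemeasurable
    (measurable_pairGibbs_left hF x).aestronglyMeasurable]
  rfl

lemma integral_sampleAverage_one (hP : ∀ᵐ x ∂P, x.IsProper) :
    ∫ x, sampleAverage (m := m) (fun _ => 1) x ∂P = 1 := by
  have : sampleAverage (m := m) (fun _ => 1) =ᵐ[P] fun _ => 1 := by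
    filter_upwards [hP] with x hx
    have hx1 : ∑' j, x.weight j = 1 := hx
    rw [sampleAverage_eq_replicaAverage]
    simp only [replicaAverage, mul_one]
    rw [(hasSum_prod_weight x (m + 1)).tsum_eq, hx1, one_pow]
  rw [integral_congr_ae this]
  simp

/-- The average of the increment at `t`, weighted by a nonnegative function of the overlaps, is
bounded in terms of the average of the increment at `u`. -/
lemma tiltedAverage_sub_le (hψ : IsEvolutionFunction ψ) (hP : ∀ᵐ x ∂P, x.IsProper)
    (hF : Measurable F) (hF0 : ∀ q, 0 ≤ F q) (hFB : ∀ q, |F q| ≤ B) {t u : ℝ}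
    (ht : t ∈ Metric.ball (0 : ℝ) 1) (hu : u ∈ Metric.ball (0 : ℝ) 1)
    (st : IsQuasiStationary P (fun y => ψ (t * y + h)) r)
    (su : IsQuasiStationary P (fun y => ψ (u * y + h)) r)
    (et : IsErgodicEvolution P (fun y => ψ (t * y + h)) r)
    (eu : IsErgodicEvolution P (fun y => ψ (u * y + h)) r) :
    tiltedAverage P ψ h r F (fun y => ψ (u * y + h) - ψ (t * y + h)) t ≤
      sampledExpectation P (m + 1) F *
        tiltedAverage P ψ h r (m := 0) (fun _ => 1) (fun y => ψ (u * y + h) - ψ (t * y + h)) u := by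
  have h1 := integral_meanPairGibbs_one_le hF hF0 hFB (hψ.hasLinearGrowth_pair h t u) hP st su et eu
  -- With `F = 1` and the parameters exchanged, the same inequality bounds the free energy
  -- difference from above by an average tilted at `u`.
  have h2 := integral_meanPairGibbs_one_le (m := 0) (F := fun _ => 1) (B := 1) measurable_const
    (fun _ => zero_le_one) (by simp) (hψ.hasLinearGrowth_pair h u t) hP su st eu et
  rw [integral_meanPairGibbs_eq hψ hP hF hFB ht u, sampleAverage_eq_replicaAverage,
    ← sampledExpectation_eq] at h1
  rw [integral_meanPairGibbs_eq (B := 1) hψ hP measurable_const (by simp) hu t,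
    integral_sampleAverage_one hP, one_mul] at h2
  have h3 : tiltedAverage P ψ h r (m := 0) (fun _ => 1)
      (fun y => ψ (t * y + h) - ψ (u * y + h)) u = - tiltedAverage P ψ h r (m := 0) (fun _ => 1)
      (fun y => ψ (u * y + h) - ψ (t * y + h)) u := by
    rw [tiltedAverage, tiltedAverage, ← integral_neg]
    refine integral_congr_ae (Eventually.of_forall fun z => ?_)
    simp only
    rw [← neg_one_mul, ← replicaSum_const_mul]
    simp
  rw [h3] at h2
  have hE : 0 ≤ sampledExpectation P (m + 1) F := by
    rw [sampledExpectation_eq, ← sampleAverage_eq_replicaAverage]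
    exact integral_nonneg fun x => sampleAverage_nonneg hF0 x
  refine h1.trans (mul_le_mul_of_nonneg_left ?_ hE)
  linarith

/-- Both increments are linearized at `h`. The remainder has size `t²`, and at zero tilt its
averages on the two sides are the same Gaussian integral times the expectation of `F`. They cancel,
and the tilts contribute only order `|t|³`. -/
lemma exists_tiltedAverage_id_le (hψ : IsEvolutionFunction ψ) (h : ℝ) (r : ℕ)
    (hP : ∀ᵐ x ∂P, x.IsProper)
    (hF : Measurable F) (hF0 : ∀ q, 0 ≤ F q) (hFB : ∀ q, |F q| ≤ B) :
    ∃ C, ∀ t ∈ Metric.ball (0 : ℝ) 1, ∀ u ∈ Metric.ball (0 : ℝ) 1, |u| ≤ 2 * |t| →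
      IsQuasiStationary P (fun y => ψ (t * y + h)) r →
      IsQuasiStationary P (fun y => ψ (u * y + h)) r →
      IsErgodicEvolution P (fun y => ψ (t * y + h)) r →
      IsErgodicEvolution P (fun y => ψ (u * y + h)) r →
      deriv ψ h * (u - t) * tiltedAverage P ψ h r F (fun y => y) t ≤
        sampledExpectation P (m + 1) F * (deriv ψ h * (u - t) *
          tiltedAverage P ψ h r (m := 0) (fun _ => 1) (fun y => y) u) + C * |t| ^ 3 := by
  obtain ⟨K, hK⟩ := hψ.bounded_deriv2
  have hK0 : 0 ≤ K := (abs_nonneg _).trans (hK 0)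
  have hm := hψ.differentiable.continuous.measurable
  obtain ⟨C, hC⟩ := exists_tiltedAverage_sub_le hψ h r hP hF hFB
  obtain ⟨C', hC'⟩ := exists_tiltedAverage_sub_le (P := P) (m := 0) (F := fun _ => 1) (B := 1)
    hψ h r hP measurable_const (by simp)
  set S := sampledExpectation P (m + 1) F with hS
  have hE : 0 ≤ S := by
    rw [hS, sampledExpectation_eq, ← sampleAverage_eq_replicaAverage]
    exact integral_nonneg fun x => sampleAverage_nonneg hF0 x
  -- From `|u| ≤ 2 |t|` come `u² + t² ≤ 5 t²` and the factor `2` on the side tilted at `u`.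
  refine ⟨5 * K * (|C| + 2 * S * |C'|), fun t ht u hu hut st su et eu => ?_⟩
  set a := deriv ψ h * (u - t) with ha
  set R : ℝ → ℝ := fun y => ψ (u * y + h) - ψ (t * y + h) - a * y with hR
  have hRm : Measurable R := by fun_prop
  set D := K * (u ^ 2 + t ^ 2) with hD
  have hRD : ∀ y, |R y| ≤ D * (1 + y ^ 2) := fun y => by
    have h1 := abs_sub_sub_mul_le_sq hψ.differentiable hψ.differentiable_deriv hK h (u * y)
    have h2 := abs_sub_sub_mul_le_sq hψ.differentiable hψ.differentiable_deriv hK h (t * y)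
    have h3 := abs_sub (ψ (u * y + h) - ψ h - deriv ψ h * (u * y))
      (ψ (t * y + h) - ψ h - deriv ψ h * (t * y))
    have e : R y = ψ (u * y + h) - ψ h - deriv ψ h * (u * y) -
      (ψ (t * y + h) - ψ h - deriv ψ h * (t * y)) := by rw [hR, ha]; ring
    rw [e]
    have h4 : K * (u * y) ^ 2 + K * (t * y) ^ 2 = D * y ^ 2 := by rw [hD]; ring
    have h5 : 0 ≤ D := by positivity
    linarith
  have hfun : (fun y => ψ (u * y + h) - ψ (t * y + h)) = fun y => a * y + R y := by
    ext y
    rw [hR]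
    ring
  have h1 := tiltedAverage_sub_le hψ hP hF hF0 hFB ht hu st su et eu
  rw [hfun, tiltedAverage_affine hψ h r hP hF hFB hRm hRD a ht,
    tiltedAverage_affine (B := 1) hψ h r hP measurable_const (by simp) hRm hRD a hu] at h1
  have h2 := hC R D hRm hRD t ht
  have h3 := hC' R D hRm hRD u hu
  have hone : sampledExpectation P (0 + 1) (fun _ => (1 : ℝ)) = 1 := by
    rw [sampledExpectation_eq, ← sampleAverage_eq_replicaAverage, integral_sampleAverage_one hP]
  rw [tiltedAverage_zero hψ h r hP hF hFB hRm hRD] at h2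
  rw [tiltedAverage_zero (B := 1) hψ h r hP measurable_const (by simp) hRm hRD, hone] at h3
  set γ := ∫ y, R y ∂gaussianReal 0 1 with hγ
  have h4 := neg_abs_le (tiltedAverage P ψ h r F R t - γ * sampledExpectation P (m + 1) F)
  have h5 := mul_le_mul_of_nonneg_left ((le_abs_self _).trans h3) hE
  have hD5 : D ≤ 5 * K * |t| ^ 2 := by
    have : u ^ 2 ≤ (2 * |t|) ^ 2 := by rw [← sq_abs u]; gcongr
    rw [hD, ← sq_abs t]
    nlinarith
  have hD0 : 0 ≤ D := by positivity
  have h6 : C * D * |t| ≤ |C| * (5 * K * |t| ^ 2) * |t| := by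
    gcongr
    exact le_abs_self C
  have h7 : C' * D * |u| ≤ |C'| * (5 * K * |t| ^ 2) * (2 * |t|) := by
    gcongr
    exact le_abs_self C'
  have h8 := mul_le_mul_of_nonneg_left h7 hE
  rw [← hS] at h2 h4
  nlinarith [h1, h2, h4, h5, h6, h8]

/-- The derivatives at `0` of the averages of the field with `F` and with `1` are compared along `β
= b ε` and `β = b ε (1 + v)`. Both points are nonzero and lie between `0` and `b`, so the interval
contains them on whichever side of `0` it extends. -/
theorem sampledExpectation_tiltObservable (hψ : IsEvolutionFunction ψ) (hh : deriv ψ h ≠ 0)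
    {J : Set ℝ} (hJ : J.OrdConnected) (hJ0 : 0 ∈ J) (hJnt : J.Nontrivial)
    (hstat : ∀ β ∈ J, IsQuasiStationary P (fun y => ψ (β * y + h)) r)
    (herg : ∀ β ∈ J, β ≠ 0 → IsErgodicEvolution P (fun y => ψ (β * y + h)) r)
    (hP : ∀ᵐ x ∂P, x.IsProper)
    (hF : Measurable F) (hF0 : ∀ q, 0 ≤ F q) (hFB : ∀ q, |F q| ≤ B) :
    sampledExpectation P (m + 2) (tiltObservable F r) =
      sampledExpectation P (m + 1) F *
        sampledExpectation P 2 (tiltObservable (m := 0) (fun _ => 1) r) := by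
  obtain ⟨b, hbJ, hb⟩ := hJnt.exists_ne 0
  obtain ⟨C, hC⟩ := exists_tiltedAverage_id_le hψ h r hP hF hF0 hFB
  have hmem : ∀ c : ℝ, 0 < c → c < 1 → b * c ∈ J ∧ b * c ≠ 0 := fun c hc0 hc1 => by
    refine ⟨hJ.uIcc_subset hJ0 hbJ ?_, mul_ne_zero hb hc0.ne'⟩
    rcases le_total 0 b with h | h
    · rw [Set.uIcc_of_le h]
      exact ⟨by positivity, mul_le_of_le_one_right h hc1.le⟩
    · rw [Set.uIcc_of_ge h]
      exact ⟨by nlinarith, by nlinarith⟩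
  have hmeas : Measurable fun _ : Fin (0 + 1) → Fin (0 + 1) → ℝ => (1 : ℝ) := measurable_const
  have hg0 : tiltedAverage P ψ h r F (fun y => y) 0 = 0 := by
    rw [tiltedAverage_zero (f := fun y => y) hψ h r hP hF hFB measurable_id
      abs_le_one_mul_one_add_sq, integral_id_gaussianReal, zero_mul]
  have hk0 : tiltedAverage P ψ h r (m := 0) (fun _ => 1) (fun y => y) 0 = 0 := by
    rw [tiltedAverage_zero (f := fun y => y) (B := 1) hψ h r hP hmeas (by simp) measurable_id
      abs_le_one_mul_one_add_sq, integral_id_gaussianReal, zero_mul]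
  have h1 := deriv_eq_of_eventually_le (C := C) (E := sampledExpectation P (m + 1) F)
    (hasDerivAt_tiltedAverage_id hψ h r hP hF hFB)
    (hasDerivAt_tiltedAverage_id (B := 1) hψ h r hP hmeas (by simp)) hg0 hk0 hh hb (by
      intro v hv hv0
      have hsmall : ∀ᶠ ε in 𝓝[>] (0 : ℝ), |b * ε| < 1 / 2 := by
        have : Tendsto (fun ε : ℝ => |b * ε|) (𝓝 0) (𝓝 |b * 0|) := Continuous.tendsto (by fun_prop) 0
        rw [mul_zero, abs_zero] at this
        exact nhdsWithin_le_nhds (this.eventually_lt_const (by norm_num))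
      have hlt : ∀ᶠ ε in 𝓝[>] (0 : ℝ), ε < 1 / 2 :=
        nhdsWithin_le_nhds (eventually_lt_nhds (by norm_num))
      filter_upwards [hsmall, hlt, self_mem_nhdsWithin] with ε hε1 hε2 hε
      have hε' : 0 < ε := hε
      have hv' := abs_lt.1 hv
      -- Together with `ε < 1 / 2` and `|b ε| < 1 / 2`, this keeps the second parameter in `J` and
      -- in the unit ball, and makes it at most twice the first in absolute value.
      have hv2 : |1 + v| ≤ 3 / 2 := abs_le.2 ⟨by linarith, by linarith⟩
      have hu : |b * ε * (1 + v)| ≤ |b * ε| * (3 / 2) := by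
        rw [abs_mul]
        exact mul_le_mul_of_nonneg_left hv2 (abs_nonneg _)
      have m1 := hmem ε hε' (by linarith)
      have m2 := hmem (ε * (1 + v)) (mul_pos hε' (by linarith)) (by nlinarith)
      rw [← mul_assoc] at m2
      have := hC (b * ε) (by rw [mem_ball_zero_iff, Real.norm_eq_abs]; linarith)
        (b * ε * (1 + v)) (by rw [mem_ball_zero_iff, Real.norm_eq_abs]; linarith)
        (by linarith [abs_nonneg (b * ε)]) (hstat _ m1.1) (hstat _ m2.1) (herg _ m1.1 m1.2)
        (herg _ m2.1 m2.2)
      rw [show b * ε * (1 + v) - b * ε = b * ε * v by ring] at this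
      exact this)
  refine mul_left_cancel₀ hh (h1.trans ?_)
  ring

end Identity

/-! ### The identity for general functions of the overlaps. -/

section Main

variable {m : ℕ} {F : (Fin (m + 1) → Fin (m + 1) → ℝ) → ℝ} {B : ℝ}
  {P : Measure OverlapStructure} [IsProbabilityMeasure P] {ψ : ℝ → ℝ} {h : ℝ} {r : ℕ}

lemma abs_overlap_pow_mul_le {s s' : ℕ} {F : (Fin s' → Fin s' → ℝ) → ℝ} (hFB : ∀ q, |F q| ≤ B)
    (T : (Fin s → Fin s → ℝ) → Fin s' → Fin s' → ℝ) (a b : Fin s) (r : ℕ)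
    (x : OverlapStructure) (i : Fin s → ℕ) :
    |x.overlapsAt i a b ^ r * F (T (x.overlapsAt i))| ≤ B := by
  rw [abs_mul]
  exact (mul_le_of_le_one_left (abs_nonneg _) (abs_overlap_pow_le x _ _ r)).trans (hFB _)

lemma measurable_overlap_pow_mul {s s' : ℕ} {F : (Fin s' → Fin s' → ℝ) → ℝ} (hF : Measurable F)
    {T : (Fin s → Fin s → ℝ) → Fin s' → Fin s' → ℝ} (hT : Measurable T) (a b : Fin s) (r : ℕ) :
    Measurable fun q : Fin s → Fin s → ℝ => q a b ^ r * F (T q) :=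
  Measurable.mul (by fun_prop) (hF.comp hT)

lemma overlapsAt_symm {s : ℕ} (x : OverlapStructure) (i : Fin s → ℕ) (a b : Fin s) :
    x.overlapsAt i a b = x.overlapsAt i b a := by
  have := x.2.2.2.2.2.1.isHermitian.apply (i b) (i a)
  simpa [overlapsAt, overlap] using this

/-- The term of the last point with itself is one, because self-overlaps are one; the other terms do
not involve the additional point, which integrates out since the weights sum to one. -/
lemma sampledExpectation_tiltObservable_eq (hP : ∀ᵐ x ∂P, x.IsProper) (hF : Measurable F)
    (hFB : ∀ q, |F q| ≤ B) (r : ℕ) :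
    sampledExpectation P (m + 2) (tiltObservable F r) =
      sampledExpectation P (m + 1) F +
        ∑ l ∈ Finset.Iio (Fin.last m), sampledExpectation P (m + 1)
          (fun q => q l (Fin.last m) ^ r * F q) -
        (m + 1) * sampledExpectation P (m + 2) (fun q =>
          q (Fin.last m).castSucc (Fin.last (m + 1)) ^ r *
            F fun l l' => q l.castSucc l'.castSucc) := by
  have hT : Measurable fun (q : Fin (m + 2) → Fin (m + 2) → ℝ) (l l' : Fin (m + 1)) =>
      q l.castSucc l'.castSucc := by fun_prop
  have hm := fun a b => measurable_overlap_pow_mul hF hT a b r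
  have hb := fun a b => abs_overlap_pow_mul_le hFB
    (fun (q : Fin (m + 2) → Fin (m + 2) → ℝ) (l l' : Fin (m + 1)) => q l.castSucc l'.castSucc) a b r
  have e : tiltObservable F r = fun q =>
      ∑ l : Fin (m + 1), q (Fin.last m).castSucc l.castSucc ^ r *
        F (fun l l' => q l.castSucc l'.castSucc) +
      -((m : ℝ) + 1) * (q (Fin.last m).castSucc (Fin.last (m + 1)) ^ r *
            F fun l l' => q l.castSucc l'.castSucc) := by
    ext q
    rw [tiltObservable, ← Finset.sum_mul]
    ring
  rw [e, sampledExpectation_add (B := (m + 1) * B) (B' := (m + 1) * B)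
    (Finset.measurable_sum _ fun l _ => hm _ _) (fun x i => ?_)
    ((hm _ _).const_mul _) (fun x i => ?_), sampledExpectation_const_mul,
    sampledExpectation_sum _ (fun l => hm _ _) (fun l => hb _ _)]
  · have e2 : ∀ l : Fin (m + 1), sampledExpectation P (m + 2) (fun q =>
        q (Fin.last m).castSucc l.castSucc ^ r * F fun l l' => q l.castSucc l'.castSucc) =
        sampledExpectation P (m + 1) (fun q => q l (Fin.last m) ^ r * F q) := fun l => by
      rw [← sampledExpectation_castSucc hP (H := fun q => q l (Fin.last m) ^ r * F q)
        (fun x i => abs_overlap_pow_mul_le hFB id _ _ r x i)]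
      refine sampledExpectation_congr fun x i => ?_
      rw [overlapsAt_symm]
    have e3 : sampledExpectation P (m + 1) (fun q => q (Fin.last m) (Fin.last m) ^ r * F q) =
        sampledExpectation P (m + 1) F := sampledExpectation_congr fun x i => by
      rw [show x.overlapsAt i (Fin.last m) (Fin.last m) = 1 from overlap_self x _, one_pow, one_mul]
    have e4 : (Finset.univ : Finset (Fin (m + 1))) =
        insert (Fin.last m) (Finset.Iio (Fin.last m)) := by
      ext l
      simpa only [Finset.mem_univ, Finset.mem_insert, Finset.mem_Iio, true_iff] using
        (Fin.le_last l).eq_or_lt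
    simp only [e2]
    rw [e4, Finset.sum_insert (by simp), e3]
    ring
  · refine (Finset.abs_sum_le_sum_abs _ _).trans ((Finset.sum_le_sum fun l _ => hb _ _ x i).trans ?_)
    simp
  · rw [abs_mul, abs_neg, abs_of_nonneg (show (0 : ℝ) ≤ m + 1 by positivity)]
    exact mul_le_mul_of_nonneg_left (hb _ _ x i) (by positivity)

/-- The difference of the two sides of the identity, as a function of `F`. -/
noncomputable def ggDefect (P : Measure OverlapStructure) (r : ℕ)
    (F : (Fin (m + 1) → Fin (m + 1) → ℝ) → ℝ) : ℝ :=
  (m + 1) * sampledExpectation P (m + 2) (fun q =>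
      q (Fin.last m).castSucc (Fin.last (m + 1)) ^ r * F fun l l' => q l.castSucc l'.castSucc) -
    sampledExpectation P 2 (fun q => q 0 1 ^ r) * sampledExpectation P (m + 1) F -
    ∑ l ∈ Finset.Iio (Fin.last m), sampledExpectation P (m + 1)
      (fun q => q l (Fin.last m) ^ r * F q)

lemma ggDefect_add {F' : (Fin (m + 1) → Fin (m + 1) → ℝ) → ℝ} {B' : ℝ} (hF : Measurable F)
    (hFB : ∀ q, |F q| ≤ B) (hF' : Measurable F') (hFB' : ∀ q, |F' q| ≤ B') (r : ℕ) :
    ggDefect P r (fun q => F q + F' q) = ggDefect P r F + ggDefect P r F' := by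
  have hT : Measurable fun (q : Fin (m + 2) → Fin (m + 2) → ℝ) (l l' : Fin (m + 1)) =>
      q l.castSucc l'.castSucc := by fun_prop
  set T : (Fin (m + 2) → Fin (m + 2) → ℝ) → Fin (m + 1) → Fin (m + 1) → ℝ :=
    fun q l l' => q l.castSucc l'.castSucc
  simp only [ggDefect, mul_add]
  rw [sampledExpectation_add (measurable_overlap_pow_mul hF hT _ _ r)
    (abs_overlap_pow_mul_le hFB T _ _ r) (measurable_overlap_pow_mul hF' hT _ _ r)
    (abs_overlap_pow_mul_le hFB' T _ _ r),
    sampledExpectation_add hF (fun x i => hFB _) hF' (fun x i => hFB' _)]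
  have : ∀ l : Fin (m + 1), sampledExpectation P (m + 1)
      (fun q => q l (Fin.last m) ^ r * F q + q l (Fin.last m) ^ r * F' q) =
      sampledExpectation P (m + 1) (fun q => q l (Fin.last m) ^ r * F q) +
      sampledExpectation P (m + 1) (fun q => q l (Fin.last m) ^ r * F' q) := fun l =>
    sampledExpectation_add (measurable_overlap_pow_mul hF measurable_id _ _ r)
      (abs_overlap_pow_mul_le hFB id _ _ r) (measurable_overlap_pow_mul hF' measurable_id _ _ r)
      (abs_overlap_pow_mul_le hFB' id _ _ r)
  simp only [this, Finset.sum_add_distrib]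
  ring

/-- For a single point and `F = 1`, the derivative reduces to one minus the mean `r`-th power of the
overlap of two points. Inserting this cancels the expectation of `F` coming from the self-overlap.
-/
lemma ggDefect_eq_zero_of_nonneg (hψ : IsEvolutionFunction ψ) (hh : deriv ψ h ≠ 0)
    {J : Set ℝ} (hJ : J.OrdConnected) (hJ0 : 0 ∈ J) (hJnt : J.Nontrivial)
    (hstat : ∀ β ∈ J, IsQuasiStationary P (fun y => ψ (β * y + h)) r)
    (herg : ∀ β ∈ J, β ≠ 0 → IsErgodicEvolution P (fun y => ψ (β * y + h)) r)
    (hP : ∀ᵐ x ∂P, x.IsProper)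
    (hF : Measurable F) (hF0 : ∀ q, 0 ≤ F q) (hFB : ∀ q, |F q| ≤ B) :
    ggDefect P r F = 0 := by
  have h1 := sampledExpectation_tiltObservable hψ hh hJ hJ0 hJnt hstat herg hP hF hF0 hFB
  rw [sampledExpectation_tiltObservable_eq hP hF hFB,
    sampledExpectation_tiltObservable_eq (m := 0) (B := 1) hP measurable_const (by simp)] at h1
  have hone : sampledExpectation P (0 + 1) (fun _ => (1 : ℝ)) = 1 := by
    rw [sampledExpectation_eq, ← sampleAverage_eq_replicaAverage, integral_sampleAverage_one hP]
  rw [hone] at h1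
  have e : Finset.Iio (Fin.last 0) = ∅ := by decide
  simp only [e, Finset.sum_empty, mul_one, Nat.cast_zero, zero_add, one_mul, add_zero] at h1
  rw [ggDefect]
  change _ = _ * (1 - sampledExpectation P 2 (fun q => q 0 1 ^ r)) at h1
  linarith

/-- The entropy argument needs a nonnegative `F`; adding the constant `B` achieves this, and the
defect is additive and vanishes on constants that are nonnegative. -/
lemma ggDefect_eq_zero (hψ : IsEvolutionFunction ψ) (hh : deriv ψ h ≠ 0)
    {J : Set ℝ} (hJ : J.OrdConnected) (hJ0 : 0 ∈ J) (hJnt : J.Nontrivial)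
    (hstat : ∀ β ∈ J, IsQuasiStationary P (fun y => ψ (β * y + h)) r)
    (herg : ∀ β ∈ J, β ≠ 0 → IsErgodicEvolution P (fun y => ψ (β * y + h)) r)
    (hP : ∀ᵐ x ∂P, x.IsProper) (hF : Measurable F) (hFB : ∀ q, |F q| ≤ B) :
    ggDefect P r F = 0 := by
  have hB : 0 ≤ B := (abs_nonneg _).trans (hFB 0)
  have h1 : ggDefect P r (fun q => F q + B) = 0 :=
    ggDefect_eq_zero_of_nonneg (B := B + B) hψ hh hJ hJ0 hJnt hstat herg hP (hF.add_const B)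
      (fun q => by linarith [neg_abs_le (F q), hFB q])
      fun q => (abs_add_le _ _).trans (by rw [abs_of_nonneg hB]; linarith [hFB q])
  have h2 : ggDefect P r (fun _ : Fin (m + 1) → Fin (m + 1) → ℝ => B) = 0 :=
    ggDefect_eq_zero_of_nonneg (B := B) hψ hh hJ hJ0 hJnt hstat herg hP measurable_const
      (fun _ => hB) fun _ => (abs_of_nonneg hB).le
  rw [ggDefect_add hF hFB measurable_const (fun _ => (abs_of_nonneg hB).le), h2, add_zero] at h1
  exact h1

lemma sampledExpectation_eq_zero (h : ∀ᵐ x ∂P, ∀ i, x.weight i = 0)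
    (H : (Fin (m + 1) → Fin (m + 1) → ℝ) → ℝ) : sampledExpectation P (m + 1) H = 0 := by
  rw [sampledExpectation_eq]
  refine integral_eq_zero_of_ae ?_
  filter_upwards [h] with x hx
  simp [replicaAverage, hx]

end Main

theorem proposition3p3
    (P : Measure OverlapStructure) [IsProbabilityMeasure P]
    (ψ : ℝ → ℝ) (hψ : IsEvolutionFunction ψ)
    (h : ℝ) (hh : deriv ψ h ≠ 0)
    (r : ℕ) (hr : 1 ≤ r)
    (J : Set ℝ) (hJ : J.OrdConnected) (hJ0 : 0 ∈ J) (hJnt : J.Nontrivial)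
    (hstat : ∀ β ∈ J, IsQuasiStationary P (fun y => ψ (β * y + h)) r)
    (herg : ∀ β ∈ J, β ≠ 0 → IsErgodicEvolution P (fun y => ψ (β * y + h)) r)
    (s : ℕ) (hs : 1 ≤ s)
    (F : (Fin s → Fin s → ℝ) → ℝ) (hF : Measurable F) (hFb : ∃ B, ∀ q, |F q| ≤ B) :
    sampledExpectation P (s + 1)
        (fun q => q (Fin.castSucc ⟨s - 1, by omega⟩) (Fin.last s) ^ r *
          F (fun l l' => q l.castSucc l'.castSucc)) =
      1 / (s : ℝ) * sampledExpectation P 2 (fun q => q 0 1 ^ r) * sampledExpectation P s F +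
        1 / (s : ℝ) * ∑ l ∈ Finset.Iio (⟨s - 1, by omega⟩ : Fin s),
          sampledExpectation P s (fun q => q l ⟨s - 1, by omega⟩ ^ r * F q) := by
  obtain ⟨m, rfl⟩ : ∃ m, s = m + 1 := ⟨s - 1, by omega⟩
  obtain ⟨B, hFB⟩ := hFb
  obtain ⟨b, hbJ, hb⟩ := hJnt.exists_ne 0
  change sampledExpectation P (m + 2) (fun q =>
      q (Fin.last m).castSucc (Fin.last (m + 1)) ^ r * F fun l l' => q l.castSucc l'.castSucc) =
    1 / ((m + 1 : ℕ) : ℝ) * sampledExpectation P 2 (fun q => q 0 1 ^ r) *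
      sampledExpectation P (m + 1) F + 1 / ((m + 1 : ℕ) : ℝ) *
      ∑ l ∈ Finset.Iio (Fin.last m), sampledExpectation P (m + 1)
        (fun q => q l (Fin.last m) ^ r * F q)
  -- A nonzero parameter of `J` is used, since ergodicity is available only there. If the weights
  -- vanish, both sides are zero because at least one point is sampled.
  rcases ae_weight_eq_zero_or_ae_isProper (hψ.hasLinearGrowth_pair h b b).fst (hstat b hbJ)
    (herg b hbJ hb) with h0 | hP
  · rw [sampledExpectation_eq_zero h0, sampledExpectation_eq_zero h0]
    simp only [sampledExpectation_eq_zero h0]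
    simp
  · have h1 := ggDefect_eq_zero hψ hh hJ hJ0 hJnt hstat herg hP hF hFB
    rw [ggDefect] at h1
    push_cast
    have hm : (m : ℝ) + 1 ≠ 0 := by positivity
    field_simp
    linarith
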